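/- Let $\mathbb{T}=\mathbb{R}/\mathbb{Z}$ and let $\varphi:\mathbb{T}\to(0,\infty)$ be a $C^3$ function with Fourier coefficients $c_m$, so that $\varphi(x)=\sum_{m\in\mathbb{Z}}c_me^{2\pi i m x}$. Suppose that [H1] there are real numbers $C_m$ $(m\ge 1)$ with $\sum_{m\ge1}|C_m|<\infty$ and $\sum_{l=2}^\infty|c_{lm}|^2\le C_m|c_m|^2$ for all sufficiently large $m$; [H2] there is $0<K_1<1/4$ with $\sum_{l=2}^\infty|c_{lm}|\le K_1|c_m|$ for all sufficiently large $m$; [H3] there is $K_2>0$ with $\sum_{l=2}^\infty l\,|c_{lm}|\le K_2|c_m|$ for all sufficiently large $m$. For $\alpha\in\mathbb{R}\setminus\mathbb{Q}$ let $T^t_{(\alpha,\varphi)}$ be the special flow over the rotation $R_\alpha:x\mapsto x+\alpha$ under $\varphi$, that is, the vertical unit speed flow on $\{(x,s):x\in\mathbb{T},\ 0\le s<\varphi(x)\}$, where $(x,\varphi(x))$ is identified with $(x+\alpha,0)$, with Lebesgue measure. Then for every irrational $\alpha$ exactly one of the following holds: 1. $T^t_{(\alpha,\varphi)}$ is weak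 mixing, i.e. its only $L^2$ eigenfunctions are the constants; 2. $T^t_{(\alpha,\varphi)}$ is $L^2$-conjugate to a suspension flow, i.e. there are a constant $c>0$ and a function $\psi\in L^2(\mathbb{T})$ such that $(x,s)\mapsto(x,s+\psi(x))$, taken modulo the identification $(x,s+c)\sim(x+\alpha,s)$, is an isomorphism mod $0$ of measure-preserving flows from $T^t_{(\alpha,\varphi)}$ to the special flow $T^t_{(\alpha,c)}$ over $R_\alpha$ under the constant $c$. Moreover, 2 holds if and only if the formal solution of the additive cohomological equation $\psi(x+\alpha)-\psi(x)=\varphi(x)-c_0$ is square-summable, i.e. $$\sum_{m\in\mathbb{Z}\setminus\{0\}}\Bigl|\frac{c_m}{e^{2\pi i m\alpha}-1}\Bigr|^2<\infty .$$ -/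

import Mathlib

open MeasureTheory Filter

noncomputable section

namespace SpecialFlow

/-- The Birkhoff sums `S_n φ(x)` over the rotation `x ↦ x + α` of `𝕋 = ℝ/ℤ`, for all integers `n`:
`S_n φ(x) = φ(x) + φ(x + α) + ⋯ + φ(x + (n-1)α)` for `n ≥ 0` and
`S_{-n} φ(x) = -(φ(x - α) + ⋯ + φ(x - nα))` for `n ≥ 1`. -/
def birkhoff (α : ℝ) (φ : UnitAddCircle → ℝ) : ℤ → UnitAddCircle → ℝ
  | Int.ofNat n, x => ∑ k ∈ Finset.range n, φ (x + (((k : ℝ) * α : ℝ) : UnitAddCircle))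
  | Int.negSucc n, x =>
      -∑ k ∈ Finset.range (n + 1), φ (x - ((((k : ℝ) + 1) * α : ℝ) : UnitAddCircle))

/-- The largest integer `n` with `S_n φ(x) ≤ u`. When `φ` is continuous and positive, it is the
unique integer `n` with `S_n φ(x) ≤ u < S_{n+1} φ(x)`. -/
def returnIndex (α : ℝ) (φ : UnitAddCircle → ℝ) (x : UnitAddCircle) (u : ℝ) : ℤ :=
  sSup {n : ℤ | birkhoff α φ n x ≤ u}

/-- The projection of `𝕋 × ℝ` onto the region `{(x, s) : 0 ≤ s < φ x}` under the graph of `φ`,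
along the identification `(x, s + φ x) ∼ (x + α, s)`. -/
def proj (α : ℝ) (φ : UnitAddCircle → ℝ) (p : UnitAddCircle × ℝ) : UnitAddCircle × ℝ :=
  (p.1 + (((returnIndex α φ p.1 p.2 : ℝ) * α : ℝ) : UnitAddCircle),
    p.2 - birkhoff α φ (returnIndex α φ p.1 p.2) p.1)

/-- The special flow over the rotation by `α` under the function `φ`: vertical motion at unit speed
in the region under the graph of `φ`, where `(x, φ x)` is identified with `(x + α, 0)`. -/
def flow (α : ℝ) (φ : UnitAddCircle → ℝ) (t : ℝ) (p : UnitAddCircle × ℝ) : UnitAddCircle × ℝ :=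
  proj α φ (p.1, p.2 + t)

/-- The phase space of the special flow under `φ`. -/
def region (φ : UnitAddCircle → ℝ) : Set (UnitAddCircle × ℝ) :=
  {p | 0 ≤ p.2 ∧ p.2 < φ p.1}

/-- The invariant measure of the special flow under `φ`: Lebesgue measure on its phase space. -/
def flowMeasure (φ : UnitAddCircle → ℝ) : Measure (UnitAddCircle × ℝ) :=
  (volume : Measure (UnitAddCircle × ℝ)).restrict (region φ)

/-- A flow is weak mixing if it has continuous spectrum: every `L²` eigenfunction, for whatever
eigenvalue (`0` included), is almost everywhere constant. -/
def WeakMixing {X : Type*} [MeasurableSpace X] (T : ℝ → X → X) (μ : Measure X) : Prop :=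
  ∀ (ν : ℝ) (f : X → ℂ), MemLp f 2 μ →
    (∀ t : ℝ, ∀ᵐ p ∂μ,
      f (T t p) = Complex.exp (2 * Real.pi * Complex.I * ν * t) * f p) →
    ∃ k : ℂ, ∀ᵐ p ∂μ, f p = k

/-- Measurable conjugacy of measure-preserving flows: `h` is an isomorphism of measure spaces mod 0
that intertwines the flows. -/
def IsConjugacy {X Y : Type*} [MeasurableSpace X] [MeasurableSpace Y]
    (T : ℝ → X → X) (μ : Measure X) (S : ℝ → Y → Y) (ν : Measure Y) (h : X → Y) : Prop :=
  MeasurePreserving h μ ν ∧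
  (∃ g : Y → X, MeasurePreserving g ν μ ∧
    (∀ᵐ p ∂μ, g (h p) = p) ∧ (∀ᵐ q ∂ν, h (g q) = q)) ∧
  ∀ t : ℝ, ∀ᵐ p ∂μ, h (T t p) = S t (h p)

/-- `L²` conjugacy of the special flows under `φ₁` and `φ₂` over the same rotation: they are
conjugate by a map that displaces the orbit of `(x, 0)` by a time `ψ x`, with `ψ` in `L²(𝕋)`;
that is, `(x, s)` is sent to the class of `(x, s + ψ x)`. -/
def L2Conjugate (α : ℝ) (φ₁ φ₂ : UnitAddCircle → ℝ) : Prop :=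
  ∃ (h : UnitAddCircle × ℝ → UnitAddCircle × ℝ) (ψ : UnitAddCircle → ℝ),
    IsConjugacy (flow α φ₁) (flowMeasure φ₁) (flow α φ₂) (flowMeasure φ₂) h ∧
    MemLp ψ 2 volume ∧
    ∀ᵐ p ∂(flowMeasure φ₁), h p = proj α φ₂ (p.1, p.2 + ψ p.1)

/-- `L²` conjugacy to a suspension flow, i.e. to a special flow under a positive constant. -/
def L2ConjugateToSuspension (α : ℝ) (φ : UnitAddCircle → ℝ) : Prop :=
  ∃ c : ℝ, 0 < c ∧ L2Conjugate α φ (fun _ => c)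

/-- The Fourier coefficients `c_m` of `φ`. -/
def coeff (φ : UnitAddCircle → ℝ) (m : ℤ) : ℂ :=
  fourierCoeff (fun x : UnitAddCircle => (φ x : ℂ)) m

/-- Condition [H1]. -/
def H1 (φ : UnitAddCircle → ℝ) : Prop :=
  ∃ C : ℕ → ℝ, Summable C ∧ ∀ᶠ m : ℕ in atTop,
    ∑' l : ℕ, ‖coeff φ ((l + 2) * m)‖ ^ 2 ≤ C m * ‖coeff φ m‖ ^ 2

/-- Condition [H2]. -/
def H2 (φ : UnitAddCircle → ℝ) : Prop :=
  ∃ K : ℝ, 0 < K ∧ K < 1 / 4 ∧ ∀ᶠ m : ℕ in atTop,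
    ∑' l : ℕ, ‖coeff φ ((l + 2) * m)‖ ≤ K * ‖coeff φ m‖

/-- Condition [H3]. -/
def H3 (φ : UnitAddCircle → ℝ) : Prop :=
  ∃ K : ℝ, 0 < K ∧ ∀ᶠ m : ℕ in atTop,
    ∑' l : ℕ, ((l : ℝ) + 2) * ‖coeff φ ((l + 2) * m)‖ ≤ K * ‖coeff φ m‖

/-- The Fourier coefficients of the formal solution `ψ` (of mean zero) of
`ψ(x + α) - ψ(x) = φ(x) - c_0`. -/
def formalCoeff (α : ℝ) (φ : UnitAddCircle → ℝ) (m : ℤ) : ℂ :=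
  if m = 0 then 0 else coeff φ m / (Complex.exp (2 * Real.pi * Complex.I * m * α) - 1)

end SpecialFlow

end

/-!
Write `S_N` for the Birkhoff sum over the rotation by `α`.

If `φ - c₀` is an `L²` coboundary, shearing along a transfer function conjugates the flow to a
suspension, which has the eigenfunction `e^{2πis/c}`. Conversely, an `L²` conjugacy provides an `L²`
transfer function, whose Fourier coefficients are those of the formal solution.

Suppose the flow is not weakly mixing. Ergodicity of the rotation turns an eigenfunction of
frequency `ν ≠ 0` into a unimodular `G` with `G(x + α) = e^{2πiνφ(x)} G(x)`, so
`∫ e^{2πiν S_N φ}` is close to `1` whenever `‖Nα‖` is small. This forces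
`|c_q| = o(‖qα‖)` along the denominators `q` of very good approximations of `α`. Frequencies which
are not multiples of such a denominator are summed using the decay of `c_m`, and proper multiples
using [H1]. What remains is a sparse sum of waves of frequencies `q`, cohomologous to `φ - c₀`.
Sparseness makes the waves nearly independent, so that the integrals `∫ e^{2πiν S_N}` can stay away
from `0` only if `∑ |c_q|² / ‖qα‖²` converges.
-/

noncomputable section

open scoped Real

namespace SpecialFlow

/-! ### The circle and its characters -/

section Circle

lemma coe_intCast_eq_zero (n : ℤ) : ((n : ℝ) : UnitAddCircle) = 0 :=
  (AddCircle.coe_eq_zero_iff (1 : ℝ)).2 ⟨n, by simp⟩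

lemma exists_coe_eq_and_abs_eq_norm (θ : UnitAddCircle) :
    ∃ t : ℝ, (t : UnitAddCircle) = θ ∧ |t| = ‖θ‖ := by
  induction θ using QuotientAddGroup.induction_on with
  | H x =>
    refine ⟨x - round x, ?_, UnitAddCircle.norm_eq.symm⟩
    rw [AddCircle.coe_sub, coe_intCast_eq_zero, sub_zero]

lemma norm_le_half (θ : UnitAddCircle) : ‖θ‖ ≤ 1 / 2 := by
  simpa using AddCircle.norm_le_half_period (1 : ℝ) (x := θ) one_ne_zero

lemma norm_coe_le_abs (t : ℝ) : ‖(t : UnitAddCircle)‖ ≤ |t| := by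
  simpa [UnitAddCircle.norm_eq] using round_le t 0

lemma norm_coe_eq_abs {t : ℝ} (ht : |t| ≤ 1 / 2) : ‖(t : UnitAddCircle)‖ = |t| := by
  rw [AddCircle.norm_coe_eq_abs_iff (1 : ℝ) one_ne_zero]
  simpa using ht

lemma norm_nsmul_eq {θ : UnitAddCircle} {n : ℕ} (h : n * ‖θ‖ ≤ 1 / 2) : ‖n • θ‖ = n * ‖θ‖ := by
  obtain ⟨t, rfl, ht⟩ := exists_coe_eq_and_abs_eq_norm θ
  have hnt : |n • t| = n * ‖(t : UnitAddCircle)‖ := by rw [nsmul_eq_mul, abs_mul, Nat.abs_cast, ht]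
  rw [← AddCircle.coe_nsmul, norm_coe_eq_abs (hnt.trans_le h), hnt]

lemma norm_nsmul_coe (n : ℕ) (t : ℝ) :
    ‖n • (t : UnitAddCircle)‖ = |n * t - round (n * t)| := by
  rw [← AddCircle.coe_nsmul, nsmul_eq_mul, UnitAddCircle.norm_eq]

lemma norm_fourier_one_coe_sub_one (t : ℝ) :
    ‖(fourier 1 (t : UnitAddCircle) : ℂ) - 1‖ = 2 * |Real.sin (π * t)| := by
  have h : (fourier 1 (t : UnitAddCircle) : ℂ)
      = Complex.exp (Complex.I * ((2 * π * t : ℝ) : ℂ)) := by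
    rw [fourier_coe_apply]
    congr 1
    push_cast
    ring
  rw [h, Complex.norm_exp_I_mul_ofReal_sub_one, norm_mul, Real.norm_two, Real.norm_eq_abs,
    mul_assoc, mul_div_cancel_left₀ _ two_ne_zero]

lemma fourier_eq_fourier_one_zsmul (m : ℤ) (θ : UnitAddCircle) :
    (fourier m θ : ℂ) = fourier 1 (m • θ) := by
  simp [fourier_apply]

lemma norm_fourier_sub_one_le (m : ℤ) (θ : UnitAddCircle) :
    ‖(fourier m θ : ℂ) - 1‖ ≤ 2 * π * ‖m • θ‖ := by
  obtain ⟨t, ht, habs⟩ := exists_coe_eq_and_abs_eq_norm (m • θ)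
  rw [fourier_eq_fourier_one_zsmul, ← ht, norm_fourier_one_coe_sub_one, ht, ← habs, mul_assoc]
  gcongr
  exact (Real.abs_sin_le_abs).trans_eq (by rw [abs_mul, abs_of_pos Real.pi_pos])

lemma le_norm_fourier_sub_one (m : ℤ) (θ : UnitAddCircle) :
    4 * ‖m • θ‖ ≤ ‖(fourier m θ : ℂ) - 1‖ := by
  obtain ⟨t, ht, habs⟩ := exists_coe_eq_and_abs_eq_norm (m • θ)
  have hπt : |π * t| = π * |t| := by rw [abs_mul, abs_of_pos Real.pi_pos]
  have hhalf : |t| ≤ 1 / 2 := habs.trans_le (norm_le_half _)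
  have hsin := Real.mul_abs_le_abs_sin (x := π * t) (by rw [hπt]; nlinarith [Real.pi_pos])
  have hjordan : 2 / π * |π * t| = 2 * |t| := by
    rw [hπt]
    field_simp
  rw [fourier_eq_fourier_one_zsmul, ← ht, norm_fourier_one_coe_sub_one, ht, ← habs]
  linarith

lemma norm_fourier_apply (m : ℤ) (x : UnitAddCircle) : ‖(fourier m x : ℂ)‖ = 1 := by
  rw [fourier_apply]
  exact Circle.norm_coe _

lemma fourier_add_apply (m : ℤ) (x y : UnitAddCircle) :
    (fourier m (x + y) : ℂ) = fourier m x * fourier m y := by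
  simp [fourier_apply, smul_add, AddCircle.toCircle_add]

lemma fourier_nsmul_apply (m : ℤ) (k : ℕ) (x : UnitAddCircle) :
    (fourier m (k • x) : ℂ) = (fourier m x : ℂ) ^ k := by
  simp [fourier_apply, smul_comm m k x, AddCircle.toCircle_nsmul]

variable {α : ℝ}

lemma norm_zsmul_pos (hα : Irrational α) {m : ℤ} (hm : m ≠ 0) :
    0 < ‖m • (α : UnitAddCircle)‖ := by
  rw [norm_pos_iff, ← AddCircle.coe_zsmul, Ne, AddCircle.coe_eq_zero_iff]
  rintro ⟨n, hn⟩
  simp only [zsmul_eq_mul, mul_one] at hn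
  exact (hα.intCast_mul hm).ne_int n hn.symm

lemma norm_nsmul_pos (hα : Irrational α) {m : ℕ} (hm : m ≠ 0) :
    0 < ‖m • (α : UnitAddCircle)‖ := by
  simpa using norm_zsmul_pos hα (m := m) (by exact_mod_cast hm)

lemma fourier_sub_one_ne_zero (hα : Irrational α) {m : ℤ} (hm : m ≠ 0) :
    (fourier m (α : UnitAddCircle) : ℂ) - 1 ≠ 0 := by
  rw [← norm_pos_iff]
  linarith [le_norm_fourier_sub_one m (α : UnitAddCircle), norm_zsmul_pos hα hm]

end Circle

/-! ### Good denominators -/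

section GoodDenom

/-- The denominators `q` of the reduced fractions `p / q` with `|q α - p| < q⁻²`. They are sparse,
and they carry all the small divisors that the decay of `c_m` does not compensate. -/
structure IsGoodDenom (α : ℝ) (q : ℕ) : Prop where
  pos : 0 < q
  close : ‖q • (α : UnitAddCircle)‖ < 1 / (q : ℝ) ^ 2
  coprime : ∃ p : ℤ, IsCoprime p (q : ℤ) ∧ ‖q • (α : UnitAddCircle)‖ = |q * α - p|

variable {α : ℝ} {p q : ℕ}

lemma IsGoodDenom.le_norm_nsmul_of_not_dvd (hq : IsGoodDenom α q) {m : ℕ} (hm : ¬ q ∣ m)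
    (h : m * ‖q • (α : UnitAddCircle)‖ ≤ 1 / 2) : 1 / (2 * q) ≤ ‖m • (α : UnitAddCircle)‖ := by
  obtain ⟨p, hp, hn⟩ := hq.coprime
  have hq0 : (0 : ℝ) < q := by exact_mod_cast hq.pos
  rw [norm_nsmul_coe, div_le_iff₀ (by positivity)]
  set P := round ((m : ℝ) * α)
  have hne : (m : ℤ) * p - P * q ≠ 0 := by
    intro h0
    have : (q : ℤ) ∣ m * p := ⟨P, by linarith⟩
    exact hm (by exact_mod_cast hp.symm.dvd_of_dvd_mul_right this)
  have hlower : (1 : ℝ) ≤ |(m : ℝ) * p - P * q| := by exact_mod_cast Int.one_le_abs hne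
  have hupper : |(m : ℝ) * p - P * q| ≤ q * |m * α - P| + m * |q * α - p| := by
    rw [show (m : ℝ) * p - P * q = q * (m * α - P) - m * (q * α - p) by ring]
    refine (abs_sub _ _).trans ?_
    rw [abs_mul, abs_mul, Nat.abs_cast, Nat.abs_cast]
  rw [hn] at h
  linarith

lemma IsGoodDenom.le_norm_nsmul_of_lt (hp : IsGoodDenom α p) (hq : IsGoodDenom α q)
    (hpq : p < q) : 1 / (2 * q) ≤ ‖p • (α : UnitAddCircle)‖ := by
  refine hq.le_norm_nsmul_of_not_dvd (Nat.not_dvd_of_pos_of_lt hp.pos hpq) ?_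
  have hp1 : (1 : ℝ) ≤ p := by exact_mod_cast hp.pos
  have hpq' : (p : ℝ) + 1 ≤ q := by exact_mod_cast hpq
  have hq2 : (0 : ℝ) < (q : ℝ) ^ 2 := pow_pos (by linarith) 2
  calc (p : ℝ) * ‖q • (α : UnitAddCircle)‖ ≤ p * (1 / (q : ℝ) ^ 2) := by
        gcongr
        exact hq.close.le
    _ ≤ 1 / 2 := by
        rw [mul_one_div, div_le_div_iff₀ hq2 two_pos]
        nlinarith

lemma IsGoodDenom.sq_lt (hp : IsGoodDenom α p) (hq : IsGoodDenom α q) (hpq : p < q) :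
    (p : ℝ) ^ 2 < 2 * q := by
  have h := (hp.le_norm_nsmul_of_lt hq hpq).trans_lt hp.close
  have hp0 : (0 : ℝ) < p := by exact_mod_cast hp.pos
  have hq0 : (0 : ℝ) < q := by exact_mod_cast hq.pos
  rw [div_lt_div_iff₀ (by positivity) (by positivity)] at h
  linarith

lemma exists_isGoodDenom_of_norm_nsmul_lt {m : ℕ} (hm : 0 < m)
    (h : ‖m • (α : UnitAddCircle)‖ < 1 / (m : ℝ) ^ 2) :
    ∃ q l : ℕ, IsGoodDenom α q ∧ 0 < l ∧ m = l * q ∧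
      ‖m • (α : UnitAddCircle)‖ = l * ‖q • (α : UnitAddCircle)‖ := by
  have hnorm := norm_nsmul_coe m α
  set P := round ((m : ℝ) * α)
  have hgcd : 0 < Int.gcd P m := Int.gcd_pos_of_ne_zero_right _ (by exact_mod_cast hm.ne')
  obtain ⟨d, p, q', hd0, hcop, hP, hmq'⟩ := Int.exists_gcd_one' hgcd
  obtain ⟨q, rfl⟩ : ∃ q : ℕ, q' = q := ⟨q'.toNat, by rw [Int.toNat_of_nonneg (by nlinarith)]⟩
  have hmq : m = d * q := by rw [mul_comm]; exact_mod_cast hmq'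
  have hreduce : |(m : ℝ) * α - P| = d * |q * α - p| := by
    rw [hP, hmq]
    push_cast
    rw [← Nat.abs_cast d, ← abs_mul, Nat.abs_cast]
    ring_nf
  have hle : |(q : ℝ) * α - p| ≤ |m * α - P| := by
    rw [hreduce]
    exact le_mul_of_one_le_left (abs_nonneg _) (by exact_mod_cast hd0)
  have hq : ‖q • (α : UnitAddCircle)‖ = |q * α - p| := by
    rw [← norm_coe_eq_abs (hle.trans (hnorm ▸ norm_le_half _)), AddCircle.coe_sub,
      coe_intCast_eq_zero, sub_zero, ← AddCircle.coe_nsmul,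
      nsmul_eq_mul]
  have hq0 : 0 < q := Nat.pos_of_ne_zero (by rintro rfl; omega)
  refine ⟨q, d, ⟨hq0, ?_, p, Int.isCoprime_iff_gcd_eq_one.2 hcop, hq⟩, hd0, hmq, ?_⟩
  · have hqm : q ≤ m := hmq ▸ Nat.le_mul_of_pos_left _ hd0
    refine (hq.trans_le (hle.trans_eq hnorm.symm)).trans_lt (h.trans_le ?_)
    gcongr
  · rw [hnorm, hreduce, hq]

lemma sum_goodDenom_le (F : Finset ℕ) (hq : IsGoodDenom α q)
    (hF : ∀ p ∈ F, IsGoodDenom α p ∧ 32 ≤ p ∧ p < q) : ∑ p ∈ F, (p : ℝ) ≤ 3 * √q := by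
  induction F using Finset.induction_on_max generalizing q with
  | empty => simp
  | insert p s hs ih =>
    obtain ⟨hp, h32, hpq⟩ := hF p (Finset.mem_insert_self _ _)
    have hrest := ih hp fun r hr =>
      have hr' := hF r (Finset.mem_insert_of_mem hr)
      ⟨hr'.1, hr'.2.1, hs r hr⟩
    have hp_sqrt : 3 * √(p : ℝ) ≤ p := by
      have h32' : (32 : ℝ) ≤ p := by exact_mod_cast h32
      have hmul : √(p : ℝ) * √(p : ℝ) = p := Real.mul_self_sqrt (by positivity)
      have hge : 3 ≤ √(p : ℝ) := Real.le_sqrt_of_sq_le (by linarith)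
      nlinarith
    have hp_q : 2 * (p : ℝ) ≤ 3 * √q := by
      have hsq := hp.sq_lt hq hpq
      have : √(q : ℝ) ^ 2 = q := Real.sq_sqrt (by positivity)
      nlinarith [Real.sqrt_nonneg (q : ℝ)]
    rw [Finset.sum_insert fun h => (hs p h).false]
    linarith

lemma sum_inv_sqrt_goodDenom_le (F : Finset ℕ) {J : ℕ} (hJ : 32 ≤ J)
    (hF : ∀ p ∈ F, IsGoodDenom α p ∧ J ≤ p) : ∑ p ∈ F, 1 / √(p : ℝ) ≤ 2 / √J := by
  induction F using Finset.induction_on_min generalizing J with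
  | empty =>
    rw [Finset.sum_empty]
    positivity
  | insert p s hs ih =>
    obtain ⟨hp, hJp⟩ := hF p (Finset.mem_insert_self _ _)
    have h32 : (32 : ℝ) ≤ p := by exact_mod_cast hJ.trans hJp
    have hrest := ih (J := 4 * p) (by omega) fun r hr => by
      have hr' := (hF r (Finset.mem_insert_of_mem hr)).1
      have hsq := hp.sq_lt hr' (hs r hr)
      have : (4 * p : ℝ) ≤ r := by nlinarith
      exact ⟨hr', by exact_mod_cast this⟩
    have hsqrt : √((4 * p : ℕ) : ℝ) = 2 * √p := by
      rw [Nat.cast_mul, Real.sqrt_mul (Nat.cast_nonneg 4), Nat.cast_ofNat,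
        show (4 : ℝ) = 2 ^ 2 by norm_num, Real.sqrt_sq zero_le_two]
    have hJ0 : (0 : ℝ) < J := by exact_mod_cast (by omega : 0 < J)
    rw [hsqrt] at hrest
    rw [Finset.sum_insert fun h => (hs p h).false]
    calc 1 / √(p : ℝ) + ∑ r ∈ s, 1 / √(r : ℝ) ≤ 1 / √(p : ℝ) + 2 / (2 * √p) := by gcongr
      _ = 2 / √(p : ℝ) := by field_simp; norm_num
      _ ≤ 2 / √J := by gcongr

end GoodDenom

/-! ### Geometric sums of characters -/

section CharSum

/-- The factor `∑_{k < N} e^{2πimka}` by which summation over `N` steps of the rotation by `a`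
multiplies the `m`-th Fourier coefficient. -/
def charSum (a : UnitAddCircle) (N : ℕ) (m : ℤ) : ℂ :=
  ∑ k ∈ Finset.range N, (fourier m (k • a) : ℂ)

lemma norm_charSum_le (a : UnitAddCircle) (N : ℕ) (m : ℤ) : ‖charSum a N m‖ ≤ N :=
  (norm_sum_le_of_le _ fun k _ => (norm_fourier_apply m (k • a)).le).trans_eq (by simp)

lemma charSum_mul_fourier_sub_one (a : UnitAddCircle) (N : ℕ) (m : ℤ) :
    charSum a N m * (fourier m a - 1) = fourier m (N • a) - 1 := by
  simp only [charSum, fourier_nsmul_apply]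
  exact geom_sum_mul _ _

lemma norm_charSum_mul_norm_zsmul_le (a : UnitAddCircle) (N : ℕ) (m : ℤ) :
    ‖charSum a N m‖ * ‖m • a‖ ≤ 2 * |(m : ℝ)| * ‖N • a‖ := by
  have hgeom := congrArg norm (charSum_mul_fourier_sub_one a N m)
  rw [norm_mul] at hgeom
  have hzsmul : ‖m • (N • a)‖ ≤ |(m : ℝ)| * ‖N • a‖ := by
    simpa [Int.norm_eq_abs] using norm_zsmul_le m (N • a)
  have : ‖charSum a N m‖ * (4 * ‖m • a‖) ≤ 8 * (|(m : ℝ)| * ‖N • a‖) := by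
    calc ‖charSum a N m‖ * (4 * ‖m • a‖) ≤ ‖charSum a N m‖ * ‖(fourier m a : ℂ) - 1‖ := by
          gcongr
          exact le_norm_fourier_sub_one m a
      _ ≤ 2 * π * ‖m • (N • a)‖ := hgeom.trans_le (norm_fourier_sub_one_le m (N • a))
      _ ≤ 8 * (|(m : ℝ)| * ‖N • a‖) := by
          gcongr
          linarith [Real.pi_lt_d2]
  linarith

lemma half_le_norm_charSum {a : UnitAddCircle} {N q : ℕ} (h : N * ‖q • a‖ ≤ 1 / 2)
    (ha : 0 < ‖q • a‖) : (N : ℝ) / 2 ≤ ‖charSum a N q‖ := by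
  have hgeom := congrArg norm (charSum_mul_fourier_sub_one a N q)
  rw [norm_mul] at hgeom
  have hlower := le_norm_fourier_sub_one q (N • a)
  rw [smul_comm, natCast_zsmul, norm_nsmul_eq h] at hlower
  have hupper : ‖(fourier q a : ℂ) - 1‖ ≤ 8 * ‖q • a‖ := by
    refine (norm_fourier_sub_one_le q a).trans ?_
    rw [natCast_zsmul]
    gcongr
    linarith [Real.pi_lt_d2]
  have : (N / 2 : ℝ) * (8 * ‖q • a‖) ≤ ‖charSum a N q‖ * (8 * ‖q • a‖) := by
    calc (N / 2 : ℝ) * (8 * ‖q • a‖) = 4 * (N * ‖q • a‖) := by ring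
      _ ≤ ‖charSum a N q‖ * ‖(fourier q a : ℂ) - 1‖ := hlower.trans_eq hgeom.symm
      _ ≤ ‖charSum a N q‖ * (8 * ‖q • a‖) := by gcongr
  exact le_of_mul_le_mul_right this (by positivity)

end CharSum

/-! ### Fourier series on the circle -/

section FourierSeries

lemma volume_eq_haarAddCircle : (volume : Measure UnitAddCircle) = AddCircle.haarAddCircle := by
  rw [AddCircle.volume_eq_smul_haarAddCircle, ENNReal.ofReal_one, one_smul]

instance isProbabilityMeasure_volume_unitAddCircle :
    IsProbabilityMeasure (volume : Measure UnitAddCircle) :=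
  ⟨UnitAddCircle.measure_univ⟩

lemma integrable_of_continuous {E : Type*} [NormedAddCommGroup E] {f : UnitAddCircle → E}
    (hf : Continuous f) : Integrable f :=
  hf.integrable_of_hasCompactSupport (HasCompactSupport.of_compactSpace f)

lemma memLp_of_continuous {E : Type*} [NormedAddCommGroup E] {f : UnitAddCircle → E}
    (hf : Continuous f) (p : ENNReal) : MemLp f p :=
  hf.memLp_of_hasCompactSupport (HasCompactSupport.of_compactSpace f)

lemma fourierCoeff_eq_integral (f : UnitAddCircle → ℂ) (m : ℤ) :
    fourierCoeff f m = ∫ x, (fourier (-m) x : ℂ) * f x := by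
  rw [fourierCoeff, volume_eq_haarAddCircle]
  rfl

lemma integral_fourier (m : ℤ) :
    ∫ x : UnitAddCircle, (fourier m x : ℂ) = if m = 0 then 1 else 0 := by
  have h := congrFun (fourierCoeff_fourier (T := 1) m) 0
  rw [fourierCoeff_eq_integral] at h
  simp only [neg_zero, fourier_zero, one_mul] at h
  rw [h, Pi.single_apply]
  simp only [eq_comm]

lemma fourierCoeff_translate (f : UnitAddCircle → ℂ) (b : UnitAddCircle) (m : ℤ) :
    fourierCoeff (fun x => f (x + b)) m = fourier m b * fourierCoeff f m := by
  rw [fourierCoeff_eq_integral, fourierCoeff_eq_integral,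
    ← integral_add_right_eq_self (fun x => _ * f x) b, ← integral_const_mul]
  congr 1
  ext x
  have h : (fourier m b : ℂ) * (starRingEnd ℂ) (fourier m b) = 1 := by
    rw [Complex.mul_conj, Complex.normSq_eq_norm_sq, norm_fourier_apply]
    simp
  rw [fourier_add_apply, fourier_neg, fourier_neg]
  linear_combination (- (starRingEnd ℂ) (fourier m x : ℂ) * f (x + b)) * h

lemma fourierCoeff_sub {f g : UnitAddCircle → ℂ} (hf : Integrable f) (hg : Integrable g) (m : ℤ) :
    fourierCoeff (fun x => f x - g x) m = fourierCoeff f m - fourierCoeff g m := by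
  simp only [fourierCoeff_eq_integral, mul_sub]
  rw [volume_eq_haarAddCircle] at *
  exact integral_sub (hf.fourier_smul (-m)) (hg.fourier_smul (-m))

lemma fourierCoeff_finsetSum {ι : Type*} (s : Finset ι) {f : ι → UnitAddCircle → ℂ}
    (hf : ∀ i ∈ s, Integrable (f i)) (m : ℤ) :
    fourierCoeff (fun x => ∑ i ∈ s, f i x) m = ∑ i ∈ s, fourierCoeff (f i) m := by
  simp only [fourierCoeff_eq_integral, Finset.mul_sum]
  rw [volume_eq_haarAddCircle] at *
  exact integral_finsetSum _ fun i hi => (hf i hi).fourier_smul (-m)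

lemma fourierCoeff_const (c : ℂ) (m : ℤ) :
    fourierCoeff (fun _ : UnitAddCircle => c) m = if m = 0 then c else 0 := by
  rw [fourierCoeff_eq_integral, integral_mul_const, integral_fourier]
  simp

lemma coeff_neg (f : UnitAddCircle → ℝ) (m : ℤ) :
    coeff f (-m) = (starRingEnd ℂ) (coeff f m) := by
  rw [coeff, coeff, fourierCoeff_eq_integral, fourierCoeff_eq_integral, ← integral_conj]
  congr 1
  ext x
  simp

lemma norm_coeff_neg (f : UnitAddCircle → ℝ) (m : ℤ) : ‖coeff f (-m)‖ = ‖coeff f m‖ := by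
  rw [coeff_neg, Complex.norm_conj]

lemma coeff_zero (f : UnitAddCircle → ℝ) : coeff f 0 = ((∫ x, f x : ℝ) : ℂ) := by
  rw [coeff, fourierCoeff_eq_integral, ← integral_complex_ofReal]
  simp

lemma coeff_sub {f g : UnitAddCircle → ℝ} (hf : Integrable f) (hg : Integrable g) (m : ℤ) :
    coeff (fun x => f x - g x) m = coeff f m - coeff g m := by
  simp only [coeff, Complex.ofReal_sub]
  exact fourierCoeff_sub hf.ofReal hg.ofReal m

lemma coeff_const (c : ℝ) (m : ℤ) :
    coeff (fun _ => c) m = if m = 0 then (c : ℂ) else 0 :=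
  fourierCoeff_const c m

lemma hasSum_sq_norm_fourierCoeff {f : UnitAddCircle → ℂ} (hf : MemLp f 2) :
    HasSum (fun m => ‖fourierCoeff f m‖ ^ 2) (∫ x, ‖f x‖ ^ 2) := by
  rw [volume_eq_haarAddCircle] at *
  have h := hasSum_sq_fourierCoeff (hf.toLp f)
  rw [fourierCoeff_congr_ae hf.coeFn_toLp] at h
  convert h using 1
  refine integral_congr_ae ?_
  filter_upwards [hf.coeFn_toLp] with x hx
  rw [hx]

lemma hasSum_sq_norm_coeff {f : UnitAddCircle → ℝ} (hf : MemLp f 2) :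
    HasSum (fun m => ‖coeff f m‖ ^ 2) (∫ x, f x ^ 2) := by
  have hfc : MemLp (fun x => (f x : ℂ)) 2 := hf.ofReal
  simpa only [coeff, Complex.norm_real, Real.norm_eq_abs, sq_abs] using
    hasSum_sq_norm_fourierCoeff hfc

lemma ae_eq_of_fourierCoeff_eq {f g : UnitAddCircle → ℂ} (hf : MemLp f 2) (hg : MemLp g 2)
    (h : ∀ m, fourierCoeff f m = fourierCoeff g m) : f =ᵐ[volume] g := by
  rw [volume_eq_haarAddCircle] at *
  have hLp : hf.toLp f = hg.toLp g := by
    apply fourierBasis.repr.injective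
    ext m
    rw [fourierBasis_repr, fourierBasis_repr, fourierCoeff_congr_ae hf.coeFn_toLp,
      fourierCoeff_congr_ae hg.coeFn_toLp, h]
  exact (MemLp.toLp_eq_toLp_iff hf hg).1 hLp

lemma exists_memLp_fourierCoeff_eq {c : ℤ → ℂ} (hc : Summable fun m => ‖c m‖ ^ 2) :
    ∃ f : UnitAddCircle → ℂ, StronglyMeasurable f ∧ MemLp f 2 ∧ ∀ m, fourierCoeff f m = c m := by
  have hmem : Memℓp c 2 := by
    rw [memℓp_gen_iff (by norm_num)]
    simpa using hc
  set F := (fourierBasis (T := 1)).repr.symm (⟨c, hmem⟩ : lp (fun _ : ℤ => ℂ) 2) with hF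
  refine ⟨F, Lp.stronglyMeasurable F, ?_, fun m => ?_⟩
  · rw [volume_eq_haarAddCircle]
    exact Lp.memLp F
  · rw [← fourierBasis_repr, hF, LinearIsometryEquiv.apply_symm_apply]

end FourierSeries

/-! ### The additive cohomological equation -/

section CohomologicalEquation

variable {α : ℝ}

lemma formalCoeff_eq (α : ℝ) (f : UnitAddCircle → ℝ) (m : ℤ) :
    formalCoeff α f m
      = if m = 0 then 0 else coeff f m / ((fourier m (α : UnitAddCircle) : ℂ) - 1) := by
  rw [formalCoeff, fourier_coe_apply]
  simp

lemma fourierCoeff_translate_sub {f : UnitAddCircle → ℂ} (hf : Integrable f) (b : UnitAddCircle)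
    (m : ℤ) :
    fourierCoeff (fun x => f (x + b) - f x) m = (fourier m b - 1) * fourierCoeff f m := by
  rw [fourierCoeff_sub (hf.comp_add_right b) hf, fourierCoeff_translate, sub_one_mul]

lemma fourierCoeff_ofReal_sub_const {f : UnitAddCircle → ℝ} (hf : Integrable f) (c : ℂ) (m : ℤ) :
    fourierCoeff (fun x => (f x : ℂ) - c) m = coeff f m - if m = 0 then c else 0 := by
  have hfc : Integrable fun x => (f x : ℂ) := hf.ofReal
  rw [fourierCoeff_sub hfc (integrable_const c), fourierCoeff_const, coeff]

lemma exists_memLp_coboundary (hα : Irrational α) {f : UnitAddCircle → ℝ} (hf : MemLp f 2)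
    (h : Summable fun m : ℤ => ‖formalCoeff α f m‖ ^ 2) :
    ∃ ψ : UnitAddCircle → ℝ, Measurable ψ ∧ MemLp ψ 2 ∧
      ∀ᵐ x, ψ (x + (α : UnitAddCircle)) - ψ x = f x - (coeff f 0).re := by
  obtain ⟨Ψ, hΨm, hΨ, hc⟩ := exists_memLp_fourierCoeff_eq h
  have hΨt : MemLp (fun x => Ψ (x + (α : UnitAddCircle))) 2 :=
    hΨ.comp_measurePreserving (measurePreserving_add_right volume _)
  have hfc : MemLp (fun x => (f x : ℂ)) 2 := hf.ofReal
  have hΨeq := ae_eq_of_fourierCoeff_eq (hΨt.sub hΨ) (hfc.sub (memLp_const (coeff f 0))) fun m => by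
    refine (fourierCoeff_translate_sub (hΨ.integrable one_le_two) _ m).trans (Eq.trans ?_
      (fourierCoeff_ofReal_sub_const (hf.integrable one_le_two) _ m).symm)
    rw [hc, formalCoeff_eq]
    split_ifs with hm
    · rw [hm, mul_zero, sub_self]
    · rw [sub_zero, mul_div_cancel₀ _ (fourier_sub_one_ne_zero hα hm)]
  refine ⟨fun x => (Ψ x).re, Complex.measurable_re.comp hΨm.measurable, hΨ.re, ?_⟩
  filter_upwards [hΨeq] with x hx
  simpa using congrArg Complex.re hx

lemma summable_formalCoeff_of_coboundary (hα : Irrational α) {f ψ : UnitAddCircle → ℝ}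
    (hf : Integrable f) (hψ : MemLp ψ 2) {c : ℝ}
    (h : ∀ᵐ x, ψ (x + (α : UnitAddCircle)) - ψ x = f x - c) :
    Summable fun m : ℤ => ‖formalCoeff α f m‖ ^ 2 := by
  refine (hasSum_sq_norm_coeff hψ).summable.of_nonneg_of_le (fun _ => by positivity) fun m => ?_
  rw [formalCoeff_eq]
  split_ifs with hm
  · simp
  · have hcongr : fourierCoeff (fun x => (ψ (x + (α : UnitAddCircle)) : ℂ) - ψ x) m
        = fourierCoeff (fun x => (f x : ℂ) - c) m := by
      rw [fourierCoeff_eq_integral, fourierCoeff_eq_integral]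
      refine integral_congr_ae ?_
      filter_upwards [h] with x hx
      congr 1
      exact_mod_cast hx
    have hψ1 : Integrable fun x => (ψ x : ℂ) := (hψ.integrable one_le_two).ofReal
    rw [fourierCoeff_translate_sub hψ1, fourierCoeff_ofReal_sub_const hf, if_neg hm,
      sub_zero] at hcongr
    rw [← hcongr, mul_div_cancel_left₀ _ (fourier_sub_one_ne_zero hα hm), coeff]

end CohomologicalEquation

/-! ### Decay of Fourier coefficients -/

section Decay

lemma continuous_of_continuous_coe {E : Type*} [TopologicalSpace E] {f : UnitAddCircle → E}
    (h : Continuous fun x : ℝ => f (x : UnitAddCircle)) : Continuous f :=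
  (QuotientAddGroup.isQuotientMap_mk _).continuous_iff.2 h

lemma periodic_deriv {f : ℝ → ℂ} {c : ℝ} (hf : Function.Periodic f c) :
    Function.Periodic (deriv f) c := fun x => by
  rw [← deriv_comp_add_const]
  congr 1
  exact funext hf

lemma norm_fourierCoeffOn_mul_le {f : ℝ → ℂ} (hf : ContDiff ℝ 1 f) (hper : f 1 = f 0) (n : ℤ) :
    ‖fourierCoeffOn zero_lt_one f n‖ * |(n : ℝ)| ≤ ‖fourierCoeffOn zero_lt_one (deriv f) n‖ := by
  by_cases hn : n = 0
  · simp [hn]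
  have hparts : ‖fourierCoeffOn zero_lt_one f n‖
      = (2 * π * |(n : ℝ)|)⁻¹ * ‖fourierCoeffOn zero_lt_one (deriv f) n‖ := by
    rw [fourierCoeffOn_of_hasDerivAt (zero_lt_one (α := ℝ)) hn
      (fun x _ => (hf.differentiable one_ne_zero x).hasDerivAt)
      ((hf.continuous_deriv le_rfl).intervalIntegrable 0 1), hper]
    simp [abs_of_pos Real.pi_pos]
  have hle : (2 * π)⁻¹ ≤ 1 := inv_le_one_of_one_le₀ (by linarith [Real.pi_gt_three])
  calc ‖fourierCoeffOn zero_lt_one f n‖ * |(n : ℝ)|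
      = (2 * π)⁻¹ * ‖fourierCoeffOn zero_lt_one (deriv f) n‖ := by
        rw [hparts]
        field_simp
    _ ≤ _ := mul_le_of_le_one_left (norm_nonneg _) hle

lemma norm_fourierCoeffOn_mul_pow_le {k : ℕ} {f : ℝ → ℂ} (hf : ContDiff ℝ k f)
    (hper : Function.Periodic f 1) (n : ℤ) :
    ‖fourierCoeffOn zero_lt_one f n‖ * |(n : ℝ)| ^ k
      ≤ ‖fourierCoeffOn zero_lt_one (iteratedDeriv k f) n‖ := by
  induction k generalizing f with
  | zero => simp
  | succ k ih =>
    have hf' : ContDiff ℝ k (deriv f) :=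
      (contDiff_succ_iff_deriv.1 (by exact_mod_cast hf : ContDiff ℝ ((k : WithTop ℕ∞) + 1) f)).2.2
    have hf1 : ContDiff ℝ 1 f := hf.of_le (by exact_mod_cast Nat.le_add_left 1 k)
    rw [iteratedDeriv_succ', pow_succ', ← mul_assoc]
    exact (mul_le_mul_of_nonneg_right
      (norm_fourierCoeffOn_mul_le hf1 (by simpa using hper 0) n) (by positivity)).trans
      (ih hf' (periodic_deriv hper))

lemma norm_fourierCoeffOn_le {f : ℝ → ℂ} {C : ℝ} (hf : ∀ x ∈ Set.Icc (0 : ℝ) 1, ‖f x‖ ≤ C)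
    (n : ℤ) : ‖fourierCoeffOn zero_lt_one f n‖ ≤ C := by
  rw [fourierCoeffOn_eq_integral]
  have := intervalIntegral.norm_integral_le_of_norm_le_const (a := 0) (b := 1) (C := C)
    (f := fun x : ℝ => (fourier (-n) (x : AddCircle (1 - 0 : ℝ)) : ℂ) • f x) fun x hx => by
      rw [norm_smul, fourier_apply, Circle.norm_coe, one_mul]
      rw [Set.uIoc_of_le zero_le_one] at hx
      exact hf x ⟨hx.1.le, hx.2⟩
  simpa using this

lemma exists_norm_coeff_mul_pow_le {k : ℕ} {f : UnitAddCircle → ℝ}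
    (hf : ContDiff ℝ k (fun x : ℝ => f (x : UnitAddCircle))) :
    ∃ C : ℝ, ∀ m : ℤ, ‖coeff f m‖ * |(m : ℝ)| ^ k ≤ C := by
  set g : ℝ → ℂ := fun x => (f (x : UnitAddCircle) : ℂ) with hg
  have hgk : ContDiff ℝ k g := Complex.ofRealCLM.contDiff.comp hf
  have hper : Function.Periodic g 1 := fun x => by simp [hg]
  obtain ⟨C, hC⟩ := (isCompact_Icc (a := (0 : ℝ)) (b := 1)).exists_bound_of_continuousOn
    (hgk.continuous_iteratedDeriv k le_rfl).continuousOn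
  refine ⟨C, fun m => ?_⟩
  have hcoeff : coeff f m = fourierCoeffOn zero_lt_one g m := by
    rw [coeff, fourierCoeff_eq_intervalIntegral _ _ 0, fourierCoeffOn_eq_integral]
    simp [hg]
  rw [hcoeff]
  exact (norm_fourierCoeffOn_mul_pow_le hgk hper m).trans (norm_fourierCoeffOn_le hC m)

end Decay

/-! ### Oscillatory integrals -/

section Oscillatory

/-- The integral of `e^{2πiνF}` over the circle: up to normalisation, the characteristic function
of the distribution of `F`. -/
def expInt (ν : ℝ) (F : UnitAddCircle → ℝ) : ℂ :=
  ∫ x, Complex.exp (2 * π * Complex.I * ν * F x)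

lemma exp_eq_exp_I_mul_ofReal (ν t : ℝ) :
    Complex.exp (2 * π * Complex.I * ν * t) = Complex.exp (Complex.I * (2 * π * ν * t : ℝ)) := by
  congr 1
  push_cast
  ring

lemma norm_exp_eq_one (ν t : ℝ) : ‖Complex.exp (2 * π * Complex.I * ν * t)‖ = 1 := by
  rw [exp_eq_exp_I_mul_ofReal, Complex.norm_exp_I_mul_ofReal]

lemma exp_add (ν s t : ℝ) : Complex.exp (2 * π * Complex.I * ν * (s + t : ℝ))
    = Complex.exp (2 * π * Complex.I * ν * s) * Complex.exp (2 * π * Complex.I * ν * t) := by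
  rw [← Complex.exp_add]
  push_cast
  ring_nf

lemma norm_exp_sub_exp_le (ν s t : ℝ) :
    ‖Complex.exp (2 * π * Complex.I * ν * s) - Complex.exp (2 * π * Complex.I * ν * t)‖
      ≤ 2 * π * |ν| * |s - t| := by
  have h : Complex.exp (2 * π * Complex.I * ν * s) - Complex.exp (2 * π * Complex.I * ν * t)
      = Complex.exp (2 * π * Complex.I * ν * t)
        * (Complex.exp (2 * π * Complex.I * ν * (s - t : ℝ)) - 1) := by
    rw [mul_sub, ← exp_add, add_sub_cancel, mul_one]
  rw [h, norm_mul, norm_exp_eq_one, one_mul, exp_eq_exp_I_mul_ofReal]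
  refine Real.norm_exp_I_mul_ofReal_sub_one_le.trans ?_
  rw [Real.norm_eq_abs, abs_mul, abs_mul, abs_of_pos Real.two_pi_pos]

lemma continuous_exp_comp {F : UnitAddCircle → ℝ} (hF : Continuous F) (ν : ℝ) :
    Continuous fun x => Complex.exp (2 * π * Complex.I * ν * F x) := by fun_prop

lemma norm_expInt_add_const (ν : ℝ) (F : UnitAddCircle → ℝ) (c : ℝ) :
    ‖expInt ν (fun x => F x + c)‖ = ‖expInt ν F‖ := by
  simp only [expInt, exp_add, integral_mul_const, norm_mul, norm_exp_eq_one, mul_one]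

lemma norm_expInt_le_add {F Z : UnitAddCircle → ℝ} (hF : Continuous F) (hZ : Continuous Z)
    (ν : ℝ) : ‖expInt ν F‖ ≤ ‖expInt ν Z‖ + 2 * π * |ν| * ∫ x, |F x - Z x| := by
  have h : expInt ν F = expInt ν Z + ∫ x, (Complex.exp (2 * π * Complex.I * ν * F x)
      - Complex.exp (2 * π * Complex.I * ν * Z x)) := by
    rw [integral_sub (integrable_of_continuous (continuous_exp_comp hF ν))
      (integrable_of_continuous (continuous_exp_comp hZ ν)), expInt, expInt, add_sub_cancel]
  rw [h]
  refine (norm_add_le _ _).trans ?_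
  gcongr
  rw [← integral_const_mul]
  refine norm_integral_le_of_norm_le ?_ (Eventually.of_forall fun x => norm_exp_sub_exp_le ν _ _)
  exact (integrable_of_continuous (hF.sub hZ).abs).const_mul _

lemma integral_abs_le_of_integral_sq_le {Ω : Type*} [MeasurableSpace Ω] {μ : Measure Ω}
    [IsProbabilityMeasure μ] {F : Ω → ℝ} (hF : MemLp F 2 μ) {s : ℝ} (hs : 0 ≤ s)
    (h : ∫ x, F x ^ 2 ∂μ ≤ s ^ 2) : ∫ x, |F x| ∂μ ≤ s := by
  have hvar := ProbabilityTheory.variance_nonneg |F| μ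
  rw [ProbabilityTheory.variance_eq_sub hF.abs] at hvar
  simp only [sq_abs, Pi.pow_apply, Pi.abs_apply] at hvar
  exact le_of_sq_le_sq (by linarith) hs

end Oscillatory

/-! ### Multiplicative cocycles -/

section Cocycle

lemma tendsto_integral_translate_mul_conj {G : UnitAddCircle → ℂ}
    (hG : AEStronglyMeasurable G) (hG1 : ∀ᵐ x, ‖G x‖ = 1) :
    Tendsto (fun y : UnitAddCircle => ∫ x, G (x + y) * (starRingEnd ℂ) (G x)) (nhds 0)
      (nhds 1) := by
  have hG2 : MemLp G 2 := MemLp.of_bound hG 1 (hG1.mono fun x hx => hx.le)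
  set g := hG2.toLp G
  have : Fact ((2 : ENNReal) ≠ ⊤) := ⟨ENNReal.ofNat_ne_top⟩
  have hcont : Continuous fun y : UnitAddCircle => inner ℂ g (DomAddAct.mk y +ᵥ g) :=
    continuous_const.inner ((continuous_vadd (M := UnitAddCircleᵈᵃᵃ)
      (X := Lp ℂ 2 (volume : Measure UnitAddCircle))).comp
        (DomAddAct.continuous_mk.prodMk continuous_const))
  have hinner (y) : inner ℂ g (DomAddAct.mk y +ᵥ g) = ∫ x, G (x + y) * (starRingEnd ℂ) (G x) := by
    rw [L2.inner_def]
    refine integral_congr_ae ?_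
    filter_upwards [DomAddAct.vadd_Lp_ae_eq (DomAddAct.mk y) g, hG2.coeFn_toLp,
      (measurePreserving_add_left (volume : Measure UnitAddCircle) y).quasiMeasurePreserving.ae
        hG2.coeFn_toLp] with x hvadd hx hyx
    rw [hvadd, hx]
    simp only [Equiv.symm_apply_apply, vadd_eq_add]
    rw [hyx, add_comm y x]
    simp
  have hzero : ∫ x, G (x + 0) * (starRingEnd ℂ) (G x) = 1 := by
    rw [integral_congr_ae (g := fun _ => 1), integral_const, probReal_univ, one_smul]
    filter_upwards [hG1] with x hx
    rw [add_zero, Complex.mul_conj, Complex.normSq_eq_norm_sq, hx]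
    simp
  simpa only [hinner, hzero] using hcont.tendsto 0

end Cocycle

/-! ### Waves -/

section Wave

/-- The real trigonometric monomial `2 Re (w e^{2πiqx})`, the part of frequency `±q` of a real
function whose `q`-th Fourier coefficient is `w`. -/
def wave (w : ℂ) (q : ℤ) (x : UnitAddCircle) : ℝ := 2 * (w * fourier q x).re

lemma continuous_wave (w : ℂ) (q : ℤ) : Continuous (wave w q) := by
  unfold wave
  fun_prop

lemma ofReal_wave (w : ℂ) (q : ℤ) (x : UnitAddCircle) :
    (wave w q x : ℂ) = w * fourier q x + (starRingEnd ℂ) w * fourier (-q) x := by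
  rw [wave, fourier_neg, ← map_mul, Complex.add_conj]

lemma abs_wave_le (w : ℂ) (q : ℤ) (x : UnitAddCircle) : |wave w q x| ≤ 2 * ‖w‖ := by
  have h := Complex.abs_re_le_norm (w * fourier q x)
  rw [norm_mul, norm_fourier_apply, mul_one] at h
  rw [wave, abs_mul, abs_two]
  gcongr

lemma wave_add (w : ℂ) (q : ℤ) (x b : UnitAddCircle) :
    wave w q (x + b) = wave (w * fourier q b) q x := by
  rw [wave, wave, fourier_add_apply, mul_right_comm, mul_assoc]

lemma wave_sub_wave (w v : ℂ) (q : ℤ) (x : UnitAddCircle) :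
    wave w q x - wave v q x = wave (w - v) q x := by
  rw [wave, wave, wave, sub_mul, Complex.sub_re, mul_sub]

lemma abs_wave_sub_le (w : ℂ) (q : ℕ) (x y : UnitAddCircle) :
    |wave w q x - wave w q y| ≤ 16 * ‖w‖ * q * ‖x - y‖ := by
  have hchar : ‖(fourier (q : ℤ) (x - y) : ℂ) - 1‖ ≤ 8 * (q * ‖x - y‖) := by
    have hnsmul : ‖(q : ℤ) • (x - y)‖ ≤ q * ‖x - y‖ := by
      rw [natCast_zsmul]
      exact norm_nsmul_le
    refine (norm_fourier_sub_one_le q (x - y)).trans ?_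
    gcongr
    linarith [Real.pi_lt_d2]
  have hfactor : wave w q x - wave w q y = wave (w * (fourier (q : ℤ) (x - y) - 1)) q y := by
    rw [mul_sub_one, ← wave_sub_wave, ← wave_add, add_sub_cancel]
  rw [hfactor]
  refine (abs_wave_le _ _ _).trans ?_
  rw [norm_mul]
  calc 2 * (‖w‖ * ‖(fourier (q : ℤ) (x - y) : ℂ) - 1‖)
      ≤ 2 * (‖w‖ * (8 * (q * ‖x - y‖))) := by gcongr
    _ = 16 * ‖w‖ * q * ‖x - y‖ := by ring

lemma coeff_wave (w : ℂ) {q : ℤ} (hq : q ≠ 0) (m : ℤ) :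
    coeff (wave w q) m = if m = q then w else if m = -q then (starRingEnd ℂ) w else 0 := by
  have hexpand (x : UnitAddCircle) : (fourier (-m) x : ℂ) * (wave w q x : ℂ)
      = w * fourier (-m + q) x + (starRingEnd ℂ) w * fourier (-m + -q) x := by
    rw [ofReal_wave, fourier_add, fourier_add]
    ring
  have hpos : -m + q = 0 ↔ m = q := by omega
  have hneg : -m + -q = 0 ↔ m = -q := by omega
  rw [coeff, fourierCoeff_eq_integral]
  simp only [hexpand]
  rw [integral_add (integrable_of_continuous (by fun_prop))
    (integrable_of_continuous (by fun_prop)), integral_const_mul, integral_const_mul,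
    integral_fourier, integral_fourier]
  simp only [hpos, hneg]
  rcases eq_or_ne m q with rfl | hmq
  · simp [show m ≠ -m by omega]
  · simp [hmq]

lemma integral_wave (w : ℂ) {q : ℤ} (hq : q ≠ 0) : ∫ x, wave w q x = 0 := by
  have h := coeff_wave w hq 0
  rw [coeff_zero, if_neg hq.symm, if_neg (by omega)] at h
  exact_mod_cast h

lemma integral_wave_sq (w : ℂ) {q : ℤ} (hq : q ≠ 0) : ∫ x, wave w q x ^ 2 = 2 * ‖w‖ ^ 2 := by
  have hre (z : ℂ) : (2 * z.re) ^ 2 = 2 * Complex.normSq z + 2 * (z ^ 2).re := by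
    rw [Complex.normSq_apply, pow_two z, Complex.mul_re]
    ring
  have hsq (x : UnitAddCircle) : wave w q x ^ 2 = 2 * ‖w‖ ^ 2 + wave (w ^ 2) (q + q) x := by
    rw [wave, wave, hre, Complex.normSq_eq_norm_sq, norm_mul, norm_fourier_apply, mul_one,
      fourier_add, mul_pow, pow_two (fourier q x : ℂ)]
  simp only [hsq]
  rw [integral_add (integrable_const _) (integrable_of_continuous (continuous_wave _ _)),
    integral_wave _ (by omega)]
  simp

lemma norm_exp_mul_I_sub_taylor_le {t : ℝ} (ht : |t| ≤ 1) :
    ‖Complex.exp (t * Complex.I) - (1 + t * Complex.I - t ^ 2 / 2)‖ ≤ t ^ 2 / 4 := by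
  have hnorm : ‖(t : ℂ) * Complex.I‖ = |t| := by simp
  have htaylor := Complex.exp_bound (hnorm.trans_le ht) (n := 3) (by norm_num)
  have hsum : ∑ m ∈ Finset.range 3, ((t : ℂ) * Complex.I) ^ m / m.factorial
      = 1 + t * Complex.I - t ^ 2 / 2 := by
    simp only [Finset.sum_range_succ, Finset.sum_range_zero, mul_pow, Complex.I_sq]
    norm_num [Nat.factorial]
    ring
  rw [hsum, hnorm] at htaylor
  refine htaylor.trans ?_
  norm_num [Nat.factorial]
  nlinarith [abs_nonneg t, sq_abs t, mul_le_mul_of_nonneg_right ht (sq_nonneg |t|)]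

lemma norm_expInt_le_of_integral_eq_zero {ν : ℝ} {F : UnitAddCircle → ℝ} (hF : Continuous F)
    (hF0 : ∫ x, F x = 0) (h : ∀ x, 2 * π * |ν| * |F x| ≤ 1) :
    ‖expInt ν F‖ ≤ 1 - (2 * π * ν) ^ 2 / 4 * ∫ x, F x ^ 2 := by
  set β : ℝ := 2 * π * ν with hβ
  have hβF (x : UnitAddCircle) : |β * F x| ≤ 1 := by
    rw [abs_mul, hβ, abs_mul, abs_of_pos Real.two_pi_pos]
    exact h x
  set s : ℝ := β ^ 2 * ∫ x, F x ^ 2 with hs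
  have hs_int : s = ∫ x, (β * F x) ^ 2 := by simp only [hs, mul_pow, integral_const_mul]
  have hβF_sq : Continuous fun x => (β * F x) ^ 2 := by fun_prop
  set T : UnitAddCircle → ℂ := fun x =>
    1 + (β * F x : ℝ) * Complex.I - ((β * F x) ^ 2 / 2 : ℝ) with hT
  have hT_cont : Continuous T := by fun_prop
  have hT_int : ∫ x, T x = ((1 - s / 2 : ℝ) : ℂ) := by
    rw [hT, integral_sub (integrable_of_continuous (by fun_prop))
      (integrable_of_continuous (by fun_prop)), integral_add (integrable_const _)
      (integrable_of_continuous (by fun_prop)), integral_mul_const, integral_complex_ofReal,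
      integral_complex_ofReal, integral_div, integral_const_mul, hF0, ← hs_int]
    simp
  have hs1 : s ≤ 1 := by
    rw [hs_int]
    refine (integral_mono (integrable_of_continuous hβF_sq) (integrable_const (1 : ℝ))
      fun x => (sq_le_one_iff_abs_le_one _).2 (hβF x)).trans_eq ?_
    simp
  have hdiff : ‖∫ x, (Complex.exp (2 * π * Complex.I * ν * F x) - T x)‖ ≤ s / 4 := by
    rw [hs_int, ← integral_div]
    refine norm_integral_le_of_norm_le (integrable_of_continuous (by fun_prop))
      (Eventually.of_forall fun x => ?_)
    rw [exp_eq_exp_I_mul_ofReal, mul_comm Complex.I]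
    simpa [hT, hβ] using norm_exp_mul_I_sub_taylor_le (hβF x)
  have hsplit : expInt ν F
      = (∫ x, T x) + ∫ x, (Complex.exp (2 * π * Complex.I * ν * F x) - T x) := by
    rw [integral_sub (integrable_of_continuous (continuous_exp_comp hF ν))
      (integrable_of_continuous hT_cont), expInt, add_sub_cancel]
  rw [hsplit, hT_int, show 1 - β ^ 2 / 4 * ∫ x, F x ^ 2 = (1 - s / 2) + s / 4 by rw [hs]; ring]
  refine (norm_add_le _ _).trans (add_le_add ?_ hdiff)
  rw [Complex.norm_real, Real.norm_of_nonneg (by linarith)]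

lemma norm_expInt_wave_le {ν : ℝ} {w : ℂ} {q : ℤ} (hq : q ≠ 0) (h : 2 * π * |ν| * ‖w‖ ≤ 1 / 2) :
    ‖expInt ν (wave w q)‖ ≤ Real.exp (-((2 * π * |ν| * ‖w‖) ^ 2 / 2)) := by
  have hle := norm_expInt_le_of_integral_eq_zero (ν := ν) (continuous_wave w q) (integral_wave w hq)
    fun x => by
      calc 2 * π * |ν| * |wave w q x| ≤ 2 * π * |ν| * (2 * ‖w‖) := by
            gcongr
            exact abs_wave_le w q x
        _ ≤ 1 := by linarith
  rw [integral_wave_sq w hq] at hle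
  refine hle.trans (le_trans (le_of_eq ?_) (Real.one_sub_le_exp_neg _))
  rw [mul_pow (2 * π), mul_pow _ ‖w‖, mul_pow (2 * π), sq_abs]
  ring

end Wave

/-! ### Near independence of slow and fast oscillations -/

section NearIndependence

variable {q : ℕ}

/-- The average of `f` over the translates by multiples of `1 / q`: the conditional expectation of
`f` with respect to the functions of period `1 / q`. -/
def cyclicMean (q : ℕ) (f : UnitAddCircle → ℂ) (x : UnitAddCircle) : ℂ :=
  (q : ℂ)⁻¹ * ∑ k ∈ Finset.range q, f (x + k • ((1 / q : ℝ) : UnitAddCircle))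

lemma nsmul_coe_one_div (q : ℕ) : q • ((1 / q : ℝ) : UnitAddCircle) = 0 := by
  rcases eq_or_ne q 0 with rfl | hq
  · exact zero_nsmul _
  · rw [← AddCircle.coe_nsmul, nsmul_eq_mul, mul_one_div_cancel (Nat.cast_ne_zero.2 hq)]
    exact AddCircle.coe_period 1

lemma periodic_cyclicMean (q : ℕ) (f : UnitAddCircle → ℂ) :
    Function.Periodic (cyclicMean q f) ((1 / q : ℝ) : UnitAddCircle) := fun x => by
  set b := ((1 / q : ℝ) : UnitAddCircle)
  have hshift := Finset.sum_range_succ' (fun k => f (x + k • b)) q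
  rw [Finset.sum_range_succ, nsmul_coe_one_div, zero_smul] at hshift
  simp only [cyclicMean]
  rw [add_right_cancel hshift]
  simp only [succ_nsmul', add_assoc, b]

lemma integral_cyclicMean (hq : q ≠ 0) {f : UnitAddCircle → ℂ} (hf : Integrable f) :
    ∫ x, cyclicMean q f x = ∫ x, f x := by
  simp only [cyclicMean]
  rw [integral_const_mul, integral_finsetSum _ fun k _ => hf.comp_add_right _]
  simp only [integral_add_right_eq_self, Finset.sum_const, Finset.card_range, nsmul_eq_mul]
  rw [inv_mul_cancel_left₀ (Nat.cast_ne_zero.2 hq)]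

lemma cyclicMean_mul {g : UnitAddCircle → ℂ}
    (hg : Function.Periodic g ((1 / q : ℝ) : UnitAddCircle)) (f : UnitAddCircle → ℂ) :
    (cyclicMean q fun x => f x * g x) = fun x => cyclicMean q f x * g x := by
  ext x
  simp only [cyclicMean, (hg.nsmul _) x, ← Finset.sum_mul, mul_assoc]

lemma lipschitzWith_cyclicMean (hq : q ≠ 0) {f : UnitAddCircle → ℂ} {K : NNReal}
    (hf : LipschitzWith K f) : LipschitzWith K (cyclicMean q f) :=
  LipschitzWith.of_dist_le_mul fun x y => by
    have hq0 : (0 : ℝ) < q := by exact_mod_cast hq.bot_lt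
    rw [dist_eq_norm, cyclicMean, cyclicMean, ← mul_sub, ← Finset.sum_sub_distrib, norm_mul,
      norm_inv, Complex.norm_natCast, inv_mul_le_iff₀ hq0]
    refine (norm_sum_le_of_le _ fun k _ => ?_).trans_eq
      (by rw [Finset.sum_const, Finset.card_range, nsmul_eq_mul])
    rw [← dist_eq_norm, ← dist_add_right x y (k • ((1 / q : ℝ) : UnitAddCircle))]
    exact hf.dist_le_mul _ _

lemma exists_norm_sub_nsmul_le (hq : q ≠ 0) (x : UnitAddCircle) :
    ∃ k : ℕ, ‖x - k • ((1 / q : ℝ) : UnitAddCircle)‖ ≤ 1 / q := by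
  have hq0 : (0 : ℝ) < q := by exact_mod_cast hq.bot_lt
  obtain ⟨t, ht, rfl⟩ : ∃ t : ℝ, 0 ≤ t ∧ (t : UnitAddCircle) = x := by
    obtain ⟨t, ht, htx⟩ := AddCircle.coe_image_Ico_eq (1 : ℝ) 0 ▸ Set.mem_univ x
    exact ⟨t, ht.1, htx⟩
  refine ⟨⌊q * t⌋₊, ?_⟩
  rw [← AddCircle.coe_nsmul, ← AddCircle.coe_sub]
  refine (norm_coe_le_abs _).trans ?_
  have hfloor_le := Nat.floor_le (a := q * t) (by positivity)
  have hlt_floor := Nat.lt_floor_add_one (q * t)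
  rw [show t - ⌊q * t⌋₊ • (1 / (q : ℝ)) = (q * t - ⌊q * t⌋₊) / q by
    rw [nsmul_eq_mul]; field_simp, abs_of_nonneg (div_nonneg (by linarith) hq0.le)]
  gcongr
  linarith

lemma norm_sub_le_of_periodic (hq : q ≠ 0) {F : UnitAddCircle → ℂ} {K : NNReal}
    (hF : LipschitzWith K F) (hper : Function.Periodic F ((1 / q : ℝ) : UnitAddCircle))
    (x y : UnitAddCircle) : ‖F x - F y‖ ≤ K / q := by
  obtain ⟨k, hk⟩ := exists_norm_sub_nsmul_le hq (x - y)
  rw [← (hper.nsmul k) y, div_eq_mul_one_div (K : ℝ)]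
  refine (hF.norm_sub_le _ _).trans (mul_le_mul_of_nonneg_left ?_ K.coe_nonneg)
  rw [← sub_sub]
  exact hk

lemma norm_sub_integral_le {F : UnitAddCircle → ℂ} (hF : Continuous F) {C : ℝ}
    (hC : ∀ x y, ‖F x - F y‖ ≤ C) (x : UnitAddCircle) : ‖F x - ∫ y, F y‖ ≤ C := by
  have hmean : F x - ∫ y, F y = ∫ y, (F x - F y) := by
    rw [integral_sub (integrable_const _) (integrable_of_continuous hF)]
    simp
  rw [hmean]
  simpa using norm_integral_le_of_norm_le_const (μ := (volume : Measure UnitAddCircle))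
    (Eventually.of_forall (hC x))

lemma norm_integral_mul_sub_le {f g : UnitAddCircle → ℂ} {K : NNReal} (hf : LipschitzWith K f)
    (hg : Continuous g) (hg1 : ∀ x, ‖g x‖ ≤ 1) (hq : q ≠ 0)
    (hper : Function.Periodic g ((1 / q : ℝ) : UnitAddCircle)) :
    ‖(∫ x, f x * g x) - (∫ x, f x) * ∫ x, g x‖ ≤ K / q := by
  have hfc := hf.continuous
  have hM := lipschitzWith_cyclicMean hq hf
  have hMc := hM.continuous
  have hdev (x : UnitAddCircle) : ‖cyclicMean q f x - ∫ y, f y‖ ≤ K / q := by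
    rw [← integral_cyclicMean hq (integrable_of_continuous hfc)]
    exact norm_sub_integral_le hMc (norm_sub_le_of_periodic hq hM (periodic_cyclicMean q f)) x
  have hcov : (∫ x, f x * g x) - (∫ x, f x) * ∫ x, g x
      = ∫ x, (cyclicMean q f x - ∫ y, f y) * g x := by
    simp only [sub_mul]
    rw [integral_sub (integrable_of_continuous (by fun_prop))
      (integrable_of_continuous (by fun_prop)), integral_const_mul, ← cyclicMean_mul hper,
      integral_cyclicMean hq (integrable_of_continuous (by fun_prop))]
  have hbound (x : UnitAddCircle) : ‖(cyclicMean q f x - ∫ y, f y) * g x‖ ≤ K / q := by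
    rw [norm_mul]
    exact (mul_le_of_le_one_right (norm_nonneg _) (hg1 x)).trans (hdev x)
  rw [hcov]
  simpa using norm_integral_le_of_norm_le_const (μ := (volume : Measure UnitAddCircle))
    (Eventually.of_forall hbound)

lemma fourier_coe_one_div (q : ℕ) :
    (fourier (q : ℤ) ((1 / q : ℝ) : UnitAddCircle) : ℂ) = 1 := by
  rw [fourier_eq_fourier_one_zsmul, natCast_zsmul, nsmul_coe_one_div, fourier_eval_zero]

lemma periodic_wave (q : ℕ) (w : ℂ) :
    Function.Periodic (wave w q) ((1 / q : ℝ) : UnitAddCircle) := fun x => by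
  rw [wave_add, fourier_coe_one_div, mul_one]

variable {α ν : ℝ}

lemma lipschitzWith_exp_sum_wave (hq : IsGoodDenom α q) (w : ℕ → ℂ) {s : Finset ℕ}
    (hs : ∀ p ∈ s, IsGoodDenom α p ∧ 32 ≤ p ∧ p < q)
    (hw : ∀ p ∈ s, 2 * π * |ν| * ‖w p‖ ≤ 1 / 4) :
    LipschitzWith (12 * NNReal.sqrt q) fun x =>
      Complex.exp (2 * π * Complex.I * ν * (∑ p ∈ s, wave (w p) p x : ℝ)) :=
  LipschitzWith.of_dist_le_mul fun x y => by
    rw [dist_eq_norm, dist_eq_norm]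
    refine (norm_exp_sub_exp_le ν _ _).trans ?_
    have hosc : |(∑ p ∈ s, wave (w p) p x) - ∑ p ∈ s, wave (w p) p y|
        ≤ ∑ p ∈ s, 16 * ‖w p‖ * p * ‖x - y‖ := by
      rw [← Finset.sum_sub_distrib]
      exact (Finset.abs_sum_le_sum_abs _ _).trans
        (Finset.sum_le_sum fun p _ => abs_wave_sub_le _ _ _ _)
    calc 2 * π * |ν| * |(∑ p ∈ s, wave (w p) p x) - ∑ p ∈ s, wave (w p) p y|
        ≤ 2 * π * |ν| * ∑ p ∈ s, 16 * ‖w p‖ * p * ‖x - y‖ := by gcongr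
      _ = ∑ p ∈ s, 2 * π * |ν| * ‖w p‖ * (16 * (p * ‖x - y‖)) := by
          rw [Finset.mul_sum]
          exact Finset.sum_congr rfl fun p _ => by ring
      _ ≤ ∑ p ∈ s, 1 / 4 * (16 * (p * ‖x - y‖)) :=
          Finset.sum_le_sum fun p hp => mul_le_mul_of_nonneg_right (hw p hp) (by positivity)
      _ = 4 * (∑ p ∈ s, (p : ℝ)) * ‖x - y‖ := by
          rw [Finset.mul_sum, Finset.sum_mul]
          exact Finset.sum_congr rfl fun p _ => by ring
      _ ≤ 4 * (3 * √q) * ‖x - y‖ := by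
          gcongr
          exact sum_goodDenom_le s hq hs
      _ = (12 * NNReal.sqrt q : NNReal) * ‖x - y‖ := by
          push_cast
          ring

lemma norm_expInt_add_wave_le (hq : IsGoodDenom α q) (w : ℕ → ℂ) {s : Finset ℕ}
    (hs : ∀ p ∈ s, IsGoodDenom α p ∧ 32 ≤ p ∧ p < q)
    (hw : ∀ p ∈ s, 2 * π * |ν| * ‖w p‖ ≤ 1 / 4) (v : ℂ) :
    ‖expInt ν (fun x => wave v q x + ∑ p ∈ s, wave (w p) p x)‖
      ≤ ‖expInt ν (wave v q)‖ * ‖expInt ν (fun x => ∑ p ∈ s, wave (w p) p x)‖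
        + 12 * (1 / √q) := by
  have hq0 : q ≠ 0 := hq.pos.ne'
  have hind := norm_integral_mul_sub_le (lipschitzWith_exp_sum_wave hq w hs hw)
    (continuous_exp_comp (continuous_wave v q) ν) (fun x => (norm_exp_eq_one ν _).le) hq0
    fun x => by rw [periodic_wave]
  simp only [← exp_add, NNReal.coe_mul, NNReal.coe_ofNat, Real.coe_sqrt, NNReal.coe_natCast,
    mul_div_assoc, Real.sqrt_div_self'] at hind
  simp only [add_comm (wave v q _), mul_comm ‖expInt ν (wave v q)‖]
  rw [← norm_mul]
  simp only [expInt]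
  linarith [norm_le_norm_add_norm_sub'
    (∫ x, Complex.exp (2 * π * Complex.I * ν * ((∑ p ∈ s, wave (w p) p x) + wave v q x : ℝ)))
    ((∫ x, Complex.exp (2 * π * Complex.I * ν * (∑ p ∈ s, wave (w p) p x : ℝ)))
      * ∫ x, Complex.exp (2 * π * Complex.I * ν * wave v q x))]

lemma norm_expInt_sum_wave_le (w : ℕ → ℂ) (s : Finset ℕ) (hs : ∀ q ∈ s, IsGoodDenom α q ∧ 32 ≤ q)
    (hw : ∀ q ∈ s, 2 * π * |ν| * ‖w q‖ ≤ 1 / 4) :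
    ‖expInt ν (fun x => ∑ q ∈ s, wave (w q) q x)‖
      ≤ Real.exp (-∑ q ∈ s, (2 * π * |ν| * ‖w q‖) ^ 2 / 2) + 12 * ∑ q ∈ s, 1 / √(q : ℝ) := by
  induction s using Finset.induction_on_max with
  | empty => simp [expInt]
  | insert q s hlt ih =>
    obtain ⟨⟨hq, -⟩, hs⟩ := (Finset.forall_mem_insert ..).1 hs
    obtain ⟨hwq, hw⟩ := (Finset.forall_mem_insert ..).1 hw
    have hqs : q ∉ s := fun h => (hlt q h).false
    set e := (2 * π * |ν| * ‖w q‖) ^ 2 / 2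
    have hwave := norm_expInt_wave_le (ν := ν) (w := w q) (q := q) (by exact_mod_cast hq.pos.ne')
      (hwq.trans (by norm_num))
    have hexp : Real.exp (-e) ≤ 1 := Real.exp_le_one_iff.2 (neg_nonpos.2 (by positivity))
    have hsum : 0 ≤ 12 * ∑ p ∈ s, 1 / √(p : ℝ) := by positivity
    have hstep := norm_expInt_add_wave_le hq w
      (fun p hp => ⟨(hs p hp).1, (hs p hp).2, hlt p hp⟩) hw (w q)
    simp only [Finset.sum_insert hqs]
    calc ‖expInt ν (fun x => wave (w q) q x + ∑ p ∈ s, wave (w p) p x)‖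
        ≤ Real.exp (-e) * (Real.exp (-∑ p ∈ s, (2 * π * |ν| * ‖w p‖) ^ 2 / 2)
            + 12 * ∑ p ∈ s, 1 / √(p : ℝ)) + 12 * (1 / √q) := by
          refine hstep.trans ?_
          gcongr
          exact ih hs hw
      _ ≤ Real.exp (-e) * Real.exp (-∑ p ∈ s, (2 * π * |ν| * ‖w p‖) ^ 2 / 2)
            + 12 * ∑ p ∈ s, 1 / √(p : ℝ) + 12 * (1 / √q) := by
          rw [mul_add]
          exact add_le_add_left (add_le_add_right (mul_le_of_le_one_left hsum hexp) _) _
      _ = _ := by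
          rw [← Real.exp_add, ← neg_add]
          ring

end NearIndependence

/-! ### Birkhoff sums over the rotation -/

section BirkhoffSums

lemma birkhoffSum_add_right (a : UnitAddCircle) (F : UnitAddCircle → ℝ) (N : ℕ)
    (x : UnitAddCircle) :
    birkhoffSum (· + a) F N x = ∑ k ∈ Finset.range N, F (x + k • a) := by
  simp only [birkhoffSum, add_right_iterate]

lemma continuous_birkhoffSum (a : UnitAddCircle) {F : UnitAddCircle → ℝ} (hF : Continuous F)
    (N : ℕ) : Continuous (birkhoffSum (· + a) F N) := by
  simp only [funext (birkhoffSum_add_right a F N)]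
  fun_prop

lemma birkhoffSum_wave (a : UnitAddCircle) (w : ℂ) (q : ℤ) (N : ℕ) (x : UnitAddCircle) :
    birkhoffSum (· + a) (wave w q) N x = wave (w * charSum a N q) q x := by
  simp only [birkhoffSum_add_right, wave_add]
  simp only [charSum, Finset.mul_sum, wave, Finset.sum_mul, Complex.re_sum]

lemma coeff_birkhoffSum (a : UnitAddCircle) {F : UnitAddCircle → ℝ} (hF : Continuous F) (N : ℕ)
    (m : ℤ) : coeff (birkhoffSum (· + a) F N) m = charSum a N m * coeff F m := by
  simp only [coeff, birkhoffSum_add_right, Complex.ofReal_sum]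
  rw [fourierCoeff_finsetSum _ fun k _ => integrable_of_continuous (by fun_prop), charSum,
    Finset.sum_mul]
  exact Finset.sum_congr rfl fun k _ => fourierCoeff_translate (fun x => (F x : ℂ)) (k • a) m

variable {a : UnitAddCircle} {ν : ℝ} {F : UnitAddCircle → ℝ} {G : UnitAddCircle → ℂ}

lemma ae_cocycle_nsmul
    (hG : ∀ᵐ x, G (x + a) = Complex.exp (2 * π * Complex.I * ν * F x) * G x) (N : ℕ) :
    ∀ᵐ x, G (x + N • a)
      = Complex.exp (2 * π * Complex.I * ν * birkhoffSum (· + a) F N x) * G x := by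
  induction N with
  | zero => simp [birkhoffSum_zero]
  | succ N ih =>
    filter_upwards [ih, (measurePreserving_add_right volume (N • a)).quasiMeasurePreserving.ae hG]
      with x hN hstep
    rw [succ_nsmul, ← add_assoc, hstep, hN, ← mul_assoc, ← exp_add, birkhoffSum_succ,
      add_right_iterate, add_comm (birkhoffSum _ _ _ _)]

lemma exists_forall_lt_norm_expInt_birkhoffSum (hGm : AEStronglyMeasurable G)
    (hG1 : ∀ᵐ x, ‖G x‖ = 1)
    (hG : ∀ᵐ x, G (x + a) = Complex.exp (2 * π * Complex.I * ν * F x) * G x)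
    {ε : ℝ} (hε : 0 < ε) :
    ∃ δ > 0, ∀ N : ℕ, ‖N • a‖ < δ → 1 - ε < ‖expInt ν (birkhoffSum (· + a) F N)‖ := by
  obtain ⟨δ, hδ, hclose⟩ :=
    Metric.tendsto_nhds_nhds.1 (tendsto_integral_translate_mul_conj hGm hG1) ε hε
  refine ⟨δ, hδ, fun N hN => ?_⟩
  have hcorr : expInt ν (birkhoffSum (· + a) F N) = ∫ x, G (x + N • a) * (starRingEnd ℂ) (G x) := by
    refine integral_congr_ae ?_
    filter_upwards [ae_cocycle_nsmul hG N, hG1] with x hx hx1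
    rw [hx, mul_assoc _ (G x), Complex.mul_conj, Complex.normSq_eq_norm_sq, hx1]
    simp
  have hdist := hclose (x := N • a) (by simpa using hN)
  rw [← hcorr, dist_eq_norm, norm_sub_rev] at hdist
  have := norm_sub_norm_le (1 : ℂ) (expInt ν (birkhoffSum (· + a) F N))
  rw [norm_one] at this
  linarith

end BirkhoffSums

/-! ### The size of a single coefficient -/

section SingleScale

lemma hasSum_two_mul_sq_norm_coeff {f : UnitAddCircle → ℝ} (hf : MemLp f 2) (h0 : coeff f 0 = 0) :
    HasSum (fun n : ℕ => 2 * ‖coeff f n‖ ^ 2) (∫ x, f x ^ 2) := by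
  simpa only [norm_coeff_neg, ← two_mul, h0, norm_zero, ne_eq, OfNat.ofNat_ne_zero,
    not_false_eq_true, zero_pow, add_zero] using (hasSum_sq_norm_coeff hf).nat_add_neg

lemma norm_mul_sq_le_div {c : ℤ → ℂ} {C : ℝ} (hC : ∀ m : ℤ, ‖c m‖ * |(m : ℝ)| ^ 3 ≤ C) {n : ℕ}
    (hn : 0 < n) : ‖c n‖ * n ^ 2 ≤ C / n := by
  rw [le_div_iff₀ (by exact_mod_cast hn)]
  calc ‖c n‖ * n ^ 2 * n = ‖c n‖ * |((n : ℤ) : ℝ)| ^ 3 := by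
        rw [Int.cast_natCast, Nat.abs_cast]
        ring
    _ ≤ C := hC n

lemma summable_sq_nat_mul_norm {c : ℤ → ℂ} {C : ℝ} (hC : ∀ m : ℤ, ‖c m‖ * |(m : ℝ)| ^ 3 ≤ C) :
    Summable fun n : ℕ => (2 * (n : ℝ) * ‖c n‖) ^ 2 := by
  refine Summable.of_nonneg_of_le (fun _ => by positivity) (fun n => ?_)
    ((Real.summable_one_div_nat_pow.2 (by norm_num : 1 < 2)).mul_left ((2 * C) ^ 2))
  rcases Nat.eq_zero_or_pos n with rfl | hn
  · simp
  have hn1 : (1 : ℝ) ≤ n := by exact_mod_cast hn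
  rw [mul_one_div, ← div_pow]
  gcongr
  calc 2 * (n : ℝ) * ‖c n‖ = 2 * (‖c n‖ * n ^ 1) := by ring
    _ ≤ 2 * (‖c n‖ * n ^ 2) := by gcongr; norm_num
    _ ≤ 2 * (C / n) := by gcongr; exact norm_mul_sq_le_div hC hn
    _ = 2 * C / n := by ring

/-- An almost period `N` of the rotation by `α` on the scale of the denominator `q`: during `N`
steps the `q`-th power of the rotation has not yet turned around the circle, while `N` steps of the
rotation move points by much less than `1 / q`. -/
structure IsAlmostPeriod (α : ℝ) (q N : ℕ) : Prop where
  isGoodDenom : IsGoodDenom α q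
  mul_norm_le : N * ‖q • (α : UnitAddCircle)‖ ≤ 1 / 2
  norm_nsmul_le : ‖N • (α : UnitAddCircle)‖ ≤ 1 / (2 * q)

variable {α : ℝ} {q N m : ℕ}

lemma IsAlmostPeriod.norm_charSum_le_two_mul (h : IsAlmostPeriod α q N) (hα : Irrational α)
    (hm : ¬ q ∣ m) : ‖charSum (α : UnitAddCircle) N m‖ ≤ 2 * m := by
  have hq0 : (0 : ℝ) < q := by exact_mod_cast h.isGoodDenom.pos
  rcases le_or_gt (m * ‖q • (α : UnitAddCircle)‖) (1 / 2) with hmq | hmq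
  · have hfar := h.isGoodDenom.le_norm_nsmul_of_not_dvd hm hmq
    have hgeom := norm_charSum_mul_norm_zsmul_le (α : UnitAddCircle) N m
    rw [natCast_zsmul, Int.cast_natCast, Nat.abs_cast] at hgeom
    have hle : ‖charSum (α : UnitAddCircle) N m‖ * (1 / (2 * q)) ≤ 2 * m * (1 / (2 * q)) :=
      calc _ ≤ ‖charSum (α : UnitAddCircle) N m‖ * ‖m • (α : UnitAddCircle)‖ := by gcongr
        _ ≤ _ := hgeom
        _ ≤ _ := by gcongr; exact h.norm_nsmul_le
    exact le_of_mul_le_mul_right hle (by positivity)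
  · have hNm : (N : ℝ) ≤ m := le_of_mul_le_mul_right (h.mul_norm_le.trans hmq.le)
      (norm_nsmul_pos hα h.isGoodDenom.pos.ne')
    linarith [norm_charSum_le (α : UnitAddCircle) N m, (Nat.cast_nonneg m : (0 : ℝ) ≤ m)]

lemma IsAlmostPeriod.norm_charSum_le_div (h : IsAlmostPeriod α q N)
    (hm : 0 < ‖m • (α : UnitAddCircle)‖) :
    ‖charSum (α : UnitAddCircle) N m‖ ≤ m / ‖m • (α : UnitAddCircle)‖ / q := by
  have hq0 : (0 : ℝ) < q := by exact_mod_cast h.isGoodDenom.pos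
  have hgeom := norm_charSum_mul_norm_zsmul_le (α : UnitAddCircle) N m
  rw [natCast_zsmul, Int.cast_natCast, Nat.abs_cast] at hgeom
  rw [div_right_comm, le_div_iff₀ hm]
  calc ‖charSum (α : UnitAddCircle) N m‖ * ‖m • (α : UnitAddCircle)‖
      ≤ 2 * m * ‖N • (α : UnitAddCircle)‖ := hgeom
    _ ≤ 2 * m * (1 / (2 * q)) := by gcongr; exact h.norm_nsmul_le
    _ = m / q := by field_simp

-- The time is `N = ⌊δ / (q r)⌋ q`.
lemma exists_isAlmostPeriod (hq : IsGoodDenom α q) {ε δ r : ℝ} (hε : 0 < ε) (hr : 0 < r)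
    (hδ : δ ≤ ε / 2) (hclose : ε * ‖q • (α : UnitAddCircle)‖ ≤ r) (hqr : q * r ≤ δ / 2) :
    ∃ N, IsAlmostPeriod α q N ∧ N * r ≤ δ ∧ δ / 2 ≤ N * r := by
  have hq0 : (0 : ℝ) < q := by exact_mod_cast hq.pos
  have hδ0 : 0 ≤ δ := by linarith [mul_pos hq0 hr]
  set k := ⌊δ / (q * r)⌋₊
  have hle := Nat.floor_le (a := δ / (q * r)) (by positivity)
  have hlt := Nat.lt_floor_add_one (δ / (q * r))
  rw [le_div_iff₀ (by positivity)] at hle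
  rw [div_lt_iff₀ (by positivity)] at hlt
  have hcast : ((k * q : ℕ) : ℝ) = k * q := Nat.cast_mul k q
  have hupper : ((k * q : ℕ) : ℝ) * r ≤ δ := by rw [hcast]; linarith
  have hturn : ((k * q : ℕ) : ℝ) * ‖q • (α : UnitAddCircle)‖ ≤ 1 / 2 := by
    refine le_of_mul_le_mul_left ?_ hε
    calc ε * ((k * q : ℕ) * ‖q • (α : UnitAddCircle)‖)
        = (k * q : ℕ) * (ε * ‖q • (α : UnitAddCircle)‖) := by ring
      _ ≤ (k * q : ℕ) * r := by gcongr
      _ ≤ ε * (1 / 2) := by linarith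
  refine ⟨k * q, ⟨hq, hturn, ?_⟩, hupper, by rw [hcast]; linarith⟩
  calc ‖(k * q) • (α : UnitAddCircle)‖ ≤ k * ‖q • (α : UnitAddCircle)‖ := by
        rw [mul_smul]
        exact norm_nsmul_le
    _ ≤ 1 / (2 * q) := by
        rw [le_div_iff₀ (by positivity)]
        rw [hcast] at hturn
        linarith

end SingleScale

section ScaleRemainder

/-- The part of the Birkhoff sum `S_N f` over the rotation by `a` that remains after its mean and
its harmonics of frequency `±q` are removed. -/
def scaleRemainder (a : UnitAddCircle) (f : UnitAddCircle → ℝ) (N q : ℕ) (x : UnitAddCircle) : ℝ :=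
  birkhoffSum (· + a) f N x - N * (∫ y, f y) - wave (charSum a N q * coeff f q) q x

variable {a : UnitAddCircle} {f : UnitAddCircle → ℝ} {q : ℕ}

lemma continuous_scaleRemainder (hf : Continuous f) (N : ℕ) :
    Continuous (scaleRemainder a f N q) :=
  ((continuous_birkhoffSum a hf N).sub continuous_const).sub (continuous_wave _ _)

lemma coeff_scaleRemainder (hf : Continuous f) (N : ℕ) (hq : 0 < q) (n : ℕ) :
    coeff (scaleRemainder a f N q) n
      = if n = 0 ∨ n = q then 0 else charSum a N n * coeff f n := by
  have hsum := continuous_birkhoffSum a hf N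
  have hexpand : coeff (scaleRemainder a f N q) n = charSum a N n * coeff f n
      - (if (n : ℤ) = 0 then ((N * ∫ y, f y : ℝ) : ℂ) else 0)
      - coeff (wave (charSum a N q * coeff f q) q) n := by
    rw [← coeff_birkhoffSum a hf, ← coeff_const, ← coeff_sub (integrable_of_continuous hsum)
      (integrable_const _), ← coeff_sub
      (integrable_of_continuous (by fun_prop)) (integrable_of_continuous (continuous_wave _ _))]
    rfl
  rw [hexpand, coeff_wave _ (by exact_mod_cast hq.ne')]
  by_cases hn0 : n = 0
  · subst hn0
    rw [if_neg (by omega : ¬ ((0 : ℕ) : ℤ) = q), if_neg (by omega : ¬ ((0 : ℕ) : ℤ) = -q)]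
    simp [charSum, coeff_zero]
  rw [if_neg (by omega : ¬ (n : ℤ) = 0), if_neg (by omega : ¬ (n : ℤ) = -q), sub_zero]
  by_cases hnq : n = q
  · simp [hnq]
  · simp [hn0, hnq]

lemma tsum_indicator_multiples (hq : 0 < q) (g : ℕ → ℝ) :
    ∑' n, {n | q ∣ n ∧ n ≠ 0 ∧ n ≠ q}.indicator g n = ∑' l, g ((l + 2) * q) := by
  have hinj : Function.Injective fun l : ℕ => (l + 2) * q := fun l l' h => by
    have := Nat.eq_of_mul_eq_mul_right hq h
    omega
  have hmem (l : ℕ) : (l + 2) * q ∈ {n | q ∣ n ∧ n ≠ 0 ∧ n ≠ q} :=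
    ⟨dvd_mul_left _ _, by positivity, by nlinarith⟩
  rw [← hinj.tsum_eq]
  · exact tsum_congr fun l => Set.indicator_of_mem (hmem l) g
  · intro n hn
    obtain ⟨⟨l, rfl⟩, h0, h1⟩ := Set.mem_of_indicator_ne_zero hn
    have hl0 : l ≠ 0 := by rintro rfl; simp at h0
    have hl1 : l ≠ 1 := by rintro rfl; simp at h1
    exact ⟨l - 2, by simp only []; rw [Nat.sub_add_cancel (by omega), mul_comm]⟩

lemma integral_sq_scaleRemainder_le (hf : Continuous f) (N : ℕ) (hq : 0 < q) :
    ∫ x, scaleRemainder a f N q x ^ 2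
      ≤ 2 * (N ^ 2 * ∑' l : ℕ, ‖coeff f ((l + 2) * q)‖ ^ 2
        + ∑' n : ℕ, if q ∣ n then 0 else (‖charSum a N n‖ * ‖coeff f n‖) ^ 2) := by
  have hparseval := hasSum_two_mul_sq_norm_coeff
    (memLp_of_continuous (continuous_scaleRemainder hf N) 2)
    (by simpa using coeff_scaleRemainder (a := a) hf N hq 0)
  set A : ℕ → ℝ := {n | q ∣ n ∧ n ≠ 0 ∧ n ≠ q}.indicator fun n => (N * ‖coeff f n‖) ^ 2 with hA
  set B : ℕ → ℝ := fun n => if q ∣ n then 0 else (‖charSum a N n‖ * ‖coeff f n‖) ^ 2 with hB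
  have hsummable : Summable fun n : ℕ => (N * ‖coeff f n‖) ^ 2 := by
    simp only [mul_pow]
    exact ((hasSum_sq_norm_coeff (memLp_of_continuous hf 2)).summable.comp_injective
      Nat.cast_injective).mul_left _
  have hAsum : Summable A := hsummable.indicator _
  have hBsum : Summable B := by
    refine hsummable.of_nonneg_of_le (fun n => by positivity) fun n => ?_
    simp only [hB]
    split_ifs
    · positivity
    · gcongr
      exact norm_charSum_le _ _ _
  have hterm (n : ℕ) : ‖coeff (scaleRemainder a f N q) n‖ ^ 2 ≤ A n + B n := by
    rw [coeff_scaleRemainder hf N hq]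
    by_cases hn : n = 0 ∨ n = q
    · rw [if_pos hn, norm_zero, zero_pow two_ne_zero]
      exact add_nonneg (Set.indicator_nonneg (fun _ _ => by positivity) n) (by positivity)
    rw [if_neg hn, norm_mul]
    by_cases hdvd : q ∣ n
    · have hmem : n ∈ {n | q ∣ n ∧ n ≠ 0 ∧ n ≠ q} := ⟨hdvd, not_or.1 hn⟩
      simp only [hA, hB, if_pos hdvd, add_zero, Set.indicator_of_mem hmem]
      gcongr
      exact norm_charSum_le _ _ _
    · simp only [hA, hB, if_neg hdvd]
      rw [Set.indicator_of_notMem fun h => hdvd h.1, zero_add]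
  have hmultiples : ∑' n, A n = N ^ 2 * ∑' l : ℕ, ‖coeff f ((l + 2) * q)‖ ^ 2 := by
    rw [hA, tsum_indicator_multiples hq, ← tsum_mul_left]
    push_cast
    simp only [mul_pow]
  rw [← hmultiples, ← hAsum.tsum_add hBsum, ← tsum_mul_left, ← hparseval.tsum_eq]
  exact hparseval.summable.tsum_le_tsum (fun n => by gcongr; exact hterm n)
    ((hAsum.add hBsum).mul_left 2)

lemma norm_expInt_birkhoffSum_le (hf : Continuous f) (ν : ℝ) (N q : ℕ) :
    ‖expInt ν (birkhoffSum (· + a) f N)‖ ≤ ‖expInt ν (wave (charSum a N q * coeff f q) q)‖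
      + 2 * π * |ν| * ∫ x, |scaleRemainder a f N q x| := by
  have hwave := continuous_wave (charSum a N q * coeff f q) q
  have hle := norm_expInt_le_add (continuous_birkhoffSum a hf N)
    (Z := fun x => wave (charSum a N q * coeff f q) q x + N * ∫ y, f y) (by fun_prop) ν
  rw [norm_expInt_add_const] at hle
  simpa only [scaleRemainder, sub_sub, add_comm] using hle

end ScaleRemainder

section SmallCoefficient

variable {α : ℝ} {φ : UnitAddCircle → ℝ} {C : ℝ} {𝓕 : Filter ℕ} {N : ℕ → ℕ}

lemma tendsto_tsum_off_multiples (hα : Irrational α) {c : ℤ → ℂ}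
    (hC : ∀ m : ℤ, ‖c m‖ * |(m : ℝ)| ^ 3 ≤ C) (h𝓕 : 𝓕 ≤ atTop)
    (hN : ∀ᶠ q in 𝓕, IsAlmostPeriod α q (N q)) :
    Tendsto (fun q => ∑' n : ℕ, if q ∣ n then 0 else
      (‖charSum (α : UnitAddCircle) (N q) n‖ * ‖c n‖) ^ 2) 𝓕 (nhds 0) := by
  rw [show nhds (0 : ℝ) = nhds (∑' _ : ℕ, 0) by rw [tsum_zero]]
  refine tendsto_tsum_of_dominated_convergence (summable_sq_nat_mul_norm hC) (fun n => ?_) ?_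
  · rcases Nat.eq_zero_or_pos n with rfl | hn
    · simp [tendsto_const_nhds]
    set b := ‖n • (α : UnitAddCircle)‖
    have hb : 0 < b := norm_nsmul_pos hα hn.ne'
    have hlim : Tendsto (fun q : ℕ => (n / b * ‖c n‖ / (q : ℝ)) ^ 2) 𝓕 (nhds 0) := by
      simpa using ((tendsto_const_div_atTop_nhds_zero_nat (n / b * ‖c n‖)).mono_left h𝓕).pow 2
    refine squeeze_zero' (Eventually.of_forall fun q => ?_) ?_ hlim
    · split_ifs <;> positivity
    filter_upwards [hN] with q hq
    split_ifs
    · positivity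
    · rw [mul_div_right_comm]
      gcongr
      exact hq.norm_charSum_le_div hb
  · filter_upwards [hN] with q hq n
    split_ifs with hdvd
    · rw [norm_zero]
      positivity
    · rw [Real.norm_of_nonneg (by positivity)]
      gcongr
      exact hq.norm_charSum_le_two_mul hα hdvd

lemma tendsto_integral_sq_scaleRemainder (hα : Irrational α) (hφ : Continuous φ)
    (hC : ∀ m : ℤ, ‖coeff φ m‖ * |(m : ℝ)| ^ 3 ≤ C) (h1 : H1 φ) (h𝓕 : 𝓕 ≤ atTop)
    (hN : ∀ᶠ q in 𝓕, IsAlmostPeriod α q (N q)) {δ : ℝ}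
    (hδ : ∀ᶠ q in 𝓕, N q * ‖coeff φ q‖ ≤ δ) :
    Tendsto (fun q => ∫ x, scaleRemainder (α : UnitAddCircle) φ (N q) q x ^ 2) 𝓕 (nhds 0) := by
  obtain ⟨K, hK, hH1⟩ := h1
  have hmult : Tendsto (fun q => δ ^ 2 * |K q|) 𝓕 (nhds 0) := by
    simpa using (hK.tendsto_atTop_zero.mono_left h𝓕).abs.const_mul (δ ^ 2)
  have hlim := (hmult.add (tendsto_tsum_off_multiples hα hC h𝓕 hN)).const_mul 2
  rw [add_zero, mul_zero] at hlim
  refine squeeze_zero' (Eventually.of_forall fun q => integral_nonneg fun x => sq_nonneg _) ?_ hlim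
  filter_upwards [hN, hδ, h𝓕 hH1] with q hq hqδ hH
  refine (integral_sq_scaleRemainder_le hφ (N q) hq.isGoodDenom.pos).trans ?_
  refine mul_le_mul_of_nonneg_left (add_le_add_left ?_ _) two_pos.le
  calc (N q : ℝ) ^ 2 * ∑' l : ℕ, ‖coeff φ ((l + 2) * q)‖ ^ 2
      ≤ N q ^ 2 * (K q * ‖coeff φ q‖ ^ 2) := by gcongr
    _ = (N q * ‖coeff φ q‖) ^ 2 * K q := by ring
    _ ≤ (N q * ‖coeff φ q‖) ^ 2 * |K q| := by gcongr; exact le_abs_self _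
    _ ≤ δ ^ 2 * |K q| := by gcongr

lemma eventually_exists_isAlmostPeriod (hα : Irrational α) {c : ℤ → ℂ}
    (hC : ∀ m : ℤ, ‖c m‖ * |(m : ℝ)| ^ 3 ≤ C) {ε δ : ℝ} (hε : 0 < ε) (hδ : 0 < δ)
    (hδε : δ ≤ ε / 2) :
    ∀ᶠ q : ℕ in atTop, IsGoodDenom α q → ε * ‖q • (α : UnitAddCircle)‖ ≤ ‖c q‖ →
      ∃ N, IsAlmostPeriod α q N ∧ N * ‖c q‖ ≤ δ ∧ δ / 2 ≤ N * ‖c q‖ := by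
  have hlim := tendsto_const_div_atTop_nhds_zero_nat C
  filter_upwards [hlim.eventually_le_const (half_pos hδ), eventually_ge_atTop 1]
    with q hCq hq1 hq hclose
  have hpos : 0 < ‖q • (α : UnitAddCircle)‖ := norm_nsmul_pos hα hq.pos.ne'
  refine exists_isAlmostPeriod hq hε (lt_of_lt_of_le (by positivity) hclose) hδε hclose ?_
  have hq1' : (1 : ℝ) ≤ q := by exact_mod_cast hq1
  calc (q : ℝ) * ‖c q‖ = ‖c q‖ * q ^ 1 := by ring
    _ ≤ ‖c q‖ * q ^ 2 := by gcongr; norm_num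
    _ ≤ δ / 2 := (norm_mul_sq_le_div hC hq.pos).trans hCq

lemma IsAlmostPeriod.norm_expInt_wave_charSum_le {q M : ℕ} (h : IsAlmostPeriod α q M)
    (hα : Irrational α) {ν δ : ℝ} (hδ : 0 ≤ δ) (hδν : 2 * π * |ν| * δ ≤ 1 / 4) {c : ℂ}
    (hle : M * ‖c‖ ≤ δ) (hge : δ / 2 ≤ M * ‖c‖) :
    ‖expInt ν (wave (charSum (α : UnitAddCircle) M q * c) q)‖
      ≤ Real.exp (-((2 * π * |ν| * (δ / 4)) ^ 2 / 2)) := by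
  have hupper : ‖charSum (α : UnitAddCircle) M q * c‖ ≤ δ := by
    rw [norm_mul]
    refine le_trans ?_ hle
    gcongr
    exact norm_charSum_le _ _ _
  have hlower : δ / 4 ≤ ‖charSum (α : UnitAddCircle) M q * c‖ := by
    rw [norm_mul]
    calc δ / 4 ≤ M / 2 * ‖c‖ := by linarith
      _ ≤ _ := by
          gcongr
          exact half_le_norm_charSum h.mul_norm_le (norm_nsmul_pos hα h.isGoodDenom.pos.ne')
  refine (norm_expInt_wave_le (by exact_mod_cast h.isGoodDenom.pos.ne') ?_).trans (by gcongr)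
  calc 2 * π * |ν| * ‖charSum (α : UnitAddCircle) M q * c‖ ≤ 2 * π * |ν| * δ := by gcongr
    _ ≤ 1 / 2 := by linarith

-- Otherwise at suitable almost periods `N` the harmonic of frequency `q` of `S_N φ` has amplitude
-- comparable to `δ` while the rest of `S_N φ` tends to a constant, so `expInt ν (S_N φ)` stays
-- away from the unit circle.
lemma eventually_norm_coeff_lt (hα : Irrational α) (hφ : Continuous φ)
    (hC : ∀ m : ℤ, ‖coeff φ m‖ * |(m : ℝ)| ^ 3 ≤ C) (h1 : H1 φ) {ν : ℝ} (hν : ν ≠ 0)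
    (hrigid : ∀ ε > 0, ∃ δ > 0, ∀ N : ℕ, ‖N • (α : UnitAddCircle)‖ < δ →
      1 - ε < ‖expInt ν (birkhoffSum (· + (α : UnitAddCircle)) φ N)‖) {ε : ℝ} (hε : 0 < ε) :
    ∀ᶠ q : ℕ in atTop, IsGoodDenom α q → ‖coeff φ q‖ < ε * ‖q • (α : UnitAddCircle)‖ := by
  set a : UnitAddCircle := (α : UnitAddCircle)
  obtain ⟨δ, hδ, hδε, hδν⟩ : ∃ δ > 0, δ ≤ ε / 2 ∧ 2 * π * |ν| * δ ≤ 1 / 4 := by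
    refine ⟨min (ε / 2) (1 / 4 / (2 * π * |ν|)), by positivity, min_le_left _ _, ?_⟩
    rw [← le_div_iff₀' (by positivity)]
    exact min_le_right _ _
  by_contra hcon
  simp only [not_eventually, Classical.not_imp, not_lt] at hcon
  set 𝓕 := atTop ⊓ 𝓟 {q : ℕ | IsGoodDenom α q ∧ ε * ‖q • a‖ ≤ ‖coeff φ q‖}
  have h𝓕bot : 𝓕.NeBot := frequently_mem_iff_neBot.1 hcon
  have h𝓕 : 𝓕 ≤ atTop := inf_le_left
  have htime : ∀ᶠ q in 𝓕, ∃ N, IsAlmostPeriod α q N ∧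
      N * ‖coeff φ q‖ ≤ δ ∧ δ / 2 ≤ N * ‖coeff φ q‖ := by
    filter_upwards [h𝓕 (eventually_exists_isAlmostPeriod hα hC hε hδ hδε),
      mem_inf_of_right (mem_principal_self _)] with q hq hbad
    exact hq hbad.1 hbad.2
  obtain ⟨N, hN⟩ := htime.choice
  have hrem := tendsto_integral_sq_scaleRemainder hα hφ hC h1 h𝓕 (hN.mono fun q h => h.1)
    (hN.mono fun q h => h.2.1)
  set κ := (2 * π * |ν| * (δ / 4)) ^ 2 / 2
  have hκ : Real.exp (-κ) < 1 := Real.exp_lt_one_iff.2 (neg_lt_zero.2 (by positivity))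
  set s := (1 - Real.exp (-κ)) / 2 / (2 * π * |ν|)
  have hs0 : 0 < s := div_pos (half_pos (sub_pos.2 hκ)) (by positivity)
  obtain ⟨η, hη, hrigid⟩ := hrigid ((1 - Real.exp (-κ)) / 2) (by linarith)
  have hsmall := h𝓕 ((tendsto_const_div_atTop_nhds_zero_nat (1 / 2 : ℝ)).eventually_lt_const hη)
  obtain ⟨q, ⟨hper, hle, hge⟩, hint, hqη⟩ :=
    (hN.and ((hrem.eventually_le_const (by positivity : 0 < s ^ 2)).and hsmall)).exists
  have hclose := hrigid (N q) (hper.norm_nsmul_le.trans_lt (by rwa [← div_div]))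
  have hupper := norm_expInt_birkhoffSum_le (a := a) hφ ν (N q) q
  have hwave := hper.norm_expInt_wave_charSum_le hα hδ.le hδν hle hge
  have habs : 2 * π * |ν| * ∫ x, |scaleRemainder a φ (N q) q x| ≤ (1 - Real.exp (-κ)) / 2 := by
    rw [← le_div_iff₀' (by positivity)]
    exact integral_abs_le_of_integral_sq_le
      (memLp_of_continuous (continuous_scaleRemainder hφ _) 2) hs0.le hint
  linarith

end SmallCoefficient

/-! ### Frequencies off the good denominators -/

section OffGoodDenominators

variable {α : ℝ}

lemma norm_formalCoeff_neg (α : ℝ) (f : UnitAddCircle → ℝ) (m : ℤ) :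
    ‖formalCoeff α f (-m)‖ = ‖formalCoeff α f m‖ := by
  rw [formalCoeff_eq, formalCoeff_eq]
  by_cases hm : m = 0
  · simp [hm]
  · have hconj : ‖(starRingEnd ℂ) (fourier m (α : UnitAddCircle)) - 1‖
        = ‖(fourier m (α : UnitAddCircle) : ℂ) - 1‖ := by
      rw [← Complex.norm_conj (_ - 1), map_sub, Complex.conj_conj, map_one]
    rw [if_neg hm, if_neg (neg_ne_zero.2 hm), norm_div, norm_div, norm_coeff_neg, fourier_neg,
      hconj]

lemma summable_formalCoeff_of_nat {f : UnitAddCircle → ℝ}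
    (h : Summable fun n : ℕ => ‖formalCoeff α f n‖ ^ 2) :
    Summable fun m : ℤ => ‖formalCoeff α f m‖ ^ 2 :=
  Summable.of_nat_of_neg h (by simpa only [norm_formalCoeff_neg] using h)

lemma norm_formalCoeff_le (hα : Irrational α) (f : UnitAddCircle → ℝ) (n : ℕ) :
    ‖formalCoeff α f n‖ ≤ ‖coeff f n‖ / ‖n • (α : UnitAddCircle)‖ := by
  rw [formalCoeff_eq]
  split_ifs with hn
  · rw [norm_zero]
    positivity
  · have hpos := norm_zsmul_pos hα hn
    have hle := le_norm_fourier_sub_one n (α : UnitAddCircle)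
    rw [natCast_zsmul] at hpos hle
    rw [norm_div]
    gcongr
    linarith

lemma summable_indicator_of_exists_le {ι κ : Type*} {f : ι → ℝ} {g : κ → ℝ} {s : Set ι}
    (hf : ∀ i, 0 ≤ f i) (hg : Summable g) (e : κ → ι) (h : ∀ i ∈ s, ∃ k, e k = i ∧ f i ≤ g k) :
    Summable (s.indicator f) := by
  choose k hek hle using h
  rw [← summable_subtype_iff_indicator]
  refine Summable.of_nonneg_of_le (fun i => hf i) (fun i => hle i i.2)
    (hg.comp_injective (i := fun i : s => k i i.2) fun i j hij => Subtype.ext ?_)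
  rw [← hek i i.2, ← hek j j.2]
  exact congrArg e hij

lemma summable_indicator_of_le_or_exists_le {ι κ : Type*} {f u : ι → ℝ} {g : κ → ℝ} {s : Set ι}
    (hf : ∀ i, 0 ≤ f i) (hu : Summable u) (hg : Summable g) (e : κ → ι)
    (h : ∀ i ∈ s, f i ≤ u i ∨ ∃ k, e k = i ∧ f i ≤ g k) : Summable (s.indicator f) := by
  have hdom : Summable ({i | f i ≤ u i}.indicator f) :=
    (hu.indicator {i | f i ≤ u i}).of_nonneg_of_le
      (fun i => Set.indicator_nonneg (fun i _ => hf i) i)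
      fun i => Set.indicator_le_indicator' fun hi => hi
  have hmap : Summable ({i | ∃ k, e k = i ∧ f i ≤ g k}.indicator f) :=
    summable_indicator_of_exists_le hf hg e fun i hi => hi
  refine (hdom.add hmap).of_nonneg_of_le (fun i => Set.indicator_nonneg (fun i _ => hf i) i)
    fun i => ?_
  by_cases hi : i ∈ s
  · rw [Set.indicator_of_mem hi]
    rcases h i hi with hle | hex
    · rw [Set.indicator_of_mem (s := {i | f i ≤ u i}) hle]
      exact le_add_of_nonneg_right (Set.indicator_nonneg (fun i _ => hf i) i)
    · rw [Set.indicator_of_mem (s := {i | ∃ k, e k = i ∧ f i ≤ g k}) hex]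
      exact le_add_of_nonneg_left (Set.indicator_nonneg (fun i _ => hf i) i)
  · rw [Set.indicator_of_notMem hi]
    exact add_nonneg (Set.indicator_nonneg (fun i _ => hf i) i)
      (Set.indicator_nonneg (fun i _ => hf i) i)

/-- The good denominators of `α` that are at least `J`; these are the frequencies that decide
whether the formal solution is square-summable. -/
def goodDenomsFrom (α : ℝ) (J : ℕ) : Set ℕ := {q | IsGoodDenom α q ∧ J ≤ q}

variable {c : ℤ → ℂ} {J : ℕ}

lemma summable_multiples_goodDenomsFrom (hα : Irrational α)
    (hcs : Summable fun n : ℕ => ‖c n‖ ^ 2)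
    (hratio : ∀ q ∈ goodDenomsFrom α J, ‖c q‖ ≤ ‖q • (α : UnitAddCircle)‖)
    {K : ℕ → ℝ} (hK : Summable K)
    (hH : ∀ q : ℕ, J ≤ q → ∑' l : ℕ, ‖c ((l + 2) * q)‖ ^ 2 ≤ K q * ‖c q‖ ^ 2) :
    Summable fun p : goodDenomsFrom α J × ℕ =>
      (‖c ((p.2 + 2) * (p.1 : ℕ))‖ / ‖(p.1 : ℕ) • (α : UnitAddCircle)‖) ^ 2 := by
  rw [summable_prod_of_nonneg fun p => by positivity]
  simp only [div_pow, tsum_div_const]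
  refine ⟨fun q => ?_, ?_⟩
  · have hinj : Function.Injective fun l : ℕ => (l + 2) * (q : ℕ) := fun l l' h => by
      have := Nat.eq_of_mul_eq_mul_right q.2.1.pos h
      omega
    simpa [Function.comp_def] using (hcs.comp_injective hinj).div_const _
  · refine (hK.abs.comp_injective Subtype.val_injective).of_nonneg_of_le
      (fun q => div_nonneg (tsum_nonneg fun l => by positivity) (by positivity)) fun q => ?_
    have hpos : 0 < ‖(q : ℕ) • (α : UnitAddCircle)‖ := norm_nsmul_pos hα q.2.1.pos.ne'
    rw [div_le_iff₀ (by positivity)]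
    calc ∑' l : ℕ, ‖c ((l + 2) * (q : ℕ))‖ ^ 2 ≤ K q * ‖c q‖ ^ 2 := hH q q.2.2
      _ ≤ |K q| * ‖c q‖ ^ 2 := by gcongr; exact le_abs_self _
      _ ≤ |K q| * ‖(q : ℕ) • (α : UnitAddCircle)‖ ^ 2 := by gcongr; exact hratio q q.2

lemma sq_div_norm_nsmul_le_of_far {C : ℝ} (hC : ∀ m : ℤ, ‖c m‖ * |(m : ℝ)| ^ 3 ≤ C) {n : ℕ}
    (hn : 0 < n) (hfar : 1 / (n : ℝ) ^ 2 ≤ ‖n • (α : UnitAddCircle)‖) :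
    (‖c n‖ / ‖n • (α : UnitAddCircle)‖) ^ 2 ≤ C ^ 2 * (1 / (n : ℝ) ^ 2) := by
  calc (‖c n‖ / ‖n • (α : UnitAddCircle)‖) ^ 2 ≤ (‖c n‖ / (1 / (n : ℝ) ^ 2)) ^ 2 := by gcongr
    _ = (‖c n‖ * n ^ 2) ^ 2 := by rw [div_div_eq_mul_div, div_one]
    _ ≤ (C / n) ^ 2 := by gcongr; exact norm_mul_sq_le_div hC hn
    _ = C ^ 2 * (1 / (n : ℝ) ^ 2) := by rw [div_pow, mul_one_div]

-- A frequency `n` with `‖nα‖ < 1 / n²` is a multiple of a good denominator `q` with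
-- `‖qα‖ ≤ ‖nα‖`: H1 handles the proper multiples of the `q ≥ J`, and there are only finitely
-- many `q < J`. The other frequencies are handled by the cubic decay.
lemma summable_off_goodDenomsFrom (hα : Irrational α) {C : ℝ}
    (hC : ∀ m : ℤ, ‖c m‖ * |(m : ℝ)| ^ 3 ≤ C) (hcs : Summable fun n : ℕ => ‖c n‖ ^ 2)
    (hratio : ∀ q ∈ goodDenomsFrom α J, ‖c q‖ ≤ ‖q • (α : UnitAddCircle)‖)
    {K : ℕ → ℝ} (hK : Summable K)
    (hH : ∀ q : ℕ, J ≤ q → ∑' l : ℕ, ‖c ((l + 2) * q)‖ ^ 2 ≤ K q * ‖c q‖ ^ 2) :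
    Summable ((goodDenomsFrom α J)ᶜ.indicator
      fun n : ℕ => (‖c n‖ / ‖n • (α : UnitAddCircle)‖) ^ 2) := by
  obtain ⟨M, hM0, hM⟩ :
      ∃ M, 0 ≤ M ∧ ∀ q ∈ Finset.range J, (1 / ‖q • (α : UnitAddCircle)‖) ^ 2 ≤ M :=
    ⟨∑ q ∈ Finset.range J, (1 / ‖q • (α : UnitAddCircle)‖) ^ 2,
      Finset.sum_nonneg fun _ _ => by positivity, fun q hq => Finset.single_le_sum
        (f := fun q => (1 / ‖q • (α : UnitAddCircle)‖) ^ 2) (fun _ _ => by positivity) hq⟩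
  have hdom : Summable fun n : ℕ => C ^ 2 * (1 / (n : ℝ) ^ 2) + M * ‖c n‖ ^ 2 :=
    ((Real.summable_one_div_nat_pow.2 (by norm_num : 1 < 2)).mul_left (C ^ 2)).add
      (hcs.mul_left M)
  refine summable_indicator_of_le_or_exists_le (fun n => by positivity) hdom
    (summable_multiples_goodDenomsFrom hα hcs hratio hK hH) (fun p => (p.2 + 2) * (p.1 : ℕ))
    fun n hn => ?_
  rcases Nat.eq_zero_or_pos n with rfl | hn0
  · left
    rw [zero_smul, norm_zero, div_zero, zero_pow two_ne_zero]
    positivity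
  rcases le_or_gt (1 / (n : ℝ) ^ 2) ‖n • (α : UnitAddCircle)‖ with hfar | hclose
  · left
    exact le_add_of_le_of_nonneg (sq_div_norm_nsmul_le_of_far hC hn0 hfar) (by positivity)
  obtain ⟨q, l, hq, hl, rfl, hnorm⟩ := exists_isGoodDenom_of_norm_nsmul_lt hn0 hclose
  have hqpos : 0 < ‖q • (α : UnitAddCircle)‖ := norm_nsmul_pos hα hq.pos.ne'
  have hqle : ‖q • (α : UnitAddCircle)‖ ≤ ‖(l * q) • (α : UnitAddCircle)‖ := by
    rw [hnorm]
    exact le_mul_of_one_le_left hqpos.le (by exact_mod_cast hl)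
  rcases le_or_gt J q with hqJ | hqJ
  · have hl1 : l ≠ 1 := by
      rintro rfl
      exact hn (by simpa using ⟨hq, hqJ⟩)
    obtain ⟨k, rfl⟩ := Nat.exists_eq_add_of_le' (by omega : 2 ≤ l)
    refine Or.inr ⟨(⟨q, hq, hqJ⟩, k), rfl, ?_⟩
    push_cast
    gcongr
  · have hqM := hM q (Finset.mem_range.2 hqJ)
    refine Or.inl (le_add_of_nonneg_of_le (by positivity) ?_)
    calc (‖c (l * q : ℕ)‖ / ‖(l * q) • (α : UnitAddCircle)‖) ^ 2
        ≤ (‖c (l * q : ℕ)‖ / ‖q • (α : UnitAddCircle)‖) ^ 2 := by gcongr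
      _ = (1 / ‖q • (α : UnitAddCircle)‖) ^ 2 * ‖c (l * q : ℕ)‖ ^ 2 := by ring
      _ ≤ M * ‖c (l * q : ℕ)‖ ^ 2 := by gcongr

end OffGoodDenominators

/-! ### Series of waves -/

section WaveSeries

lemma hasSum_coeff_tsum {F : ℕ → UnitAddCircle → ℝ} {u : ℕ → ℝ} (hF : ∀ k, Continuous (F k))
    (hu : Summable u) (hle : ∀ k x, |F k x| ≤ u k) (m : ℤ) :
    HasSum (fun k => coeff (F k) m) (coeff (fun x => ∑' k, F k x) m) := by
  have hint (k : ℕ) : Integrable fun x : UnitAddCircle =>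
      (fourier (-m) x : ℂ) * (F k x : ℂ) := by
    have := hF k
    exact integrable_of_continuous (by fun_prop)
  have hnorm (k : ℕ) (x : UnitAddCircle) : ‖(fourier (-m) x : ℂ) * (F k x : ℂ)‖ ≤ u k := by
    rw [norm_mul, norm_fourier_apply, one_mul, Complex.norm_real, Real.norm_eq_abs]
    exact hle k x
  have hsummable : Summable fun k => ∫ x : UnitAddCircle, ‖(fourier (-m) x : ℂ) * (F k x : ℂ)‖ := by
    refine hu.of_nonneg_of_le (fun k => integral_nonneg fun x => norm_nonneg _) fun k => ?_
    simpa using integral_mono (hint k).norm (integrable_const (u k)) (hnorm k)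
  simpa only [coeff, fourierCoeff_eq_integral, tsum_mul_left, Complex.ofReal_tsum]
    using hasSum_integral_of_summable_integral_norm hint hsummable

/-- The real trigonometric series with coefficient `b n` at the frequency `n ≥ 0`: the sum of the
waves `2 Re (b n e^{2πinx})`. -/
def waveSeries (b : ℕ → ℂ) (x : UnitAddCircle) : ℝ := ∑' n : ℕ, wave (b n) n x

variable {b : ℕ → ℂ}

lemma continuous_waveSeries (hb : Summable fun n => ‖b n‖) : Continuous (waveSeries b) :=
  continuous_tsum (fun _ => continuous_wave _ _) (hb.mul_left 2) fun _ _ => abs_wave_le _ _ _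

lemma summable_wave (hb : Summable fun n => ‖b n‖) (x : UnitAddCircle) :
    Summable fun n : ℕ => wave (b n) n x :=
  Summable.of_norm_bounded (hb.mul_left 2) fun _ => abs_wave_le _ _ _

lemma coeff_waveSeries (hb : Summable fun n => ‖b n‖) (h0 : b 0 = 0) (n : ℕ) :
    coeff (waveSeries b) n = b n := by
  have hsum := hasSum_coeff_tsum (fun k : ℕ => continuous_wave (b k) k) (hb.mul_left 2)
    (fun k x => abs_wave_le _ _ _) n
  have hcoeff (k : ℕ) : coeff (wave (b k) k) n = if k = n then b n else 0 := by
    rcases Nat.eq_zero_or_pos k with rfl | hk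
    · have hzero : wave (b 0) (0 : ℕ) = fun _ => 0 := by
        ext x
        simp [wave, h0]
      rw [hzero, coeff_const]
      split_ifs with hn <;> simp_all
    · rw [coeff_wave _ (by exact_mod_cast hk.ne'), if_neg (by omega : ¬ (n : ℤ) = -k)]
      by_cases hkn : k = n
      · simp [hkn]
      · rw [if_neg hkn, if_neg (by omega)]
  simp only [hcoeff] at hsum
  exact hsum.unique (hasSum_ite_eq n (b n))

lemma birkhoffSum_waveSeries (hb : Summable fun n => ‖b n‖) (a : UnitAddCircle) (N : ℕ)
    (x : UnitAddCircle) :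
    birkhoffSum (· + a) (waveSeries b) N x = ∑' n : ℕ, wave (b n * charSum a N n) n x := by
  simp only [← birkhoffSum_wave, birkhoffSum_add_right, waveSeries]
  exact (Summable.tsum_finsetSum fun k _ => summable_wave hb _).symm

end WaveSeries

/-! ### Sparse series -/

section SparseSeries

/-- A sequence of coefficients supported on the good denominators of `α`: it decays cubically, and
the coefficients `b n / (e^{2πinα} - 1)` of the formal solution for `waveSeries b` are bounded.
Beyond `32`, each good denominator is more than `16` times the preceding one. -/
structure IsSparse (α C : ℝ) (b : ℕ → ℂ) : Prop where
  decay : ∀ n : ℕ, ‖b n‖ * (n : ℝ) ^ 3 ≤ C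
  isGoodDenom : ∀ n, b n ≠ 0 → IsGoodDenom α n
  le : ∀ n, b n ≠ 0 → 32 ≤ n
  norm_le : ∀ n, ‖b n‖ ≤ ‖n • (α : UnitAddCircle)‖

variable {α C : ℝ} {b : ℕ → ℂ} {q : ℕ}

namespace IsSparse

lemma summable_norm (hb : IsSparse α C b) : Summable fun n => ‖b n‖ := by
  refine Summable.of_norm_bounded_eventually_nat
    ((Real.summable_one_div_nat_pow.2 (by norm_num : 1 < 3)).mul_left C) ?_
  filter_upwards [eventually_gt_atTop 0] with n hn
  rw [norm_norm, mul_one_div, le_div_iff₀ (by positivity)]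
  exact hb.decay n

lemma apply_zero (hb : IsSparse α C b) : b 0 = 0 := by
  by_contra h
  exact (hb.isGoodDenom 0 h).pos.ne rfl

lemma nonneg (hb : IsSparse α C b) : 0 ≤ C := by simpa using hb.decay 0

lemma norm_mul_norm_charSum_le_of_lt (hb : IsSparse α C b) {N : ℕ} (hN : IsAlmostPeriod α q N)
    (n : ℕ) : ‖b n‖ * ‖charSum (α : UnitAddCircle) N n‖ ≤ n / q := by
  have hq0 : (0 : ℝ) < q := by exact_mod_cast hN.isGoodDenom.pos
  have hgeom := norm_charSum_mul_norm_zsmul_le (α : UnitAddCircle) N n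
  rw [natCast_zsmul, Int.cast_natCast, Nat.abs_cast] at hgeom
  calc ‖b n‖ * ‖charSum (α : UnitAddCircle) N n‖
      ≤ ‖n • (α : UnitAddCircle)‖ * ‖charSum (α : UnitAddCircle) N n‖ := by
        gcongr
        exact hb.norm_le n
    _ ≤ 2 * n * ‖N • (α : UnitAddCircle)‖ := by rwa [mul_comm]
    _ ≤ 2 * n * (1 / (2 * q)) := by gcongr; exact hN.norm_nsmul_le
    _ = n / q := by field_simp

lemma norm_mul_norm_charSum_le_of_gt (hb : IsSparse α C b) {N : ℕ} (hN : IsAlmostPeriod α q N)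
    {n : ℕ} (hn : IsGoodDenom α n) (hqn : q < n) :
    ‖b n‖ * ‖charSum (α : UnitAddCircle) N n‖ ≤ C * ((n : ℝ) ^ 2)⁻¹ := by
  have hn0 : (0 : ℝ) < n := by exact_mod_cast hn.pos
  have hNn : (N : ℝ) ≤ n := by
    have hturn : (N : ℝ) * (1 / (2 * n)) ≤ 1 / 2 := by
      refine le_trans ?_ hN.mul_norm_le
      gcongr
      exact hN.isGoodDenom.le_norm_nsmul_of_lt hn hqn
    rw [mul_one_div, div_le_div_iff₀ (by positivity) two_pos] at hturn
    linarith
  calc ‖b n‖ * ‖charSum (α : UnitAddCircle) N n‖ ≤ ‖b n‖ * n := by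
        gcongr
        exact (norm_charSum_le _ _ _).trans hNn
    _ = ‖b n‖ * n ^ 3 * ((n : ℝ) ^ 2)⁻¹ := by field_simp
    _ ≤ C * ((n : ℝ) ^ 2)⁻¹ := by gcongr; exact hb.decay n

lemma sum_norm_mul_norm_charSum_le (hb : IsSparse α C b) {N : ℕ} (hN : IsAlmostPeriod α q N)
    {s : Finset ℕ} (hs : ∀ n ∈ s, b n ≠ 0 ∧ n ≠ q) :
    ∑ n ∈ s, ‖b n‖ * ‖charSum (α : UnitAddCircle) N n‖ ≤ (3 + 2 * C) * (1 / √q) := by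
  have hq1 : (1 : ℝ) ≤ q := by exact_mod_cast hN.isGoodDenom.pos
  have hsqrt : √(q : ℝ) * √q = q := Real.mul_self_sqrt (by linarith)
  have hsqrt1 : 1 ≤ √(q : ℝ) := Real.one_le_sqrt.2 hq1
  have hlow : ∑ n ∈ s with n < q, ‖b n‖ * ‖charSum (α : UnitAddCircle) N n‖ ≤ 3 * (1 / √q) := by
    refine (Finset.sum_le_sum fun n _ => hb.norm_mul_norm_charSum_le_of_lt hN n).trans ?_
    rw [← Finset.sum_div, div_le_iff₀ (by positivity)]
    calc ∑ n ∈ s with n < q, (n : ℝ) ≤ 3 * √q :=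
          sum_goodDenom_le _ hN.isGoodDenom fun n hn => by
            obtain ⟨hns, hnq⟩ := Finset.mem_filter.1 hn
            exact ⟨hb.isGoodDenom n (hs n hns).1, hb.le n (hs n hns).1, hnq⟩
      _ = 3 * (1 / √q) * q := by
          nth_rewrite 3 [← hsqrt]
          field_simp
  have hhigh : ∑ n ∈ s with ¬ n < q, ‖b n‖ * ‖charSum (α : UnitAddCircle) N n‖
      ≤ C * (2 * (1 / √q)) := by
    have hgt {n : ℕ} (hn : n ∈ s.filter (¬ · < q)) : q < n :=
      lt_of_le_of_ne (not_lt.1 (Finset.mem_filter.1 hn).2)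
        (hs n (Finset.mem_filter.1 hn).1).2.symm
    calc ∑ n ∈ s with ¬ n < q, ‖b n‖ * ‖charSum (α : UnitAddCircle) N n‖
        ≤ ∑ n ∈ s with ¬ n < q, C * ((n : ℝ) ^ 2)⁻¹ := Finset.sum_le_sum fun n hn =>
          hb.norm_mul_norm_charSum_le_of_gt hN
            (hb.isGoodDenom n (hs n (Finset.mem_filter.1 hn).1).1) (hgt hn)
      _ = C * ∑ n ∈ s with ¬ n < q, ((n : ℝ) ^ 2)⁻¹ := by rw [Finset.mul_sum]
      _ ≤ C * ∑ n ∈ Finset.Ioo q (s.sup id + 1), ((n : ℝ) ^ 2)⁻¹ := by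
          refine mul_le_mul_of_nonneg_left (Finset.sum_le_sum_of_subset_of_nonneg (fun n hn => ?_)
            fun _ _ _ => by positivity) hb.nonneg
          exact Finset.mem_Ioo.2 ⟨hgt hn, Nat.lt_succ_of_le
            (Finset.le_sup (f := id) (Finset.mem_filter.1 hn).1)⟩
      _ ≤ C * (2 / (q + 1)) := mul_le_mul_of_nonneg_left (sum_Ioo_inv_sq_le q _) hb.nonneg
      _ ≤ C * (2 * (1 / √q)) := by
          refine mul_le_mul_of_nonneg_left ?_ hb.nonneg
          rw [mul_one_div]
          gcongr
          nlinarith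
  rw [← Finset.sum_filter_add_sum_filter_not s (· < q)]
  linarith

lemma abs_birkhoffSum_waveSeries_sub_le (hb : IsSparse α C b) {N : ℕ} (hN : IsAlmostPeriod α q N)
    (x : UnitAddCircle) :
    |birkhoffSum (· + (α : UnitAddCircle)) (waveSeries b) N x
      - wave (b q * charSum (α : UnitAddCircle) N q) q x| ≤ (6 + 4 * C) * (1 / √q) := by
  set u : ℕ → ℝ := fun n => wave (b n * charSum (α : UnitAddCircle) N n) n x with hu
  have hule (n : ℕ) : ‖u n‖ ≤ 2 * (‖b n‖ * ‖charSum (α : UnitAddCircle) N n‖) := by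
    rw [← norm_mul]
    exact abs_wave_le _ _ _
  have husum : Summable u := by
    refine Summable.of_norm_bounded (hb.summable_norm.mul_left (2 * (N : ℝ))) fun n => ?_
    calc ‖u n‖ ≤ 2 * (‖b n‖ * N) := (hule n).trans (by gcongr; exact norm_charSum_le _ _ _)
      _ = 2 * N * ‖b n‖ := by ring
  have hfin (s : Finset ℕ) : ∑ n ∈ s, ‖if n = q then 0 else u n‖ ≤ (6 + 4 * C) * (1 / √q) := by
    classical
    have hterm (n : ℕ) : ‖if n = q then 0 else u n‖ ≤ if b n ≠ 0 ∧ n ≠ q then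
        2 * (‖b n‖ * ‖charSum (α : UnitAddCircle) N n‖) else 0 := by
      by_cases hnq : n = q
      · simp [hnq]
      by_cases hbn : b n = 0
      · simp [hu, wave, hbn]
      · rw [if_neg hnq, if_pos ⟨hbn, hnq⟩]
        exact hule n
    refine (Finset.sum_le_sum fun n _ => hterm n).trans ?_
    rw [← Finset.sum_filter, ← Finset.mul_sum]
    have := hb.sum_norm_mul_norm_charSum_le hN (s := s.filter fun n => b n ≠ 0 ∧ n ≠ q)
      fun n hn => (Finset.mem_filter.1 hn).2
    linarith
  have hsum : Summable fun n => ‖if n = q then 0 else u n‖ :=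
    summable_of_sum_le (fun _ => norm_nonneg _) hfin
  rw [birkhoffSum_waveSeries hb.summable_norm, husum.tsum_eq_add_tsum_ite q, add_sub_cancel_left]
  exact (norm_tsum_le_tsum_norm hsum).trans (hsum.tsum_le_of_sum_le hfin)

-- Running through the almost periods of the frequencies in `F` one after the other, each one
-- contributes its own wave, shifted by the time already elapsed.
lemma exists_birkhoffSum_near_sum_wave (hb : IsSparse α C b) (F : Finset ℕ) {N : ℕ → ℕ}
    (hN : ∀ q ∈ F, IsAlmostPeriod α q (N q)) :
    ∃ w : ℕ → ℂ, (∀ q ∈ F, ‖w q‖ = ‖b q‖ * ‖charSum (α : UnitAddCircle) (N q) q‖) ∧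
      ∀ x, |birkhoffSum (· + (α : UnitAddCircle)) (waveSeries b) (∑ q ∈ F, N q) x
        - ∑ q ∈ F, wave (w q) q x| ≤ (6 + 4 * C) * ∑ q ∈ F, 1 / √(q : ℝ) := by
  classical
  induction F using Finset.induction_on with
  | empty => exact ⟨0, by simp, fun x => by simp [birkhoffSum_zero]⟩
  | insert q s hqs ih =>
    obtain ⟨w, hwnorm, hwnear⟩ := ih fun p hp => hN p (Finset.mem_insert_of_mem hp)
    set a : UnitAddCircle := (α : UnitAddCircle)
    set M := ∑ p ∈ s, N p
    set v : ℂ := b q * charSum a (N q) q * fourier (q : ℤ) (M • a) with hv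
    have hupdate {p : ℕ} (hp : p ∈ s) : Function.update w q v p = w p :=
      Function.update_of_ne (ne_of_mem_of_not_mem hp hqs) v w
    refine ⟨Function.update w q v, fun p hp => ?_, fun x => ?_⟩
    · rcases Finset.mem_insert.1 hp with rfl | hp
      · rw [Function.update_self, hv, norm_mul, norm_fourier_apply, mul_one, norm_mul]
      · rw [hupdate hp, hwnorm p hp]
    · have hnew := hb.abs_birkhoffSum_waveSeries_sub_le (hN q (Finset.mem_insert_self _ _))
        (x + M • a)
      rw [wave_add] at hnew
      have hwaves : ∑ p ∈ s, wave (Function.update w q v p) p x = ∑ p ∈ s, wave (w p) p x :=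
        Finset.sum_congr rfl fun p hp => by rw [hupdate hp]
      rw [Finset.sum_insert hqs, Finset.sum_insert hqs, Finset.sum_insert hqs, add_comm (N q),
        birkhoffSum_add, add_right_iterate, Function.update_self, hwaves,
        add_comm (wave v q x), mul_add, add_sub_add_comm, add_comm (_ * (1 / _))]
      exact (abs_add_le _ _).trans (add_le_add (hwnear x) hnew)

lemma norm_expInt_birkhoffSum_waveSeries_le (hb : IsSparse α C b) {ν : ℝ}
    (hsmall : ∀ n, 4 * π * |ν| * ‖b n‖ ≤ ‖n • (α : UnitAddCircle)‖) {F : Finset ℕ} {N : ℕ → ℕ}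
    (hN : ∀ q ∈ F, IsAlmostPeriod α q (N q)) (hF : ∀ q ∈ F, 32 ≤ q) :
    ‖expInt ν (birkhoffSum (· + (α : UnitAddCircle)) (waveSeries b) (∑ q ∈ F, N q))‖
      ≤ Real.exp
          (-∑ q ∈ F, (2 * π * |ν| * (‖b q‖ * ‖charSum (α : UnitAddCircle) (N q) q‖)) ^ 2 / 2)
        + (12 + 2 * π * |ν| * (6 + 4 * C)) * ∑ q ∈ F, 1 / √(q : ℝ) := by
  obtain ⟨w, hwnorm, hwnear⟩ := hb.exists_birkhoffSum_near_sum_wave F hN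
  have hsum : Continuous (birkhoffSum (· + (α : UnitAddCircle)) (waveSeries b) (∑ q ∈ F, N q)) :=
    continuous_birkhoffSum _ (continuous_waveSeries hb.summable_norm) _
  have hwaves : Continuous fun x => ∑ q ∈ F, wave (w q) q x :=
    continuous_finsetSum _ fun q _ => continuous_wave _ _
  have hdist := integral_mono (integrable_of_continuous (hsum.sub hwaves).abs)
    (integrable_const ((6 + 4 * C) * ∑ q ∈ F, 1 / √(q : ℝ))) hwnear
  rw [integral_const, probReal_univ, one_smul] at hdist
  have hwsmall : ∀ q ∈ F, 2 * π * |ν| * ‖w q‖ ≤ 1 / 4 := fun q hq => by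
    rw [hwnorm q hq]
    calc 2 * π * |ν| * (‖b q‖ * ‖charSum (α : UnitAddCircle) (N q) q‖)
        ≤ 2 * π * |ν| * (‖b q‖ * N q) := by gcongr; exact norm_charSum_le _ _ _
      _ = N q * (4 * π * |ν| * ‖b q‖) / 2 := by ring
      _ ≤ N q * ‖q • (α : UnitAddCircle)‖ / 2 := by gcongr; exact hsmall q
      _ ≤ 1 / 4 := by linarith [(hN q hq).mul_norm_le]
  have hprod := norm_expInt_sum_wave_le w F
    (fun q hq => ⟨(hN q hq).isGoodDenom, hF q hq⟩) hwsmall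
  rw [Finset.sum_congr rfl fun q hq => by rw [hwnorm q hq]] at hprod
  calc _ ≤ _ := norm_expInt_le_add hsum hwaves ν
    _ ≤ _ := add_le_add hprod (mul_le_mul_of_nonneg_left hdist (by positivity))
    _ = _ := by ring

end IsSparse

lemma IsGoodDenom.exists_isAlmostPeriod_one_fourth_le (hq : IsGoodDenom α q) (hα : Irrational α)
    (h4 : 4 ≤ q) : ∃ N, IsAlmostPeriod α q N ∧ 1 / 4 ≤ N * ‖q • (α : UnitAddCircle)‖ := by
  have hq4 : (4 : ℝ) ≤ q := by exact_mod_cast h4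
  have hqa : q * ‖q • (α : UnitAddCircle)‖ ≤ 1 / 2 / 2 := by
    calc q * ‖q • (α : UnitAddCircle)‖ ≤ q * (1 / (q : ℝ) ^ 2) := by gcongr; exact hq.close.le
      _ = 1 / q := by field_simp
      _ ≤ 1 / 4 := by gcongr
      _ = 1 / 2 / 2 := by norm_num
  obtain ⟨N, hN, -, hlower⟩ := exists_isAlmostPeriod hq one_pos (norm_nsmul_pos hα hq.pos.ne')
    le_rfl (by rw [one_mul]) hqa
  exact ⟨N, hN, by linarith⟩

lemma norm_sum_nsmul_le_of_isAlmostPeriod {F : Finset ℕ} {N : ℕ → ℕ}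
    (hN : ∀ q ∈ F, IsAlmostPeriod α q (N q)) :
    ‖(∑ q ∈ F, N q) • (α : UnitAddCircle)‖ ≤ ∑ q ∈ F, 1 / √(q : ℝ) := by
  rw [Finset.sum_smul]
  refine (norm_sum_le _ _).trans (Finset.sum_le_sum fun q hq => (hN q hq).norm_nsmul_le.trans ?_)
  have hq1 : (1 : ℝ) ≤ q := by exact_mod_cast (hN q hq).isGoodDenom.pos
  have hsqrt : √(q : ℝ) ≤ q := Real.sqrt_le_iff.2 ⟨by linarith, by nlinarith⟩
  gcongr
  linarith

lemma IsSparse.sum_sq_norm_div_le (hb : IsSparse α C b) (hα : Irrational α) {ν : ℝ} (hν : ν ≠ 0)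
    (hsmall : ∀ n, 4 * π * |ν| * ‖b n‖ ≤ ‖n • (α : UnitAddCircle)‖) {δ : ℝ}
    (hrigid : ∀ N : ℕ, ‖N • (α : UnitAddCircle)‖ < δ →
      1 / 2 < ‖expInt ν (birkhoffSum (· + (α : UnitAddCircle)) (waveSeries b) N)‖)
    {F : Finset ℕ} (hF : ∀ q ∈ F, b q ≠ 0) (hFδ : ∑ q ∈ F, 1 / √(q : ℝ) < δ)
    (hF4 : (12 + 2 * π * |ν| * (6 + 4 * C)) * ∑ q ∈ F, 1 / √(q : ℝ) ≤ 1 / 4) :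
    ∑ q ∈ F, (‖b q‖ / ‖q • (α : UnitAddCircle)‖) ^ 2
      ≤ 128 * Real.log 4 / (2 * π * |ν|) ^ 2 := by
  have hperiod : ∀ q ∈ F, ∃ N, IsAlmostPeriod α q N ∧ 1 / 4 ≤ N * ‖q • (α : UnitAddCircle)‖ :=
    fun q hq => (hb.isGoodDenom q (hF q hq)).exists_isAlmostPeriod_one_fourth_le hα
      (by linarith [hb.le q (hF q hq)])
  choose! N hN hlower using hperiod
  have hupper := hb.norm_expInt_birkhoffSum_waveSeries_le hsmall hN fun q hq => hb.le q (hF q hq)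
  have hclose := hrigid _ ((norm_sum_nsmul_le_of_isAlmostPeriod hN).trans_lt hFδ)
  have hlog : ∑ q ∈ F, (2 * π * |ν| * (‖b q‖ * ‖charSum (α : UnitAddCircle) (N q) q‖)) ^ 2 / 2
      ≤ Real.log 4 := by
    have hexp : Real.exp (Real.log (1 / 4)) ≤ Real.exp
        (-∑ q ∈ F, (2 * π * |ν| * (‖b q‖ * ‖charSum (α : UnitAddCircle) (N q) q‖)) ^ 2 / 2) := by
      rw [Real.exp_log (by norm_num)]
      linarith
    rw [Real.exp_le_exp, one_div, Real.log_inv] at hexp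
    linarith
  have hterm : ∀ q ∈ F, ‖b q‖ / ‖q • (α : UnitAddCircle)‖
      ≤ 8 * (‖b q‖ * ‖charSum (α : UnitAddCircle) (N q) q‖) := fun q hq => by
    have hpos : 0 < ‖q • (α : UnitAddCircle)‖ := norm_nsmul_pos hα (hN q hq).isGoodDenom.pos.ne'
    have hhalf := half_le_norm_charSum (hN q hq).mul_norm_le hpos
    rw [div_le_iff₀ hpos]
    calc ‖b q‖ = ‖b q‖ * (8 * (1 / 4 / 2)) := by ring
      _ ≤ ‖b q‖ * (8 * (N q * ‖q • (α : UnitAddCircle)‖ / 2)) := by gcongr; exact hlower q hq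
      _ = 8 * (‖b q‖ * (N q / 2)) * ‖q • (α : UnitAddCircle)‖ := by ring
      _ ≤ _ := by gcongr
  rw [le_div_iff₀ (by positivity), Finset.sum_mul]
  calc ∑ q ∈ F, (‖b q‖ / ‖q • (α : UnitAddCircle)‖) ^ 2 * (2 * π * |ν|) ^ 2
      ≤ ∑ q ∈ F, (8 * (‖b q‖ * ‖charSum (α : UnitAddCircle) (N q) q‖)) ^ 2
          * (2 * π * |ν|) ^ 2 := by
        gcongr with q hq
        exact hterm q hq
    _ = 128 * ∑ q ∈ F,
          (2 * π * |ν| * (‖b q‖ * ‖charSum (α : UnitAddCircle) (N q) q‖)) ^ 2 / 2 := by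
        rw [Finset.mul_sum]
        exact Finset.sum_congr rfl fun q _ => by ring
    _ ≤ 128 * Real.log 4 := by gcongr

lemma IsSparse.summable_sq_norm_div (hb : IsSparse α C b) (hα : Irrational α) {ν : ℝ} (hν : ν ≠ 0)
    (hsmall : ∀ n, 4 * π * |ν| * ‖b n‖ ≤ ‖n • (α : UnitAddCircle)‖) {δ : ℝ} (hδ : 0 < δ)
    (hrigid : ∀ N : ℕ, ‖N • (α : UnitAddCircle)‖ < δ →
      1 / 2 < ‖expInt ν (birkhoffSum (· + (α : UnitAddCircle)) (waveSeries b) N)‖) :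
    Summable fun n : ℕ => (‖b n‖ / ‖n • (α : UnitAddCircle)‖) ^ 2 := by
  classical
  set B : ℝ := 12 + 2 * π * |ν| * (6 + 4 * C)
  have hB0 : 0 < B := by
    have := hb.nonneg
    positivity
  have hlim : Tendsto (fun J : ℕ => 2 / √(J : ℝ)) atTop (nhds 0) :=
    (Real.tendsto_sqrt_atTop.comp tendsto_natCast_atTop_atTop).const_div_atTop 2
  have hlimB := hlim.const_mul B
  rw [mul_zero] at hlimB
  obtain ⟨J, hJ32, hJδ, hJB⟩ := ((eventually_ge_atTop 32).and ((hlim.eventually_lt_const hδ).and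
    (hlimB.eventually_le_const (by norm_num : (0 : ℝ) < 1 / 4)))).exists
  have hbound (s : Finset ℕ) :
      ∑ n ∈ s, (if b n ≠ 0 ∧ J ≤ n then (‖b n‖ / ‖n • (α : UnitAddCircle)‖) ^ 2 else 0)
        ≤ 128 * Real.log 4 / (2 * π * |ν|) ^ 2 := by
    rw [← Finset.sum_filter]
    have hF : ∀ q ∈ s.filter (fun n => b n ≠ 0 ∧ J ≤ n), b q ≠ 0 ∧ J ≤ q :=
      fun q hq => (Finset.mem_filter.1 hq).2
    have hinv := sum_inv_sqrt_goodDenom_le (α := α) (s.filter fun n => b n ≠ 0 ∧ J ≤ n) hJ32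
      fun q hq => ⟨hb.isGoodDenom q (hF q hq).1, (hF q hq).2⟩
    exact hb.sum_sq_norm_div_le hα hν hsmall hrigid (fun q hq => (hF q hq).1) (hinv.trans_lt hJδ)
      ((mul_le_mul_of_nonneg_left hinv hB0.le).trans hJB)
  refine (summable_of_sum_le (fun n => by positivity) hbound).of_norm_bounded_eventually_nat ?_
  filter_upwards [eventually_ge_atTop J] with n hn
  by_cases hbn : b n = 0
  · simp [hbn]
  · simp [hbn, hn]

end SparseSeries

/-! ### From the multiplicative to the additive cohomological equation -/

section Cocycle

variable {α : ℝ} {φ : UnitAddCircle → ℝ} {C : ℝ} {J : ℕ}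

/-- The coefficients of `φ` at the good denominators of `α` that are at least `J`. -/
def sparsePart (α : ℝ) (φ : UnitAddCircle → ℝ) (J : ℕ) : ℕ → ℂ :=
  (goodDenomsFrom α J).indicator fun n => coeff φ n

lemma isSparse_sparsePart (hC : ∀ m : ℤ, ‖coeff φ m‖ * |(m : ℝ)| ^ 3 ≤ C) (hJ : 32 ≤ J)
    (hratio : ∀ q ∈ goodDenomsFrom α J, ‖coeff φ q‖ ≤ ‖q • (α : UnitAddCircle)‖) :
    IsSparse α C (sparsePart α φ J) where
  decay n := by
    have hn := hC n
    rw [Int.cast_natCast, Nat.abs_cast] at hn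
    exact le_trans (by gcongr; exact norm_indicator_le_norm_self _ _) hn
  isGoodDenom n hn := (Set.mem_of_indicator_ne_zero hn).1
  le n hn := hJ.trans (Set.mem_of_indicator_ne_zero hn).2
  norm_le n := by
    rw [sparsePart, norm_indicator_eq_indicator_norm]
    exact Set.indicator_le' hratio (fun _ _ => norm_nonneg _) n

lemma summable_formalCoeff_sub_sparsePart (hα : Irrational α) (hφ : Continuous φ)
    (hb : IsSparse α C (sparsePart α φ J))
    (hoff : Summable ((goodDenomsFrom α J)ᶜ.indicator
      fun n : ℕ => (‖coeff φ n‖ / ‖n • (α : UnitAddCircle)‖) ^ 2)) :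
    Summable fun m : ℤ =>
      ‖formalCoeff α (fun x => φ x - waveSeries (sparsePart α φ J) x) m‖ ^ 2 := by
  have hΦ := continuous_waveSeries hb.summable_norm
  refine summable_formalCoeff_of_nat (hoff.of_nonneg_of_le (fun _ => by positivity) fun n => ?_)
  have hle := norm_formalCoeff_le hα (fun x => φ x - waveSeries (sparsePart α φ J) x) n
  rw [coeff_sub (integrable_of_continuous hφ) (integrable_of_continuous hΦ),
    coeff_waveSeries hb.summable_norm hb.apply_zero] at hle
  by_cases hn : n ∈ goodDenomsFrom α J
  · have hval : sparsePart α φ J n = coeff φ n := Set.indicator_of_mem hn _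
    rw [hval, sub_self, norm_zero, zero_div] at hle
    rw [Set.indicator_of_notMem (Set.notMem_compl_iff.2 hn), norm_le_zero_iff.1 hle, norm_zero,
      zero_pow two_ne_zero]
  · have hval : sparsePart α φ J n = 0 := Set.indicator_of_notMem hn _
    rw [hval, sub_zero] at hle
    rw [Set.indicator_of_mem (s := (goodDenomsFrom α J)ᶜ) hn]
    gcongr

lemma exists_forall_lt_norm_expInt_of_cohomologous {a : UnitAddCircle} {ν c : ℝ}
    {F Φ ψ : UnitAddCircle → ℝ} {G : UnitAddCircle → ℂ} (hGm : AEStronglyMeasurable G)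
    (hG1 : ∀ᵐ x, ‖G x‖ = 1)
    (hG : ∀ᵐ x, G (x + a) = Complex.exp (2 * π * Complex.I * ν * F x) * G x)
    (hψm : AEStronglyMeasurable ψ) (hψ : ∀ᵐ x, ψ (x + a) - ψ x = F x - Φ x - c) {ε : ℝ}
    (hε : 0 < ε) :
    ∃ δ > 0, ∀ N : ℕ, ‖N • a‖ < δ → 1 - ε < ‖expInt ν (birkhoffSum (· + a) Φ N)‖ := by
  have hG'm : AEStronglyMeasurable fun x =>
      Complex.exp (2 * π * Complex.I * ν * (-ψ x : ℝ)) * G x :=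
    ((by fun_prop : Continuous fun t : ℝ =>
      Complex.exp (2 * π * Complex.I * ν * (-t : ℝ))).comp_aestronglyMeasurable hψm).mul hGm
  have hG'1 : ∀ᵐ x, ‖Complex.exp (2 * π * Complex.I * ν * (-ψ x : ℝ)) * G x‖ = 1 := by
    filter_upwards [hG1] with x hx
    rw [norm_mul, norm_exp_eq_one, hx, one_mul]
  have hG' : ∀ᵐ x, Complex.exp (2 * π * Complex.I * ν * (-ψ (x + a) : ℝ)) * G (x + a)
      = Complex.exp (2 * π * Complex.I * ν * (Φ x + c : ℝ))
        * (Complex.exp (2 * π * Complex.I * ν * (-ψ x : ℝ)) * G x) := by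
    filter_upwards [hG, hψ] with x hx hψx
    have hsplit : -ψ (x + a) + F x = Φ x + c + -ψ x := by linarith
    rw [hx, ← mul_assoc, ← mul_assoc, ← exp_add, ← exp_add, hsplit]
  obtain ⟨δ, hδ, hclose⟩ := exists_forall_lt_norm_expInt_birkhoffSum hG'm hG'1 hG' hε
  refine ⟨δ, hδ, fun N hN => ?_⟩
  have hconst : birkhoffSum (· + a) (fun x => Φ x + c) N
      = fun x => birkhoffSum (· + a) Φ N x + N * c := by
    ext x
    simp [birkhoffSum_add_right, Finset.sum_add_distrib]
  have hlt := hclose N hN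
  rwa [hconst, norm_expInt_add_const] at hlt

-- Off the good denominators the formal solution is square-summable, so `φ` is cohomologous up to
-- a constant to the sparse series over its good denominators, which inherits the cocycle.
theorem summable_formalCoeff_of_cocycle (hα : Irrational α) (hφ : Continuous φ)
    (hC : ∀ m : ℤ, ‖coeff φ m‖ * |(m : ℝ)| ^ 3 ≤ C) (h1 : H1 φ) {ν : ℝ} (hν : ν ≠ 0)
    {G : UnitAddCircle → ℂ} (hGm : AEStronglyMeasurable G) (hG1 : ∀ᵐ x, ‖G x‖ = 1)
    (hG : ∀ᵐ x, G (x + (α : UnitAddCircle)) = Complex.exp (2 * π * Complex.I * ν * φ x) * G x) :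
    Summable fun m : ℤ => ‖formalCoeff α φ m‖ ^ 2 := by
  have hcoeff {ε : ℝ} (hε : 0 < ε) := eventually_norm_coeff_lt hα hφ hC h1 hν
    (fun ε hε => exists_forall_lt_norm_expInt_birkhoffSum hGm hG1 hG hε) hε
  have hcs : Summable fun n : ℕ => ‖coeff φ n‖ ^ 2 :=
    (hasSum_sq_norm_coeff (memLp_of_continuous hφ 2)).summable.comp_injective Nat.cast_injective
  obtain ⟨K, hK, hH⟩ := h1
  obtain ⟨J, hJ⟩ := eventually_atTop.1 (((hcoeff one_pos).and
    (hcoeff (by positivity : 0 < 1 / (4 * π * |ν|)))).and (hH.and (eventually_ge_atTop 32)))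
  have hratio : ∀ q ∈ goodDenomsFrom α J, ‖coeff φ q‖ ≤ ‖q • (α : UnitAddCircle)‖ :=
    fun q hq => by simpa using ((hJ q hq.2).1.1 hq.1).le
  have hb := isSparse_sparsePart hC (hJ J le_rfl).2.2 hratio
  have hsmall (n : ℕ) : 4 * π * |ν| * ‖sparsePart α φ J n‖ ≤ ‖n • (α : UnitAddCircle)‖ := by
    by_cases hn : n ∈ goodDenomsFrom α J
    · rw [sparsePart, Set.indicator_of_mem hn, ← le_div_iff₀' (by positivity),
        ← one_div_mul_eq_div]
      exact ((hJ n hn.2).1.2 hn.1).le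
    · rw [sparsePart, Set.indicator_of_notMem hn, norm_zero, mul_zero]
      exact norm_nonneg _
  have hoff := summable_off_goodDenomsFrom hα hC hcs hratio hK fun q hq => (hJ q hq).2.1
  obtain ⟨ψ, hψm, -, hψ⟩ := exists_memLp_coboundary hα (memLp_of_continuous
    (hφ.sub (continuous_waveSeries hb.summable_norm)) 2)
    (summable_formalCoeff_sub_sparsePart hα hφ hb hoff)
  obtain ⟨δ, hδ, hrigid⟩ := exists_forall_lt_norm_expInt_of_cohomologous hGm hG1 hG
    hψm.aestronglyMeasurable hψ (half_pos one_pos)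
  rw [sub_half] at hrigid
  have hon := hb.summable_sq_norm_div hα hν hsmall hδ hrigid
  refine summable_formalCoeff_of_nat
    ((hoff.add hon).of_nonneg_of_le (fun _ => by positivity) fun n => ?_)
  refine (pow_le_pow_left₀ (norm_nonneg _) (norm_formalCoeff_le hα φ n) 2).trans ?_
  by_cases hn : n ∈ goodDenomsFrom α J
  · rw [Set.indicator_of_notMem (Set.notMem_compl_iff.2 hn), sparsePart,
      Set.indicator_of_mem hn, zero_add]
  · rw [Set.indicator_of_mem (s := (goodDenomsFrom α J)ᶜ) hn]
    exact le_add_of_nonneg_right (by positivity)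

end Cocycle

/-! ### The skew product whose orbits the special flow identifies -/

section Birkhoff

variable (α : ℝ) (φ : UnitAddCircle → ℝ)

lemma birkhoff_zero (x : UnitAddCircle) : birkhoff α φ 0 x = 0 := by
  change birkhoff α φ (Int.ofNat 0) x = 0
  simp [birkhoff]

lemma birkhoff_add_one (n : ℤ) (x : UnitAddCircle) :
    birkhoff α φ (n + 1) x = birkhoff α φ n x + φ (x + n • (α : UnitAddCircle)) := by
  rw [← AddCircle.coe_zsmul, zsmul_eq_mul]
  cases n with
  | ofNat n =>
    change birkhoff α φ (Int.ofNat (n + 1)) x = _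
    simp [birkhoff, Finset.sum_range_succ]
  | negSucc n =>
    have hneg : x + (((Int.negSucc n : ℤ) * α : ℝ) : UnitAddCircle)
        = x - ((((n : ℝ) + 1) * α : ℝ) : UnitAddCircle) := by
      rw [sub_eq_add_neg, ← AddCircle.coe_neg, Int.cast_negSucc]
      push_cast
      ring_nf
    rw [hneg]
    cases n with
    | zero =>
      change birkhoff α φ 0 x = _
      simp [birkhoff]
    | succ n =>
      change birkhoff α φ (Int.negSucc n) x = _
      simp only [birkhoff, Finset.sum_range_succ _ (n + 1)]
      ring

variable {α φ}

lemma eq_birkhoff_of_add_one {u : ℤ → ℝ} {x : UnitAddCircle} (h0 : u 0 = 0)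
    (hu : ∀ n, u (n + 1) = u n + φ (x + n • (α : UnitAddCircle))) (n : ℤ) :
    u n = birkhoff α φ n x := by
  induction n using Int.induction_on with
  | zero => rw [h0, birkhoff_zero]
  | succ n ih => rw [hu, ih, birkhoff_add_one]
  | pred n ih =>
    have hu' := hu (-n - 1)
    have hb := birkhoff_add_one α φ (-n - 1) x
    rw [sub_add_cancel] at hu' hb
    linarith

lemma birkhoff_add (n m : ℤ) (x : UnitAddCircle) :
    birkhoff α φ (n + m) x = birkhoff α φ n x + birkhoff α φ m (x + n • (α : UnitAddCircle)) := by
  rw [← eq_birkhoff_of_add_one (u := fun k => birkhoff α φ (n + k) x - birkhoff α φ n x)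
    (by simp) (fun k => ?_) m, add_sub_cancel]
  rw [← add_assoc, birkhoff_add_one, add_smul, ← add_assoc]
  ring

lemma birkhoff_const (c : ℝ) (n : ℤ) (x : UnitAddCircle) :
    birkhoff α (fun _ => c) n x = n * c :=
  (eq_birkhoff_of_add_one (u := fun n => n * c) (by simp) (fun n => by push_cast; ring) n).symm

lemma continuous_birkhoff (hφ : Continuous φ) (n : ℤ) : Continuous (birkhoff α φ n) := by
  cases n
  · change Continuous fun x => ∑ k ∈ Finset.range _, φ (x + (((k : ℝ) * α : ℝ) : UnitAddCircle))
    fun_prop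
  · change Continuous fun x =>
      -∑ k ∈ Finset.range (_ + 1), φ (x - ((((k : ℝ) + 1) * α : ℝ) : UnitAddCircle))
    fun_prop

lemma strictMono_birkhoff (hpos : ∀ x, 0 < φ x) (x : UnitAddCircle) :
    StrictMono fun n => birkhoff α φ n x :=
  strictMono_int_of_lt_succ fun n => by
    rw [birkhoff_add_one]
    linarith [hpos (x + n • (α : UnitAddCircle))]

lemma monotone_birkhoff_sub {ρ : ℝ} (hρ : ∀ x, ρ ≤ φ x) (x : UnitAddCircle) :
    Monotone fun n : ℤ => birkhoff α φ n x - n * ρ :=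
  monotone_int_of_le_succ fun n => by
    rw [birkhoff_add_one]
    push_cast
    linarith [hρ (x + n • (α : UnitAddCircle))]

end Birkhoff

section Skew

/-- The action of `ℤ` on `𝕋 × ℝ` generated by the skew product `(x, s) ↦ (x + α, s - φ x)`; its
orbits are the classes of the identification `(x, s + φ x) ∼ (x + α, s)`. -/
def skew (α : ℝ) (φ : UnitAddCircle → ℝ) (n : ℤ) (p : UnitAddCircle × ℝ) : UnitAddCircle × ℝ :=
  (p.1 + n • (α : UnitAddCircle), p.2 - birkhoff α φ n p.1)

variable {α : ℝ} {φ : UnitAddCircle → ℝ}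

lemma skew_zero (p : UnitAddCircle × ℝ) : skew α φ 0 p = p := by
  simp [skew, birkhoff_zero]

lemma skew_one (p : UnitAddCircle × ℝ) :
    skew α φ 1 p = (p.1 + (α : UnitAddCircle), p.2 - φ p.1) := by
  have hone := birkhoff_add_one α φ 0 p.1
  rw [zero_add, birkhoff_zero, zero_add, zero_smul, add_zero] at hone
  rw [skew, one_smul, hone]

lemma skew_skew (n m : ℤ) (p : UnitAddCircle × ℝ) :
    skew α φ m (skew α φ n p) = skew α φ (n + m) p := by
  simp only [skew, birkhoff_add, add_smul, add_assoc, sub_sub]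

lemma skew_add_snd (n : ℤ) (p : UnitAddCircle × ℝ) (t : ℝ) :
    skew α φ n (p.1, p.2 + t) = ((skew α φ n p).1, (skew α φ n p).2 + t) := by
  rw [skew, skew, sub_add_eq_add_sub]

lemma proj_eq_skew (p : UnitAddCircle × ℝ) :
    proj α φ p = skew α φ (returnIndex α φ p.1 p.2) p := by
  rw [proj, skew, ← AddCircle.coe_zsmul, zsmul_eq_mul]

lemma measurable_skew (hφ : Continuous φ) (n : ℤ) : Measurable (skew α φ n) := by
  have := continuous_birkhoff (α := α) hφ n
  unfold skew
  fun_prop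

lemma measurePreserving_add_prod (a : UnitAddCircle) {h : UnitAddCircle → ℝ} (hh : Measurable h) :
    MeasurePreserving (fun p : UnitAddCircle × ℝ => (p.1 + a, p.2 + h p.1)) :=
  (measurePreserving_add_right volume a).skew_product (g := fun x s => s + h x)
    (measurable_snd.add (hh.comp measurable_fst))
    (Eventually.of_forall fun x => (measurePreserving_add_right volume (h x)).map_eq)

lemma measurePreserving_skew (hφ : Continuous φ) (n : ℤ) : MeasurePreserving (skew α φ n) :=
  measurePreserving_add_prod (n • (α : UnitAddCircle)) (continuous_birkhoff hφ n).neg.measurable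

lemma measurableSet_region (hφ : Continuous φ) : MeasurableSet (region φ) :=
  (measurableSet_le measurable_const measurable_snd).inter
    (measurableSet_lt measurable_snd (hφ.measurable.comp measurable_fst))

end Skew

section Proj

variable {α : ℝ} {φ : UnitAddCircle → ℝ}

lemma exists_pos_forall_le (hφ : Continuous φ) (hpos : ∀ x, 0 < φ x) : ∃ ρ > 0, ∀ x, ρ ≤ φ x := by
  obtain ⟨x, -, hx⟩ := isCompact_univ.exists_isMinOn Set.univ_nonempty hφ.continuousOn
  exact ⟨φ x, hpos x, fun y => hx (Set.mem_univ y)⟩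

lemma returnIndex_spec (hφ : Continuous φ) (hpos : ∀ x, 0 < φ x) (x : UnitAddCircle) (u : ℝ) :
    birkhoff α φ (returnIndex α φ x u) x ≤ u ∧ u < birkhoff α φ (returnIndex α φ x u + 1) x := by
  obtain ⟨ρ, hρ0, hρ⟩ := exists_pos_forall_le hφ hpos
  have hmono := monotone_birkhoff_sub (α := α) hρ x
  have hne : {n : ℤ | birkhoff α φ n x ≤ u}.Nonempty := by
    obtain ⟨k, hk⟩ := exists_nat_ge (-u / ρ)
    rw [div_le_iff₀ hρ0] at hk
    have hle := hmono (show (-k : ℤ) ≤ 0 by lia)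
    simp only [birkhoff_zero] at hle
    push_cast at hle
    exact ⟨-k, show birkhoff α φ (-k) x ≤ u by linarith⟩
  have hbdd : BddAbove {n : ℤ | birkhoff α φ n x ≤ u} := by
    obtain ⟨k, hk⟩ := exists_nat_gt (u / ρ)
    rw [div_lt_iff₀ hρ0] at hk
    have hle := hmono (show (0 : ℤ) ≤ k by lia)
    simp only [birkhoff_zero] at hle
    push_cast at hle
    refine ⟨k, fun n (hn : birkhoff α φ n x ≤ u) => ?_⟩
    exact ((strictMono_birkhoff hpos x).lt_iff_lt.1 (by linarith : _ < birkhoff α φ k x)).le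
  refine ⟨Int.csSup_mem hne hbdd, ?_⟩
  by_contra! hle
  exact (lt_add_one (returnIndex α φ x u)).not_ge (le_csSup hbdd hle)

lemma returnIndex_eq_iff (hφ : Continuous φ) (hpos : ∀ x, 0 < φ x) {x : UnitAddCircle} {u : ℝ}
    {n : ℤ} : returnIndex α φ x u = n ↔ birkhoff α φ n x ≤ u ∧ u < birkhoff α φ (n + 1) x := by
  constructor
  · rintro rfl
    exact returnIndex_spec hφ hpos x u
  · rintro ⟨hn, hn'⟩
    obtain ⟨hr, hr'⟩ := returnIndex_spec (α := α) hφ hpos x u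
    have hmono := strictMono_birkhoff (α := α) hpos x
    have hlt := hmono.lt_iff_lt.1 (hn.trans_lt hr')
    have hgt := hmono.lt_iff_lt.1 (hr.trans_lt hn')
    lia

lemma skew_mem_region_iff (hφ : Continuous φ) (hpos : ∀ x, 0 < φ x) {p : UnitAddCircle × ℝ}
    {n : ℤ} : skew α φ n p ∈ region φ ↔ returnIndex α φ p.1 p.2 = n := by
  rw [returnIndex_eq_iff hφ hpos, birkhoff_add_one]
  simp only [region, skew, Set.mem_ofPred_eq, sub_nonneg, sub_lt_iff_lt_add']

lemma proj_mem_region (hφ : Continuous φ) (hpos : ∀ x, 0 < φ x) (p : UnitAddCircle × ℝ) :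
    proj α φ p ∈ region φ := by
  rw [proj_eq_skew, skew_mem_region_iff hφ hpos]

lemma proj_eq_of_skew_mem_region (hφ : Continuous φ) (hpos : ∀ x, 0 < φ x)
    {p : UnitAddCircle × ℝ} {n : ℤ} (h : skew α φ n p ∈ region φ) :
    proj α φ p = skew α φ n p := by
  rw [proj_eq_skew, (skew_mem_region_iff hφ hpos).1 h]

lemma proj_eq_self (hφ : Continuous φ) (hpos : ∀ x, 0 < φ x) {p : UnitAddCircle × ℝ}
    (h : p ∈ region φ) : proj α φ p = p := by
  rw [proj_eq_of_skew_mem_region (n := 0) hφ hpos (by rwa [skew_zero]), skew_zero]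

lemma proj_skew (hφ : Continuous φ) (hpos : ∀ x, 0 < φ x) (n : ℤ) (p : UnitAddCircle × ℝ) :
    proj α φ (skew α φ n p) = proj α φ p := by
  have hskew : skew α φ (returnIndex α φ p.1 p.2 - n) (skew α φ n p) = proj α φ p := by
    rw [skew_skew, add_sub_cancel, proj_eq_skew]
  have hmem := hskew ▸ proj_mem_region hφ hpos p
  rw [proj_eq_of_skew_mem_region hφ hpos hmem, hskew]

lemma flow_proj (hφ : Continuous φ) (hpos : ∀ x, 0 < φ x) (t : ℝ) (p : UnitAddCircle × ℝ) :
    flow α φ t (proj α φ p) = proj α φ (p.1, p.2 + t) := by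
  rw [flow, proj_eq_skew p, ← skew_add_snd, proj_skew hφ hpos]

lemma measurable_proj (hφ : Continuous φ) (hpos : ∀ x, 0 < φ x) : Measurable (proj α φ) := by
  have hindex : Measurable fun p : UnitAddCircle × ℝ => returnIndex α φ p.1 p.2 := by
    refine measurable_to_countable' fun n => ?_
    convert measurable_skew (α := α) hφ n (measurableSet_region hφ) using 1
    ext p
    exact (skew_mem_region_iff hφ hpos).symm
  have hskew : Measurable fun q : ℤ × (UnitAddCircle × ℝ) => skew α φ q.1 q.2 :=
    measurable_from_prod_countable_right fun n => measurable_skew hφ n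
  rw [funext proj_eq_skew]
  exact hskew.comp (hindex.prodMk measurable_id)

end Proj

/-! ### Cohomologous roof functions -/

section Transfer

/-- `ψ` is a transfer function from `φ₁` to `φ₂` over the rotation by `α`: it solves the additive
cohomological equation with right-hand side `φ₁ - φ₂` almost everywhere. -/
def IsTransfer (α : ℝ) (ψ φ₁ φ₂ : UnitAddCircle → ℝ) : Prop :=
  ∀ᵐ x, ψ (x + (α : UnitAddCircle)) - ψ x = φ₁ x - φ₂ x

/-- The displacement `(x, s) ↦ (x, s + ψ x)` of `L2Conjugate`, before projection. -/
def shear (ψ : UnitAddCircle → ℝ) (p : UnitAddCircle × ℝ) : UnitAddCircle × ℝ :=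
  (p.1, p.2 + ψ p.1)

/-- The additive action `skew α φ`; not an instance, as it depends on `α` and `φ`. -/
abbrev skewAction (α : ℝ) (φ : UnitAddCircle → ℝ) : AddAction ℤ (UnitAddCircle × ℝ) where
  vadd := skew α φ
  zero_vadd := skew_zero
  add_vadd n m p := by
    change skew α φ (n + m) p = skew α φ n (skew α φ m p)
    rw [skew_skew, add_comm]

variable {α : ℝ} {φ φ₁ φ₂ ψ : UnitAddCircle → ℝ}

lemma shear_neg_shear (ψ : UnitAddCircle → ℝ) (p : UnitAddCircle × ℝ) :
    shear (-ψ) (shear ψ p) = p := by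
  simp [shear]

lemma measurePreserving_shear (hψ : Measurable ψ) : MeasurePreserving (shear ψ) := by
  unfold shear
  simpa using measurePreserving_add_prod 0 hψ

lemma isTransfer_const (c : ℝ) : IsTransfer α (fun _ => c) φ φ :=
  Eventually.of_forall fun x => by simp

lemma IsTransfer.neg (h : IsTransfer α ψ φ₁ φ₂) : IsTransfer α (-ψ) φ₂ φ₁ := by
  filter_upwards [h] with x hx
  rw [Pi.neg_apply, Pi.neg_apply]
  linarith

lemma ae_prod_of_ae {P : UnitAddCircle → Prop} (h : ∀ᵐ x, P x) :
    ∀ᵐ p : UnitAddCircle × ℝ, P p.1 :=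
  (Measure.quasiMeasurePreserving_fst (μ := (volume : Measure UnitAddCircle))
    (ν := (volume : Measure ℝ))).ae h

lemma IsTransfer.ae_shear_skew (h : IsTransfer α ψ φ₁ φ₂) :
    ∀ᵐ p : UnitAddCircle × ℝ, ∀ n : ℤ, shear ψ (skew α φ₁ n p) = skew α φ₂ n (shear ψ p) := by
  have hall : ∀ᵐ x : UnitAddCircle, ∀ n : ℤ, ψ (x + n • (α : UnitAddCircle) + (α : UnitAddCircle))
      - ψ (x + n • (α : UnitAddCircle))
      = φ₁ (x + n • (α : UnitAddCircle)) - φ₂ (x + n • (α : UnitAddCircle)) :=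
    ae_all_iff.2 fun n =>
      (measurePreserving_add_right volume (n • (α : UnitAddCircle))).quasiMeasurePreserving.ae
        (p := fun x => ψ (x + (α : UnitAddCircle)) - ψ x = φ₁ x - φ₂ x) h
  filter_upwards [ae_prod_of_ae hall] with p hp n
  have hbirkhoff := eq_birkhoff_of_add_one (α := α) (φ := φ₂) (x := p.1) (n := n)
    (u := fun n => birkhoff α φ₁ n p.1 - (ψ (p.1 + n • (α : UnitAddCircle)) - ψ p.1))
    (by simp [birkhoff_zero]) fun n => by
      rw [birkhoff_add_one, add_smul, one_smul, ← add_assoc]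
      linarith [hp n]
  simp only [shear, skew, ← hbirkhoff, Prod.mk.injEq, true_and]
  ring

open scoped Pointwise in
lemma IsTransfer.isAddFundamentalDomain (h : IsTransfer α ψ φ₁ φ₂) (hφ₂ : Continuous φ₂)
    (hpos₂ : ∀ x, 0 < φ₂ x) (hψ : Measurable ψ) :
    letI := skewAction α φ₁
    IsAddFundamentalDomain ℤ (shear ψ ⁻¹' region φ₂) volume := by
  let := skewAction α φ₁
  have hindex : ∀ᵐ p : UnitAddCircle × ℝ, ∀ n : ℤ, skew α φ₁ n p ∈ shear ψ ⁻¹' region φ₂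
      ↔ returnIndex α φ₂ (shear ψ p).1 (shear ψ p).2 = n := by
    filter_upwards [h.ae_shear_skew] with p hp n
    rw [Set.mem_preimage, hp, skew_mem_region_iff hφ₂ hpos₂]
  refine ⟨((measurePreserving_shear hψ).measurable (measurableSet_region hφ₂)).nullMeasurableSet,
    ?_, ?_⟩
  · filter_upwards [hindex] with p hp
    exact ⟨_, (hp _).2 rfl⟩
  · intro n m hnm
    refine measure_eq_zero_iff_ae_notMem.2 ?_
    filter_upwards [hindex] with p hp hpnm
    have hk {k : ℤ} (hpk : p ∈ k +ᵥ shear ψ ⁻¹' region φ₂) :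
        returnIndex α φ₂ (shear ψ p).1 (shear ψ p).2 = -k :=
      (hp (-k)).1 (Set.mem_vadd_set_iff_neg_vadd_mem.1 hpk)
    exact hnm (neg_injective ((hk hpnm.1).symm.trans (hk hpnm.2)))

lemma measurableConstVAdd_skewAction (hφ : Continuous φ) :
    letI := skewAction α φ
    MeasurableConstVAdd ℤ (UnitAddCircle × ℝ) :=
  letI := skewAction α φ
  ⟨fun n => measurable_skew hφ n⟩

lemma vaddInvariantMeasure_skewAction (hφ : Continuous φ) :
    letI := skewAction α φ
    VAddInvariantMeasure ℤ (UnitAddCircle × ℝ) volume :=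
  letI := skewAction α φ
  ⟨fun n _ hs => (measurePreserving_skew hφ n).measure_preimage hs.nullMeasurableSet⟩

lemma isAddFundamentalDomain_region (hφ : Continuous φ) (hpos : ∀ x, 0 < φ x) :
    letI := skewAction α φ
    IsAddFundamentalDomain ℤ (region φ) volume := by
  convert (isTransfer_const (α := α) (φ := φ) 0).isAddFundamentalDomain hφ hpos measurable_const
    using 1
  ext p
  simp [shear]

lemma measure_proj_preimage_inter_region (hφ : Continuous φ) (hpos : ∀ x, 0 < φ x)
    {D A : Set (UnitAddCircle × ℝ)} (hA : MeasurableSet A)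
    (hD : letI := skewAction α φ; IsAddFundamentalDomain ℤ D volume) :
    volume (proj α φ ⁻¹' A ∩ D) = volume (A ∩ region φ) := by
  let := skewAction α φ
  have := measurableConstVAdd_skewAction (α := α) hφ
  have := vaddInvariantMeasure_skewAction (α := α) hφ
  have hinv (n : ℤ) : (fun p => n +ᵥ p) ⁻¹' (proj α φ ⁻¹' A) = proj α φ ⁻¹' A := by
    rw [← Set.preimage_comp]
    exact congrArg (· ⁻¹' A) (funext fun p => proj_skew hφ hpos n p)
  have hregion : proj α φ ⁻¹' A ∩ region φ = A ∩ region φ := by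
    ext p
    exact and_congr_left fun hp => by rw [Set.mem_preimage, proj_eq_self hφ hpos hp]
  rw [hD.measure_set_eq (isAddFundamentalDomain_region hφ hpos) (measurable_proj hφ hpos hA) hinv,
    hregion]

lemma IsTransfer.measurePreserving_proj_shear (h : IsTransfer α ψ φ₁ φ₂) (hφ₁ : Continuous φ₁)
    (hpos₁ : ∀ x, 0 < φ₁ x) (hφ₂ : Continuous φ₂) (hpos₂ : ∀ x, 0 < φ₂ x) (hψ : Measurable ψ) :
    MeasurePreserving (fun p => proj α φ₂ (shear ψ p)) (flowMeasure φ₁) (flowMeasure φ₂) := by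
  have hshear := measurePreserving_shear hψ
  have hproj : Measurable (proj α φ₂) := measurable_proj hφ₂ hpos₂
  have hD := h.neg.isAddFundamentalDomain hφ₁ hpos₁ hψ.neg
  have hDm : MeasurableSet (shear (-ψ) ⁻¹' region φ₁) :=
    (measurePreserving_shear hψ.neg).measurable (measurableSet_region hφ₁)
  have hmeas : Measurable fun p => proj α φ₂ (shear ψ p) := hproj.comp hshear.measurable
  have hregion : shear ψ ⁻¹' (shear (-ψ) ⁻¹' region φ₁) = region φ₁ := by
    ext p
    rw [Set.mem_preimage, Set.mem_preimage, shear_neg_shear]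
  refine ⟨hmeas, Measure.ext fun A hA => ?_⟩
  rw [Measure.map_apply hmeas hA, flowMeasure, flowMeasure, Measure.restrict_apply (hmeas hA),
    Measure.restrict_apply hA, ← measure_proj_preimage_inter_region hφ₂ hpos₂ hA hD,
    ← hshear.measure_preimage ((hproj hA).inter hDm).nullMeasurableSet, Set.preimage_inter, hregion]
  rfl

lemma measurePreserving_flow (hφ : Continuous φ) (hpos : ∀ x, 0 < φ x) (t : ℝ) :
    MeasurePreserving (flow α φ t) (flowMeasure φ) (flowMeasure φ) :=
  (isTransfer_const t).measurePreserving_proj_shear hφ hpos hφ hpos measurable_const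

lemma ae_mem_region (hφ : Continuous φ) : ∀ᵐ p ∂(flowMeasure φ), p ∈ region φ :=
  ae_restrict_mem (measurableSet_region hφ)

lemma IsTransfer.ae_proj_shear_neg_proj_shear (h : IsTransfer α ψ φ₁ φ₂) (hφ₁ : Continuous φ₁)
    (hpos₁ : ∀ x, 0 < φ₁ x) :
    ∀ᵐ p ∂(flowMeasure φ₁), proj α φ₁ (shear (-ψ) (proj α φ₂ (shear ψ p))) = p := by
  filter_upwards [ae_restrict_of_ae h.ae_shear_skew, ae_mem_region hφ₁] with p hp hmem
  rw [proj_eq_skew (φ := φ₂), ← hp, shear_neg_shear, proj_skew hφ₁ hpos₁,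
    proj_eq_self hφ₁ hpos₁ hmem]

lemma IsTransfer.ae_proj_shear_flow (h : IsTransfer α ψ φ₁ φ₂) (hφ₂ : Continuous φ₂)
    (hpos₂ : ∀ x, 0 < φ₂ x) (t : ℝ) :
    ∀ᵐ p ∂(flowMeasure φ₁),
      proj α φ₂ (shear ψ (flow α φ₁ t p)) = flow α φ₂ t (proj α φ₂ (shear ψ p)) := by
  have hshift := (measurePreserving_shear (measurable_const (a := t))).quasiMeasurePreserving.ae
    h.ae_shear_skew
  filter_upwards [ae_restrict_of_ae hshift] with p hp
  have hcomm : shear ψ (p.1, p.2 + t) = ((shear ψ p).1, (shear ψ p).2 + t) := by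
    simp only [shear, add_right_comm]
  rw [flow_proj hφ₂ hpos₂, flow, proj_eq_skew (φ := φ₁), ← hcomm,
    ← proj_skew hφ₂ hpos₂ (returnIndex α φ₁ p.1 (p.2 + t)) (shear ψ (p.1, p.2 + t))]
  exact congrArg (proj α φ₂) (hp _)

theorem IsTransfer.l2Conjugate (h : IsTransfer α ψ φ₁ φ₂) (hφ₁ : Continuous φ₁)
    (hpos₁ : ∀ x, 0 < φ₁ x) (hφ₂ : Continuous φ₂) (hpos₂ : ∀ x, 0 < φ₂ x) (hψ : Measurable ψ)
    (hψ2 : MemLp ψ 2) : L2Conjugate α φ₁ φ₂ := by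
  have hinv := h.neg.ae_proj_shear_neg_proj_shear hφ₂ hpos₂
  rw [neg_neg] at hinv
  exact ⟨fun p => proj α φ₂ (shear ψ p), ψ,
    ⟨h.measurePreserving_proj_shear hφ₁ hpos₁ hφ₂ hpos₂ hψ,
      ⟨fun p => proj α φ₁ (shear (-ψ) p),
        h.neg.measurePreserving_proj_shear hφ₂ hpos₂ hφ₁ hpos₁ hψ.neg,
        h.ae_proj_shear_neg_proj_shear hφ₁ hpos₁, hinv⟩,
      h.ae_proj_shear_flow hφ₂ hpos₂⟩,
    hψ2, Eventually.of_forall fun _ => rfl⟩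

end Transfer

/-! ### Suspension flows -/

section Suspension

variable {α c : ℝ} {φ ψ : UnitAddCircle → ℝ}

lemma eq_sub_of_proj_const_eq (hα : Irrational α) {x : UnitAddCircle} {u v : ℝ}
    (h : proj α (fun _ => c) (x + (α : UnitAddCircle), u) = proj α (fun _ => c) (x, v)) :
    u = v - c := by
  rw [proj_eq_skew, proj_eq_skew, skew, skew, birkhoff_const, birkhoff_const, Prod.mk.injEq] at h
  obtain ⟨hbase, hfiber⟩ := h
  generalize returnIndex α (fun _ => c) (x + (α : UnitAddCircle), u).1
    (x + (α : UnitAddCircle), u).2 = n at hbase hfiber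
  generalize returnIndex α (fun _ => c) (x, v).1 (x, v).2 = m at hbase hfiber
  have hzsmul : (1 + n - m) • (α : UnitAddCircle) = 0 := by
    rw [sub_smul, add_smul, one_smul, sub_eq_zero]
    exact add_left_cancel ((add_assoc _ _ _).symm.trans hbase)
  have hm : m = 1 + n := by
    by_contra hne
    exact (norm_zsmul_pos hα (sub_ne_zero.2 (Ne.symm hne))).ne' (by rw [hzsmul, norm_zero])
  rw [hm] at hfiber
  push_cast at hfiber
  linarith

lemma flow_eq_of_le (hφ : Continuous φ) (hpos : ∀ x, 0 < φ x) {p : UnitAddCircle × ℝ} {t : ℝ}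
    (hle : φ p.1 ≤ p.2 + t) (hlt : p.2 + t < φ p.1 + φ (p.1 + (α : UnitAddCircle))) :
    flow α φ t p = (p.1 + (α : UnitAddCircle), p.2 + t - φ p.1) := by
  have hskew : skew α φ 1 (p.1, p.2 + t) = (p.1 + (α : UnitAddCircle), p.2 + t - φ p.1) :=
    skew_one _
  rw [flow, ← hskew]
  refine proj_eq_of_skew_mem_region hφ hpos ?_
  rw [hskew]
  exact ⟨sub_nonneg.2 hle, sub_lt_iff_lt_add'.2 hlt⟩

lemma ae_of_ae_flowMeasure {P : UnitAddCircle → Prop} (hφ : Continuous φ) {ρ : ℝ} (hρ : 0 < ρ)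
    (hρφ : ∀ x, ρ ≤ φ x) (h : ∀ᵐ p ∂(flowMeasure φ), φ p.1 ≤ p.2 + ρ → P p.1) : ∀ᵐ x, P x := by
  rw [flowMeasure, ae_restrict_iff' (measurableSet_region hφ)] at h
  filter_upwards [Measure.ae_ae_of_ae_prod h] with x hx
  by_contra hP
  have hnull : volume (Set.Ico (φ x - ρ) (φ x)) = 0 := by
    refine measure_eq_zero_iff_ae_notMem.2 ?_
    filter_upwards [hx] with s hs hmem
    exact hP (hs ⟨(sub_nonneg.2 (hρφ x)).trans hmem.1, hmem.2⟩ (sub_le_iff_le_add.1 hmem.1))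
  rw [Real.volume_Ico, sub_sub_cancel, ENNReal.ofReal_eq_zero] at hnull
  exact hnull.not_gt hρ

-- Compare the displacements of a point just below the roof and of its image just after the jump.
lemma isTransfer_of_isConjugacy (hα : Irrational α) (hφ : Continuous φ) (hpos : ∀ x, 0 < φ x)
    (hc : 0 < c) {h : UnitAddCircle × ℝ → UnitAddCircle × ℝ}
    (hconj : IsConjugacy (flow α φ) (flowMeasure φ) (flow α fun _ => c) (flowMeasure fun _ => c) h)
    (hψ : ∀ᵐ p ∂(flowMeasure φ), h p = proj α (fun _ => c) (p.1, p.2 + ψ p.1)) :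
    IsTransfer α ψ φ fun _ => c := by
  obtain ⟨ρ, hρ, hρφ⟩ := exists_pos_forall_le hφ hpos
  refine ae_of_ae_flowMeasure hφ hρ hρφ ?_
  have hψflow := (measurePreserving_flow (α := α) hφ hpos ρ).quasiMeasurePreserving.ae hψ
  filter_upwards [hconj.2.2 ρ, hψflow, hψ, ae_mem_region hφ] with p hcomm hp' hp hmem hle
  have hjump : flow α φ ρ p = (p.1 + (α : UnitAddCircle), p.2 + ρ - φ p.1) :=
    flow_eq_of_le hφ hpos hle (by linarith [hρφ (p.1 + (α : UnitAddCircle)), hmem.2])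
  rw [hp', hp, hjump, flow_proj continuous_const fun _ => hc] at hcomm
  linarith [eq_sub_of_proj_const_eq hα hcomm]

theorem summable_of_l2ConjugateToSuspension (hα : Irrational α) (hφ : Continuous φ)
    (hpos : ∀ x, 0 < φ x) (h : L2ConjugateToSuspension α φ) :
    Summable fun m : ℤ => ‖formalCoeff α φ m‖ ^ 2 := by
  obtain ⟨c, hc, h, ψ, hconj, hψ2, hψ⟩ := h
  exact summable_formalCoeff_of_coboundary hα (integrable_of_continuous hφ) hψ2
    (isTransfer_of_isConjugacy hα hφ hpos hc hconj hψ)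

lemma coeff_zero_re_pos (hφ : Continuous φ) (hpos : ∀ x, 0 < φ x) : 0 < (coeff φ 0).re := by
  obtain ⟨ρ, hρ, hρφ⟩ := exists_pos_forall_le hφ hpos
  have hmean := integral_mono (integrable_const ρ) (integrable_of_continuous hφ) hρφ
  rw [integral_const, probReal_univ, one_smul] at hmean
  rw [coeff_zero, Complex.ofReal_re]
  exact hρ.trans_le hmean

theorem l2ConjugateToSuspension_of_summable (hα : Irrational α) (hφ : Continuous φ)
    (hpos : ∀ x, 0 < φ x) (h : Summable fun m : ℤ => ‖formalCoeff α φ m‖ ^ 2) :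
    L2ConjugateToSuspension α φ := by
  obtain ⟨ψ, hψm, hψ2, hψ⟩ := exists_memLp_coboundary hα (memLp_of_continuous hφ 2) h
  have hc := coeff_zero_re_pos hφ hpos
  exact ⟨_, hc, IsTransfer.l2Conjugate hψ hφ hpos continuous_const (fun _ => hc) hψm hψ2⟩

lemma flowMeasure_const_univ (c : ℝ) :
    flowMeasure (fun _ => c) Set.univ = ENNReal.ofReal c := by
  have hregion : region (fun _ => c) = Set.univ ×ˢ Set.Ico 0 c := by
    ext p
    simp [region]
  rw [flowMeasure, Measure.restrict_apply_univ, hregion, Measure.volume_eq_prod,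
    Measure.prod_prod, UnitAddCircle.measure_univ, Real.volume_Ico, one_mul, sub_zero]

lemma exp_flow_const (hc : c ≠ 0) (t : ℝ) (p : UnitAddCircle × ℝ) :
    Complex.exp (2 * π * Complex.I * (1 / c : ℝ) * (flow α (fun _ => c) t p).2)
      = Complex.exp (2 * π * Complex.I * (1 / c : ℝ) * t)
        * Complex.exp (2 * π * Complex.I * (1 / c : ℝ) * p.2) := by
  rw [flow, proj_eq_skew, skew, birkhoff_const]
  generalize returnIndex α (fun _ => c) (p.1, p.2 + t).1 (p.1, p.2 + t).2 = n
  have hc' : (c : ℂ) ≠ 0 := by exact_mod_cast hc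
  rw [← exp_add, Complex.exp_eq_exp_iff_exists_int]
  refine ⟨-n, ?_⟩
  push_cast
  field_simp
  ring

lemma not_weakMixing_flow_const (hc : 0 < c) :
    ¬ WeakMixing (flow α fun _ => c) (flowMeasure fun _ => c) := by
  intro hwm
  have : IsFiniteMeasure (flowMeasure fun _ => c) :=
    ⟨by rw [flowMeasure_const_univ]; exact ENNReal.ofReal_lt_top⟩
  have : NeZero (flowMeasure fun _ => c) := ⟨fun hzero => by
    have huniv := flowMeasure_const_univ c
    rw [hzero, Measure.coe_zero, Pi.zero_apply] at huniv
    exact (ENNReal.ofReal_pos.2 hc).ne huniv⟩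
  have hcont : Continuous fun p : UnitAddCircle × ℝ =>
      Complex.exp (2 * π * Complex.I * (1 / c : ℝ) * p.2) := by fun_prop
  obtain ⟨k, hk⟩ := hwm (1 / c) _
    (MemLp.of_bound hcont.aestronglyMeasurable 1
      (Eventually.of_forall fun p => (norm_exp_eq_one _ _).le))
    (fun t => Eventually.of_forall fun p => exp_flow_const hc.ne' t p)
  -- Flowing for time `c / 2` changes the sign of the eigenfunction.
  have hflow := (measurePreserving_flow (α := α) continuous_const (fun _ => hc)
    (c / 2)).quasiMeasurePreserving.ae hk
  obtain ⟨p, hp, hp'⟩ := (hk.and hflow).exists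
  have hc' : (c : ℂ) ≠ 0 := by exact_mod_cast hc.ne'
  have hhalf : 2 * π * Complex.I * (1 / c : ℝ) * (c / 2 : ℝ) = π * Complex.I := by
    push_cast
    field_simp
  rw [exp_flow_const hc.ne', hp, hhalf, Complex.exp_pi_mul_I, neg_one_mul, neg_eq_self] at hp'
  exact Complex.exp_ne_zero _ (hp.trans hp')

lemma WeakMixing.of_isConjugacy {X Y : Type*} [MeasurableSpace X] [MeasurableSpace Y]
    {T : ℝ → X → X} {μ : Measure X} {S : ℝ → Y → Y} {ν : Measure Y} {h : X → Y}
    (hT : WeakMixing T μ) (hconj : IsConjugacy T μ S ν h) : WeakMixing S ν := by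
  obtain ⟨hh, ⟨g, hg, -, hhg⟩, hcomm⟩ := hconj
  intro θ f hf hfe
  obtain ⟨k, hk⟩ := hT θ (f ∘ h) (hf.comp_measurePreserving hh) fun t => by
    filter_upwards [hcomm t, hh.quasiMeasurePreserving.ae (hfe t)] with p hp hfp
    rw [Function.comp, Function.comp, hp, hfp]
  refine ⟨k, ?_⟩
  filter_upwards [hg.quasiMeasurePreserving.ae hk, hhg] with q hq hhgq
  rw [← hq, Function.comp, hhgq]

lemma not_weakMixing_of_l2ConjugateToSuspension (h : L2ConjugateToSuspension α φ) :
    ¬ WeakMixing (flow α φ) (flowMeasure φ) := by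
  obtain ⟨c, hc, h, ψ, hconj, -, -⟩ := h
  exact fun hwm => not_weakMixing_flow_const hc (hwm.of_isConjugacy hconj)

end Suspension

/-! ### Eigenfunctions of special flows -/

section Eigenfunction

lemma exists_ae_eq_comp_fst_of_translate {X E : Type*} [MeasurableSpace X] {μ : Measure X}
    [SFinite μ] [NormedAddCommGroup E] [NormedSpace ℝ E] [CompleteSpace E] {g : X × ℝ → E}
    (hg : StronglyMeasurable g)
    (h : ∀ t : ℝ, ∀ᵐ p ∂(μ.prod volume), g (p.1, p.2 + t) = g p) :
    ∃ G : X → E, StronglyMeasurable G ∧ ∀ᵐ x ∂μ, ∀ᵐ u : ℝ, g (x, u) = G x := by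
  have hset : MeasurableSet {q : ℝ × (X × ℝ) | g (q.2.1, q.2.2 + q.1) = g q.2} :=
    (hg.comp_measurable (by fun_prop)).measurableSet_eq_fun (hg.comp_measurable measurable_snd)
  have hswap : ∀ᵐ p ∂(μ.prod volume), ∀ᵐ t : ℝ, g (p.1, p.2 + t) = g p :=
    (Measure.ae_ae_comm hset).1 (Eventually.of_forall h)
  refine ⟨fun x => ∫ u in Set.Icc (0 : ℝ) 1, g (x, u),
    hg.integral_prod_right', ?_⟩
  filter_upwards [Measure.ae_ae_of_ae_prod hswap] with x hx
  obtain ⟨s, hs⟩ := hx.exists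
  have hconst : ∀ᵐ u : ℝ, g (x, u) = g (x, s) := by
    filter_upwards [(measurePreserving_add_right (volume : Measure ℝ)
      (-s)).quasiMeasurePreserving.ae hs] with u hu
    rwa [add_comm u, add_neg_cancel_left] at hu
  have hmean : ∫ u in Set.Icc (0 : ℝ) 1, g (x, u) = g (x, s) := by
    rw [integral_congr_ae (ae_restrict_of_ae hconst)]
    simp
  rwa [hmean]

variable {α ν : ℝ} {φ : UnitAddCircle → ℝ}

lemma quasiMeasurePreserving_proj (hφ : Continuous φ) (hpos : ∀ x, 0 < φ x) :
    Measure.QuasiMeasurePreserving (proj α φ) volume (flowMeasure φ) := by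
  let := skewAction α φ
  have := measurableConstVAdd_skewAction (α := α) hφ
  have := vaddInvariantMeasure_skewAction (α := α) hφ
  refine ⟨measurable_proj hφ hpos, Measure.AbsolutelyContinuous.mk fun A hA hzero => ?_⟩
  rw [Measure.map_apply (measurable_proj hφ hpos) hA]
  refine (isAddFundamentalDomain_region hφ hpos).measure_zero_of_invariant _ (fun n => ?_) ?_
  · ext p
    rw [Set.mem_vadd_set_iff_neg_vadd_mem, Set.mem_preimage, Set.mem_preimage]
    exact iff_of_eq (congrArg (· ∈ A) (proj_skew hφ hpos (-n) p))
  · rwa [measure_proj_preimage_inter_region hφ hpos hA (isAddFundamentalDomain_region hφ hpos),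
      ← Measure.restrict_apply hA]

-- In the coordinates `(x, s)`, the function `e^{-2πiνs} f` does not depend on `s`.
lemma exists_cocycle_of_eigenfunction (hφ : Continuous φ) (hpos : ∀ x, 0 < φ x)
    {f : UnitAddCircle × ℝ → ℂ} (hf : StronglyMeasurable f)
    (hfe : ∀ t : ℝ, ∀ᵐ p ∂(flowMeasure φ),
      f (flow α φ t p) = Complex.exp (2 * π * Complex.I * ν * t) * f p) :
    ∃ G : UnitAddCircle → ℂ, StronglyMeasurable G ∧
      (∀ᵐ x, G (x + (α : UnitAddCircle)) = Complex.exp (2 * π * Complex.I * ν * φ x) * G x) ∧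
      ∀ᵐ p ∂(flowMeasure φ), f p = Complex.exp (2 * π * Complex.I * ν * p.2) * G p.1 := by
  set g : UnitAddCircle × ℝ → ℂ := fun p =>
    Complex.exp (2 * π * Complex.I * ν * (-p.2 : ℝ)) * f (proj α φ p) with hg
  have hgm : StronglyMeasurable g :=
    (by fun_prop : Continuous fun p : UnitAddCircle × ℝ =>
      Complex.exp (2 * π * Complex.I * ν * (-p.2 : ℝ))).stronglyMeasurable.mul
        (hf.comp_measurable (measurable_proj hφ hpos))
  have hinv (t : ℝ) : ∀ᵐ p : UnitAddCircle × ℝ, g (p.1, p.2 + t) = g p := by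
    filter_upwards [(quasiMeasurePreserving_proj hφ hpos).ae (hfe t)] with p hp
    have hsplit : -p.2 = -(p.2 + t) + t := by ring
    simp only [hg]
    rw [← flow_proj hφ hpos, hp, ← mul_assoc, ← exp_add, ← hsplit]
  obtain ⟨G, hGm, hG⟩ := exists_ae_eq_comp_fst_of_translate hgm hinv
  refine ⟨G, hGm, ?_, ?_⟩
  · filter_upwards [hG, (measurePreserving_add_right volume
      (α : UnitAddCircle)).quasiMeasurePreserving.ae hG] with x hx hxα
    have hshift := (measurePreserving_add_right (volume : Measure ℝ)
      (-φ x)).quasiMeasurePreserving.ae hxα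
    obtain ⟨u, hu, huα⟩ := (hx.and hshift).exists
    have hskew : (x + (α : UnitAddCircle), u + -φ x) = skew α φ 1 (x, u) := by
      rw [skew_one, sub_eq_add_neg]
    have hsplit : -(u + -φ x) = φ x + -u := by ring
    rw [← hu, ← huα]
    simp only [hg]
    rw [hskew, proj_skew hφ hpos, ← mul_assoc, ← exp_add, hsplit]
  · have hprod : ∀ᵐ p : UnitAddCircle × ℝ, g p = G p.1 :=
      (Measure.ae_prod_iff_ae_ae (hgm.measurableSet_eq_fun
        (hGm.comp_measurable measurable_fst))).2 hG
    filter_upwards [ae_restrict_of_ae hprod, ae_mem_region hφ] with p hp hmem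
    rw [← hp]
    simp only [hg]
    rw [proj_eq_self hφ hpos hmem, ← mul_assoc, ← exp_add, add_neg_cancel]
    simp

lemma ergodic_add_right (hα : Irrational α) :
    Ergodic (fun x : UnitAddCircle => x + (α : UnitAddCircle)) := by
  rw [AddCircle.ergodic_add_right, addOrderOf_eq_zero_iff']
  exact fun n hn hzero => (norm_nsmul_pos hα hn.ne').ne' (by rw [hzero, norm_zero])

lemma ae_eq_zero_of_cocycle_of_not_summable (hα : Irrational α) (hφ : Continuous φ) {C : ℝ}
    (hC : ∀ m : ℤ, ‖coeff φ m‖ * |(m : ℝ)| ^ 3 ≤ C) (h1 : H1 φ)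
    (hns : ¬ Summable fun m : ℤ => ‖formalCoeff α φ m‖ ^ 2) (hν : ν ≠ 0) {G : UnitAddCircle → ℂ}
    (hGm : StronglyMeasurable G)
    (hG : ∀ᵐ x, G (x + (α : UnitAddCircle)) = Complex.exp (2 * π * Complex.I * ν * φ x) * G x) :
    ∀ᵐ x, G x = 0 := by
  have hnorm : (fun x => ‖G x‖) ∘ (· + (α : UnitAddCircle)) =ᵐ[volume] fun x => ‖G x‖ := by
    filter_upwards [hG] with x hx
    rw [Function.comp, hx, norm_mul, norm_exp_eq_one, one_mul]
  obtain ⟨r, hr⟩ := (ergodic_add_right hα).ae_eq_const_of_ae_eq_comp₀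
    hGm.measurable.norm.nullMeasurable hnorm
  rcases eq_or_ne r 0 with rfl | hr0
  · filter_upwards [hr] with x hx
    exact norm_eq_zero.1 hx
  · refine absurd (summable_formalCoeff_of_cocycle hα hφ hC h1 hν (G := fun x => (r : ℂ)⁻¹ * G x)
      (hGm.const_mul _).aestronglyMeasurable ?_ ?_) hns
    · filter_upwards [hr] with x (hx : ‖G x‖ = r)
      rw [norm_mul, norm_inv, Complex.norm_real, ← hx, norm_norm, inv_mul_cancel₀ (hx ▸ hr0)]
    · filter_upwards [hG] with x hx
      rw [hx, mul_left_comm]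

theorem weakMixing_of_not_summable (hα : Irrational α) (hφ : Continuous φ)
    (hpos : ∀ x, 0 < φ x) {C : ℝ} (hC : ∀ m : ℤ, ‖coeff φ m‖ * |(m : ℝ)| ^ 3 ≤ C) (h1 : H1 φ)
    (hns : ¬ Summable fun m : ℤ => ‖formalCoeff α φ m‖ ^ 2) :
    WeakMixing (flow α φ) (flowMeasure φ) := by
  intro ν f hf hfe
  have hmk := hf.1.ae_eq_mk
  obtain ⟨G, hGm, hG, hfG⟩ := exists_cocycle_of_eigenfunction hφ hpos
    hf.1.stronglyMeasurable_mk fun t => by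
      filter_upwards [hfe t, hmk, (measurePreserving_flow (α := α) hφ hpos
        t).quasiMeasurePreserving.ae hmk] with p hp hmkp hmkflow
      rw [← hmkflow, ← hmkp, hp]
  obtain ⟨k, hk⟩ : ∃ k, ∀ᵐ x, ∀ s : ℝ, Complex.exp (2 * π * Complex.I * ν * s) * G x = k := by
    rcases eq_or_ne ν 0 with rfl | hν
    · obtain ⟨k, hk⟩ := (ergodic_add_right hα).ae_eq_const_of_ae_eq_comp₀
        hGm.measurable.nullMeasurable (by filter_upwards [hG] with x hx; simpa using hx)
      exact ⟨k, by filter_upwards [hk] with x hx; simpa using hx⟩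
    · refine ⟨0, ?_⟩
      filter_upwards [ae_eq_zero_of_cocycle_of_not_summable hα hφ hC h1 hns hν hGm hG] with x hx s
      rw [hx, mul_zero]
  refine ⟨k, ?_⟩
  filter_upwards [hmk, hfG, ae_restrict_of_ae (ae_prod_of_ae hk)] with p hmkp hp hkp
  rw [hmkp, hp, hkp]

end Eigenfunction

end SpecialFlow

end

theorem theorem2p1_general {φ : UnitAddCircle → ℝ} (hφ : Continuous φ) (hpos : ∀ x, 0 < φ x)
    {C : ℝ} (hC : ∀ m : ℤ, ‖SpecialFlow.coeff φ m‖ * |(m : ℝ)| ^ 3 ≤ C) (h1 : SpecialFlow.H1 φ)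
    {α : ℝ} (hα : Irrational α) :
    Xor (SpecialFlow.WeakMixing (SpecialFlow.flow α φ) (SpecialFlow.flowMeasure φ))
      (SpecialFlow.L2ConjugateToSuspension α φ) ∧
    (SpecialFlow.L2ConjugateToSuspension α φ ↔
      Summable (fun m : ℤ => ‖SpecialFlow.formalCoeff α φ m‖ ^ 2)) := by
  have hiff : SpecialFlow.L2ConjugateToSuspension α φ ↔
      Summable fun m : ℤ => ‖SpecialFlow.formalCoeff α φ m‖ ^ 2 :=
    ⟨SpecialFlow.summable_of_l2ConjugateToSuspension hα hφ hpos,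
      SpecialFlow.l2ConjugateToSuspension_of_summable hα hφ hpos⟩
  refine ⟨?_, hiff⟩
  by_cases hconj : SpecialFlow.L2ConjugateToSuspension α φ
  · exact Or.inr ⟨hconj, SpecialFlow.not_weakMixing_of_l2ConjugateToSuspension hconj⟩
  · exact Or.inl
      ⟨SpecialFlow.weakMixing_of_not_summable hα hφ hpos hC h1 (hiff.not.1 hconj), hconj⟩

theorem theorem2p1 (φ : UnitAddCircle → ℝ)
    (hφ : ContDiff ℝ 3 (fun x : ℝ => φ (x : UnitAddCircle)))
    (hpos : ∀ x, 0 < φ x)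
    (h1 : SpecialFlow.H1 φ) (h2 : SpecialFlow.H2 φ) (h3 : SpecialFlow.H3 φ)
    (α : ℝ) (hα : Irrational α) :
    Xor (SpecialFlow.WeakMixing (SpecialFlow.flow α φ) (SpecialFlow.flowMeasure φ))
      (SpecialFlow.L2ConjugateToSuspension α φ) ∧
    (SpecialFlow.L2ConjugateToSuspension α φ ↔
      Summable (fun m : ℤ => ‖SpecialFlow.formalCoeff α φ m‖ ^ 2)) := by
  obtain ⟨C, hC⟩ := SpecialFlow.exists_norm_coeff_mul_pow_le (k := 3) hφ
  exact theorem2p1_general (SpecialFlow.continuous_of_continuous_coe hφ.continuous) hpos hC h1 hα
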